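/- For $i=1,2$ let $\Omega_i$ be a complex manifold (Hausdorff and second countable, of dimension $n_i$), let $E_i\to\Omega_i$ be a holomorphic vector bundle of finite rank with a continuous Hermitian metric $h_i$, let $dV_i$ be a continuous (positive) volume form on $\Omega_i$, let $\psi_i:\Omega_i\to[-\infty,+\infty)$ be a measurable function that is locally bounded from above and such that $\{\psi_i=-\infty\}$ has measure zero, and let $S_i\subset\Omega_i$ be an arbitrary closed subset. Let $A^2(\Omega_i,E_i)$ be the space of all holomorphic sections $f$ of $E_i$ with $$\|f\|_{A^2(\Omega_i,E_i)}^2:=\int_{\Omega_i}|f|_{h_i}^2e^{-\psi_i}\,dV_i<+\infty .$$ Let $\Omega=\Omega_1\times\Omega_2$ with projections $p_i:\Omega\to\Omega_i$, let $E=p_1^*E_1\otimes p_2^*E_2$ with the Hermitian metric $h=p_1^*h_1\otimes p_2^*h_2$, let $\psi=p_1^*\psi_1+p_2^*\psi_2$, let $dV=p_1^*dV_1\times p_2^*dV_2$, and let $S=S_1\times S_2$. The space $A^2(\Omega,E)$ and its norm are defined in the same way from $h$, $\psi$, $dV$. For sections $f^{(i)}$ of $E_i$, $f^{(1)}\otimes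 f^{(2)}$ denotes the section $p_1^*f^{(1)}\otimes p_2^*f^{(2)}$ of $E$. For an integer $k$, two holomorphic sections coincide up to order $k$ on a set if, in local coordinates and a local trivialization near each point of the set, all their partial derivatives of order $\le k$ agree at that point; a section vanishes up to order $k$ if it coincides with the zero section up to order $k$. For $k=-1$ this is no condition. Let $f^{(1)}\in A^2(\Omega_1,E_1)$, $f^{(2)}\in A^2(\Omega_2,E_2)$ and integers $m_1,m_2\ge 0$ be given. Then for $i=1,2$ there is a unique element $F^{(i)}$ of minimal norm among the elements of $A^2(\Omega_i,E_i)$ that coincide with $f^{(i)}$ up to order $m_i$ on $S_i$, and there is a unique element $F$ of minimal norm among the elements of $A^2(\Omega,E)$ that coincide with $f^{(1)}\otimes f^{(2)}$ up to order $m_1+m_2$ on $S$. They satisfy $$\|F\|_{A^2(\Omega,E)}\ \ge\ \|F^{(1)}\|_{A^2(\Omega_1,E_1)}\,\|F^{(2)}\|_{A^2(\Omega_2,E_2)} .$$ Moreover, if for both $i=1$ and $i=2$ the section $f^{(i)}$ vanishes up to order $m_i-1$ on $S_i$, then $$F=F^{(1)}\otimes F^{(2)}\quad\text{and}\quad \|F\|_{A^2(\Omega,E)}=\|F^{(1)}\|_{A^2(\Omega_1,E_1)}\,\|F^{(2)}\|_{A^2(\Omega_2,E_2)}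 .$$ -/

import Mathlib

open Bundle Set MeasureTheory Topology
open scoped Manifold ContDiff TensorProduct ENNReal

noncomputable section

namespace BergmanProd

/-! ### Holomorphic sections, jets and Hermitian metrics on vector bundles

Complex manifolds are manifolds over `ℂ` of class `C^ω`, and holomorphic vector bundles are vector
bundles over `ℂ` of class `C^ω`. A Hermitian metric is a family of inner products on the fibres. -/

section General

variable {V : Type*} [NormedAddCommGroup V] [NormedSpace ℂ V] {H : Type*} [TopologicalSpace H]
  (I : ModelWithCorners ℂ V H)
  {M : Type*} [TopologicalSpace M] [ChartedSpace H M]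
  (F : Type*) [NormedAddCommGroup F] [NormedSpace ℂ F]
  {E : M → Type*} [TopologicalSpace (TotalSpace F E)]
  [∀ x, NormedAddCommGroup (E x)] [∀ x, InnerProductSpace ℂ (E x)]
  [FiberBundle F E]

/-- The inner products on the fibres of `E` form a continuous Hermitian metric: with respect to
every local trivialization, the entries of the Gram matrix are continuous. -/
class IsContinuousHermitianBundle (F : Type*) [NormedAddCommGroup F] [NormedSpace ℂ F]
    (E : M → Type*) [TopologicalSpace (TotalSpace F E)]
    [∀ x, NormedAddCommGroup (E x)] [∀ x, InnerProductSpace ℂ (E x)] [FiberBundle F E] :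
    Prop where
  continuousOn_inner : ∀ (e : Trivialization F (π F E)) [MemTrivializationAtlas e] (v w : F),
    ContinuousOn (fun x => inner ℂ (e.symm x v) (e.symm x w)) e.baseSet

/-- `f` is a holomorphic section of `E`, i.e. `f ∈ Γ(M, E)`. -/
def IsHolomorphicSection (f : ∀ x, E x) : Prop :=
  ContMDiff I (I.prod 𝓘(ℂ, F)) ω (fun x => TotalSpace.mk' F x (f x))

/-- The section `f` written in the preferred chart around `x` and the preferred local
trivialization of `E` around `x`. -/
def localRep (x : M) (f : ∀ x, E x) (z : V) : F :=
  (trivializationAt F E x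
    (TotalSpace.mk' F ((extChartAt I x).symm z) (f ((extChartAt I x).symm z)))).2

/-- The holomorphic sections `f` and `g` coincide up to order `k` on `S`: at every point of `S`, all
partial derivatives of order at most `k` (in local coordinates, with respect to a local
trivialization) are the same. For holomorphic sections this does not depend on the choice of the
chart and of the trivialization. The condition is empty for `k < 0`. -/
def CoincideUpTo (k : ℤ) (S : Set M) (f g : ∀ x, E x) : Prop :=
  ∀ x ∈ S, ∀ j : ℕ, (j : ℤ) ≤ k →
    iteratedFDeriv ℂ j (localRep I F x f) (extChartAt I x x) =
      iteratedFDeriv ℂ j (localRep I F x g) (extChartAt I x x)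

/-- The section `f` vanishes up to order `k` on `S`. -/
def VanishesUpTo (k : ℤ) (S : Set M) (f : ∀ x, E x) : Prop :=
  CoincideUpTo I F k S f (fun _ => 0)

variable [MeasurableSpace M] (μ : Measure M) (ψ : M → EReal)

/-- The norm of the Bergman space: `‖f‖ = (∫ |f|² e^{-ψ} dμ)^{1/2}`. -/
def bergmanNorm (f : ∀ x, E x) : ℝ≥0∞ :=
  (∫⁻ x, ‖f x‖ₑ ^ 2 * EReal.exp (-ψ x) ∂μ) ^ (1 / 2 : ℝ)

/-- The Bergman space `A²(M, E; h, e^{-ψ} dμ)` of square integrable holomorphic sections. -/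
def bergmanSpace : Set (∀ x, E x) :=
  {f | IsHolomorphicSection I F f ∧ bergmanNorm μ ψ f < ⊤}

/-- `G` is an element of minimal norm among the elements of the Bergman space that coincide with `f`
up to order `k` on `S`. -/
def IsMinimalExtension (k : ℤ) (S : Set M) (f G : ∀ x, E x) : Prop :=
  G ∈ bergmanSpace I F μ ψ ∧ CoincideUpTo I F k S G f ∧
    ∀ G' ∈ bergmanSpace (E := E) I F μ ψ, CoincideUpTo I F k S G' f →
      bergmanNorm μ ψ G ≤ bergmanNorm μ ψ G'

end General

/-! ### Volume forms and weights -/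

/-- `μ` is the measure of a continuous (positive) volume form on the `n`-dimensional complex
manifold `M`: in every chart it is `ρ dλ` with `ρ` continuous and positive and `dλ` the Lebesgue
measure of `ℂⁿ`. -/
def IsContinuousVolume {n : ℕ} {M : Type*} [TopologicalSpace M] [ChartedSpace (Fin n → ℂ) M]
    [MeasurableSpace M] (μ : Measure M) : Prop :=
  ∀ φ ∈ atlas (Fin n → ℂ) M, ∃ ρ : (Fin n → ℂ) → ℝ,
    ContinuousOn ρ φ.target ∧ (∀ z ∈ φ.target, 0 < ρ z) ∧
    ∀ A ⊆ φ.source, MeasurableSet A → μ A = ∫⁻ z in φ '' A, ENNReal.ofReal (ρ z)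

/-- Admissible weights: measurable functions with values in `[-∞, ∞)`, locally bounded from above,
for which `{ψ = -∞}` is a null set. -/
structure IsWeight {M : Type*} [TopologicalSpace M] [MeasurableSpace M] (μ : Measure M)
    (ψ : M → EReal) : Prop where
  measurable : Measurable ψ
  locally_bdd_above : ∀ x, ∃ C : ℝ, ∀ᶠ y in 𝓝 x, ψ y ≤ (C : EReal)
  null_bot : μ {x | ψ x = ⊥} = 0

/-! ### The external tensor product `p₁^* E₁ ⊗ p₂^* E₂` -/

section Tensor

variable {M₁ M₂ : Type*}

/-- The fibres of `p₁^* E₁ ⊗ p₂^* E₂`, a family over `M₁ × M₂`. -/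
def ExtTensor (E₁ : M₁ → Type*) (E₂ : M₂ → Type*)
    [∀ x, NormedAddCommGroup (E₁ x)] [∀ x, InnerProductSpace ℂ (E₁ x)]
    [∀ y, NormedAddCommGroup (E₂ y)] [∀ y, InnerProductSpace ℂ (E₂ y)]
    (p : M₁ × M₂) : Type _ := E₁ p.1 ⊗[ℂ] E₂ p.2

/-- The weight `p₁^* ψ₁ + p₂^* ψ₂`. -/
def prodWeight (ψ₁ : M₁ → EReal) (ψ₂ : M₂ → EReal) (p : M₁ × M₂) : EReal := ψ₁ p.1 + ψ₂ p.2

variable {E₁ : M₁ → Type*} {E₂ : M₂ → Type*}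
  [∀ x, NormedAddCommGroup (E₁ x)] [∀ x, InnerProductSpace ℂ (E₁ x)]
  [∀ y, NormedAddCommGroup (E₂ y)] [∀ y, InnerProductSpace ℂ (E₂ y)]

instance (p : M₁ × M₂) : NormedAddCommGroup (ExtTensor E₁ E₂ p) :=
  inferInstanceAs (NormedAddCommGroup (E₁ p.1 ⊗[ℂ] E₂ p.2))

/-- The metric `p₁^* h₁ ⊗ p₂^* h₂`: on every fibre it is the inner product with
`⟪a ⊗ b, c ⊗ d⟫ = ⟪a, c⟫ * ⟪b, d⟫`. -/
instance (p : M₁ × M₂) : InnerProductSpace ℂ (ExtTensor E₁ E₂ p) :=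
  inferInstanceAs (InnerProductSpace ℂ (E₁ p.1 ⊗[ℂ] E₂ p.2))

/-- The section `f₁ ⊗ f₂ : (z, w) ↦ f₁ z ⊗ f₂ w`. -/
def tensorSection (f₁ : ∀ x, E₁ x) (f₂ : ∀ y, E₂ y) (p : M₁ × M₂) : ExtTensor E₁ E₂ p :=
  f₁ p.1 ⊗ₜ[ℂ] f₂ p.2

end Tensor

/-- The tensor product of the model fibres, the model fibre of `p₁^* E₁ ⊗ p₂^* E₂`. -/
def TensorFiber (F₁ F₂ : Type*) [NormedAddCommGroup F₁] [InnerProductSpace ℂ F₁]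
    [NormedAddCommGroup F₂] [InnerProductSpace ℂ F₂] : Type _ := F₁ ⊗[ℂ] F₂

theorem contMDiffOn_bilinear {A B C V H M : Type*} [NormedAddCommGroup A] [NormedSpace ℂ A]
    [NormedAddCommGroup B] [NormedSpace ℂ B] [NormedAddCommGroup C] [NormedSpace ℂ C]
    [NormedAddCommGroup V] [NormedSpace ℂ V] [TopologicalSpace H] {I : ModelWithCorners ℂ V H}
    [TopologicalSpace M] [ChartedSpace H M] (L : A →L[ℂ] B →L[ℂ] C) {f : M → A} {g : M → B}
    {s : Set M} (hf : ContMDiffOn I 𝓘(ℂ, A) ω f s) (hg : ContMDiffOn I 𝓘(ℂ, B) ω g s) :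
    ContMDiffOn I 𝓘(ℂ, C) ω (fun p => L (f p) (g p)) s :=
  (L.contMDiff.comp_contMDiffOn hf).clm_apply hg

section Fiber

variable (F₁ F₂ : Type*) [NormedAddCommGroup F₁] [InnerProductSpace ℂ F₁]
  [NormedAddCommGroup F₂] [InnerProductSpace ℂ F₂]

instance : NormedAddCommGroup (TensorFiber F₁ F₂) :=
  inferInstanceAs (NormedAddCommGroup (F₁ ⊗[ℂ] F₂))

instance : InnerProductSpace ℂ (TensorFiber F₁ F₂) :=
  inferInstanceAs (InnerProductSpace ℂ (F₁ ⊗[ℂ] F₂))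

variable {F₁ F₂}

/-- The tensor product of linear maps. -/
def fiberMap (f : F₁ →ₗ[ℂ] F₁) (g : F₂ →ₗ[ℂ] F₂) : TensorFiber F₁ F₂ →ₗ[ℂ] TensorFiber F₁ F₂ :=
  TensorProduct.map f g

theorem fiberMap_add_left (f f' : F₁ →ₗ[ℂ] F₁) (g : F₂ →ₗ[ℂ] F₂) :
    fiberMap (f + f') g = fiberMap f g + fiberMap f' g :=
  TensorProduct.map_add_left f f' g

theorem fiberMap_add_right (f : F₁ →ₗ[ℂ] F₁) (g g' : F₂ →ₗ[ℂ] F₂) :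
    fiberMap f (g + g') = fiberMap f g + fiberMap f g' :=
  TensorProduct.map_add_right f g g'

theorem fiberMap_smul_left (c : ℂ) (f : F₁ →ₗ[ℂ] F₁) (g : F₂ →ₗ[ℂ] F₂) :
    fiberMap (c • f) g = c • fiberMap f g :=
  TensorProduct.map_smul_left c f g

theorem fiberMap_smul_right (c : ℂ) (f : F₁ →ₗ[ℂ] F₁) (g : F₂ →ₗ[ℂ] F₂) :
    fiberMap f (c • g) = c • fiberMap f g :=
  TensorProduct.map_smul_right c f g

variable [FiniteDimensional ℂ F₁] [FiniteDimensional ℂ F₂]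

instance : FiniteDimensional ℂ (TensorFiber F₁ F₂) :=
  inferInstanceAs (Module.Finite ℂ (F₁ ⊗[ℂ] F₂))

/-- `fiberMap f`, as a linear map into the continuous linear maps. -/
def fiberMapAux (f : F₁ →ₗ[ℂ] F₁) :
    (F₂ →L[ℂ] F₂) →ₗ[ℂ] (TensorFiber F₁ F₂ →L[ℂ] TensorFiber F₁ F₂) where
  toFun g := LinearMap.toContinuousLinearMap (fiberMap f g)
  map_add' g g' := by
    rw [ContinuousLinearMap.toLinearMap_add, fiberMap_add_right, map_add]
  map_smul' c g := by
    rw [ContinuousLinearMap.toLinearMap_smul, fiberMap_smul_right, map_smul, RingHom.id_apply]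

theorem fiberMapAux_apply (f : F₁ →ₗ[ℂ] F₁) (g : F₂ →L[ℂ] F₂) (ξ : TensorFiber F₁ F₂) :
    fiberMapAux f g ξ = fiberMap f g ξ := rfl

variable (F₁ F₂) in
/-- The tensor product of continuous linear maps, as a continuous bilinear map. -/
def fiberMapL : (F₁ →L[ℂ] F₁) →L[ℂ] (F₂ →L[ℂ] F₂) →L[ℂ]
    (TensorFiber F₁ F₂ →L[ℂ] TensorFiber F₁ F₂) :=
  LinearMap.toContinuousLinearMap
    { toFun := fun f => LinearMap.toContinuousLinearMap (fiberMapAux (f : F₁ →ₗ[ℂ] F₁))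
      map_add' := fun f f' => by
        ext g ξ
        simp [fiberMapAux_apply, fiberMap_add_left]
      map_smul' := fun c f => by
        ext g ξ
        simp [fiberMapAux_apply, fiberMap_smul_left] }

theorem fiberMapL_apply (f : F₁ →L[ℂ] F₁) (g : F₂ →L[ℂ] F₂) (ξ : TensorFiber F₁ F₂) :
    fiberMapL F₁ F₂ f g ξ = fiberMap (f : F₁ →ₗ[ℂ] F₁) (g : F₂ →ₗ[ℂ] F₂) ξ := rfl

end Fiber

section Tensor

variable {M₁ M₂ : Type*} {E₁ : M₁ → Type*} {E₂ : M₂ → Type*}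
  [∀ x, NormedAddCommGroup (E₁ x)] [∀ x, InnerProductSpace ℂ (E₁ x)]
  [∀ y, NormedAddCommGroup (E₂ y)] [∀ y, InnerProductSpace ℂ (E₂ y)]
  [TopologicalSpace M₁] [TopologicalSpace M₂]
  {F₁ : Type*} [NormedAddCommGroup F₁] [InnerProductSpace ℂ F₁]
  {F₂ : Type*} [NormedAddCommGroup F₂] [InnerProductSpace ℂ F₂]
  [TopologicalSpace (TotalSpace F₁ E₁)] [TopologicalSpace (TotalSpace F₂ E₂)]

/-- The linear map `e₁(z) ⊗ e₂(w)` from the fibre of `p₁^* E₁ ⊗ p₂^* E₂` at `(z, w)` to the model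
fibre, for local trivializations `e₁` of `E₁` and `e₂` of `E₂`. -/
def extTensorTo (e₁ : Trivialization F₁ (π F₁ E₁)) (e₂ : Trivialization F₂ (π F₂ E₂))
    [e₁.IsLinear ℂ] [e₂.IsLinear ℂ] (p : M₁ × M₂) : ExtTensor E₁ E₂ p →ₗ[ℂ] TensorFiber F₁ F₂ :=
  TensorProduct.map (e₁.linearMapAt ℂ p.1) (e₂.linearMapAt ℂ p.2)

/-- The linear map `e₁(z)⁻¹ ⊗ e₂(w)⁻¹` from the model fibre to the fibre at `(z, w)`. -/
def extTensorFrom (e₁ : Trivialization F₁ (π F₁ E₁)) (e₂ : Trivialization F₂ (π F₂ E₂))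
    [e₁.IsLinear ℂ] [e₂.IsLinear ℂ] (p : M₁ × M₂) : TensorFiber F₁ F₂ →ₗ[ℂ] ExtTensor E₁ E₂ p :=
  TensorProduct.map (e₁.symmₗ ℂ p.1) (e₂.symmₗ ℂ p.2)

theorem extTensorFrom_to (e₁ : Trivialization F₁ (π F₁ E₁)) (e₂ : Trivialization F₂ (π F₂ E₂))
    [e₁.IsLinear ℂ] [e₂.IsLinear ℂ] {p : M₁ × M₂} (hp : p ∈ e₁.baseSet ×ˢ e₂.baseSet)
    (ξ : ExtTensor E₁ E₂ p) : extTensorFrom e₁ e₂ p (extTensorTo e₁ e₂ p ξ) = ξ := by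
  have a₁ : e₁.symmₗ ℂ p.1 ∘ₗ e₁.linearMapAt ℂ p.1 = LinearMap.id :=
    LinearMap.ext fun v => e₁.symmₗ_linearMapAt hp.1 v
  have a₂ : e₂.symmₗ ℂ p.2 ∘ₗ e₂.linearMapAt ℂ p.2 = LinearMap.id :=
    LinearMap.ext fun v => e₂.symmₗ_linearMapAt hp.2 v
  have := TensorProduct.map_comp (e₁.symmₗ ℂ p.1) (e₂.symmₗ ℂ p.2)
    (e₁.linearMapAt ℂ p.1) (e₂.linearMapAt ℂ p.2)
  rw [a₁, a₂, TensorProduct.map_id] at this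
  exact (LinearMap.congr_fun this ξ).symm

theorem extTensorTo_from (e₁ : Trivialization F₁ (π F₁ E₁)) (e₂ : Trivialization F₂ (π F₂ E₂))
    [e₁.IsLinear ℂ] [e₂.IsLinear ℂ] {p : M₁ × M₂} (hp : p ∈ e₁.baseSet ×ˢ e₂.baseSet)
    (ξ : TensorFiber F₁ F₂) : extTensorTo e₁ e₂ p (extTensorFrom e₁ e₂ p ξ) = ξ := by
  have a₁ : e₁.linearMapAt ℂ p.1 ∘ₗ e₁.symmₗ ℂ p.1 = LinearMap.id :=
    LinearMap.ext fun v => e₁.linearMapAt_symmₗ hp.1 v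
  have a₂ : e₂.linearMapAt ℂ p.2 ∘ₗ e₂.symmₗ ℂ p.2 = LinearMap.id :=
    LinearMap.ext fun v => e₂.linearMapAt_symmₗ hp.2 v
  have := TensorProduct.map_comp (e₁.linearMapAt ℂ p.1) (e₂.linearMapAt ℂ p.2)
    (e₁.symmₗ ℂ p.1) (e₂.symmₗ ℂ p.2)
  rw [a₁, a₂, TensorProduct.map_id] at this
  exact (LinearMap.congr_fun this ξ).symm

/-- The local trivialization `(z, w; ξ) ↦ (z, w; (e₁(z) ⊗ e₂(w)) ξ)` of `p₁^* E₁ ⊗ p₂^* E₂` that is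
induced by local trivializations `e₁` of `E₁` and `e₂` of `E₂`. -/
def extTensorPretriv (e₁ : Trivialization F₁ (π F₁ E₁)) (e₂ : Trivialization F₂ (π F₂ E₂))
    [e₁.IsLinear ℂ] [e₂.IsLinear ℂ] :
    Pretrivialization (TensorFiber F₁ F₂) (π (TensorFiber F₁ F₂) (ExtTensor E₁ E₂)) where
  toFun p := ⟨p.1, extTensorTo e₁ e₂ p.1 p.2⟩
  invFun p := ⟨p.1, extTensorFrom e₁ e₂ p.1 p.2⟩
  source := TotalSpace.proj ⁻¹' (e₁.baseSet ×ˢ e₂.baseSet)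
  target := (e₁.baseSet ×ˢ e₂.baseSet) ×ˢ univ
  map_source' := fun ⟨_, _⟩ h => ⟨h, mem_univ _⟩
  map_target' := fun ⟨_, _⟩ h => h.1
  left_inv' := fun ⟨p, ξ⟩ h => congrArg (TotalSpace.mk p) (extTensorFrom_to e₁ e₂ h ξ)
  right_inv' := fun ⟨p, ξ⟩ h => congrArg (Prod.mk p) (extTensorTo_from e₁ e₂ h.1 ξ)
  open_target := (e₁.open_baseSet.prod e₂.open_baseSet).prod isOpen_univ
  baseSet := e₁.baseSet ×ˢ e₂.baseSet
  open_baseSet := e₁.open_baseSet.prod e₂.open_baseSet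
  source_eq := rfl
  target_eq := rfl
  proj_toFun _ _ := rfl

instance (e₁ : Trivialization F₁ (π F₁ E₁)) (e₂ : Trivialization F₂ (π F₂ E₂))
    [e₁.IsLinear ℂ] [e₂.IsLinear ℂ] : (extTensorPretriv e₁ e₂).IsLinear ℂ where
  linear p _ :=
    { map_add := fun ξ η => map_add (extTensorTo e₁ e₂ p) ξ η
      map_smul := fun c ξ => map_smul (extTensorTo e₁ e₂ p) c ξ }

variable [FiberBundle F₁ E₁] [FiberBundle F₂ E₂]
  [FiniteDimensional ℂ F₁] [FiniteDimensional ℂ F₂]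

/-- The coordinate changes of `p₁^* E₁ ⊗ p₂^* E₂` are the tensor products of coordinate changes. -/
def extTensorCoordChange (e₁ e₁' : Trivialization F₁ (π F₁ E₁))
    (e₂ e₂' : Trivialization F₂ (π F₂ E₂))
    [e₁.IsLinear ℂ] [e₂.IsLinear ℂ] [e₁'.IsLinear ℂ] [e₂'.IsLinear ℂ] (p : M₁ × M₂) :
    TensorFiber F₁ F₂ →L[ℂ] TensorFiber F₁ F₂ :=
  fiberMapL F₁ F₂ (e₁.coordChangeL ℂ e₁' p.1) (e₂.coordChangeL ℂ e₂' p.2)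

theorem continuousOn_extTensorCoordChange [VectorBundle ℂ F₁ E₁] [VectorBundle ℂ F₂ E₂]
    (e₁ e₁' : Trivialization F₁ (π F₁ E₁)) (e₂ e₂' : Trivialization F₂ (π F₂ E₂))
    [MemTrivializationAtlas e₁] [MemTrivializationAtlas e₁']
    [MemTrivializationAtlas e₂] [MemTrivializationAtlas e₂'] :
    ContinuousOn (extTensorCoordChange e₁ e₁' e₂ e₂')
      (e₁.baseSet ×ˢ e₂.baseSet ∩ e₁'.baseSet ×ˢ e₂'.baseSet) := by
  have c₁ : ContinuousOn (fun p : M₁ × M₂ => (e₁.coordChangeL ℂ e₁' p.1 : F₁ →L[ℂ] F₁))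
      (e₁.baseSet ×ˢ e₂.baseSet ∩ e₁'.baseSet ×ˢ e₂'.baseSet) :=
    (continuousOn_coordChange ℂ e₁ e₁').comp continuousOn_fst fun p hp => ⟨hp.1.1, hp.2.1⟩
  have c₂ : ContinuousOn (fun p : M₁ × M₂ => (e₂.coordChangeL ℂ e₂' p.2 : F₂ →L[ℂ] F₂))
      (e₁.baseSet ×ˢ e₂.baseSet ∩ e₁'.baseSet ×ˢ e₂'.baseSet) :=
    (continuousOn_coordChange ℂ e₂ e₂').comp continuousOn_snd fun p hp => ⟨hp.1.2, hp.2.2⟩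
  exact ((fiberMapL F₁ F₂).continuous.comp_continuousOn c₁).clm_apply c₂

theorem contMDiffOn_extTensorCoordChange [VectorBundle ℂ F₁ E₁] [VectorBundle ℂ F₂ E₂]
    {V₁ V₂ H₁ H₂ : Type*} [NormedAddCommGroup V₁] [NormedSpace ℂ V₁] [TopologicalSpace H₁]
    [NormedAddCommGroup V₂] [NormedSpace ℂ V₂] [TopologicalSpace H₂]
    (I₁ : ModelWithCorners ℂ V₁ H₁) (I₂ : ModelWithCorners ℂ V₂ H₂)
    [ChartedSpace H₁ M₁] [ChartedSpace H₂ M₂]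
    [ContMDiffVectorBundle ω F₁ E₁ I₁] [ContMDiffVectorBundle ω F₂ E₂ I₂]
    (e₁ e₁' : Trivialization F₁ (π F₁ E₁)) (e₂ e₂' : Trivialization F₂ (π F₂ E₂))
    [MemTrivializationAtlas e₁] [MemTrivializationAtlas e₁']
    [MemTrivializationAtlas e₂] [MemTrivializationAtlas e₂'] :
    ContMDiffOn (I₁.prod I₂) 𝓘(ℂ, TensorFiber F₁ F₂ →L[ℂ] TensorFiber F₁ F₂) ω
      (extTensorCoordChange e₁ e₁' e₂ e₂')
      (e₁.baseSet ×ˢ e₂.baseSet ∩ e₁'.baseSet ×ˢ e₂'.baseSet) := by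
  have c₁ : ContMDiffOn (I₁.prod I₂) 𝓘(ℂ, F₁ →L[ℂ] F₁) ω
      (fun p : M₁ × M₂ => (e₁.coordChangeL ℂ e₁' p.1 : F₁ →L[ℂ] F₁))
      (e₁.baseSet ×ˢ e₂.baseSet ∩ e₁'.baseSet ×ˢ e₂'.baseSet) :=
    (contMDiffOn_coordChangeL (IB := I₁) e₁ e₁').comp contMDiffOn_fst
      fun p hp => ⟨hp.1.1, hp.2.1⟩
  have c₂ : ContMDiffOn (I₁.prod I₂) 𝓘(ℂ, F₂ →L[ℂ] F₂) ω
      (fun p : M₁ × M₂ => (e₂.coordChangeL ℂ e₂' p.2 : F₂ →L[ℂ] F₂))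
      (e₁.baseSet ×ˢ e₂.baseSet ∩ e₁'.baseSet ×ˢ e₂'.baseSet) :=
    (contMDiffOn_coordChangeL (IB := I₂) e₂ e₂').comp contMDiffOn_snd
      fun p hp => ⟨hp.1.2, hp.2.2⟩
  exact contMDiffOn_bilinear (fiberMapL F₁ F₂) c₁ c₂

theorem extTensorCoordChange_apply (e₁ e₁' : Trivialization F₁ (π F₁ E₁))
    (e₂ e₂' : Trivialization F₂ (π F₂ E₂))
    [e₁.IsLinear ℂ] [e₂.IsLinear ℂ] [e₁'.IsLinear ℂ] [e₂'.IsLinear ℂ]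
    {p : M₁ × M₂} (hp : p ∈ e₁.baseSet ×ˢ e₂.baseSet ∩ e₁'.baseSet ×ˢ e₂'.baseSet)
    (ξ : TensorFiber F₁ F₂) :
    extTensorCoordChange e₁ e₁' e₂ e₂' p ξ =
      (extTensorPretriv e₁' e₂' ⟨p, (extTensorPretriv e₁ e₂).symm p ξ⟩).2 := by
  obtain ⟨⟨h₁, h₂⟩, h₁', h₂'⟩ := hp
  have hs : (extTensorPretriv e₁ e₂).symm p ξ = extTensorFrom e₁ e₂ p ξ :=
    Pretrivialization.symm_apply (extTensorPretriv e₁ e₂) (mk_mem_prod h₁ h₂) ξ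
  rw [hs]
  have a₁ : e₁'.linearMapAt ℂ p.1 ∘ₗ e₁.symmₗ ℂ p.1 =
      ((e₁.coordChangeL ℂ e₁' p.1 : F₁ →L[ℂ] F₁) : F₁ →ₗ[ℂ] F₁) := by
    ext v
    simp only [LinearMap.comp_apply, ContinuousLinearMap.coe_coe, ContinuousLinearEquiv.coe_coe,
      e₁.coordChangeL_apply e₁' ⟨h₁, h₁'⟩, e₁'.coe_linearMapAt_of_mem h₁',
      e₁.symmₗ_apply h₁]
  have a₂ : e₂'.linearMapAt ℂ p.2 ∘ₗ e₂.symmₗ ℂ p.2 =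
      ((e₂.coordChangeL ℂ e₂' p.2 : F₂ →L[ℂ] F₂) : F₂ →ₗ[ℂ] F₂) := by
    ext v
    simp only [LinearMap.comp_apply, ContinuousLinearMap.coe_coe, ContinuousLinearEquiv.coe_coe,
      e₂.coordChangeL_apply e₂' ⟨h₂, h₂'⟩, e₂'.coe_linearMapAt_of_mem h₂',
      e₂.symmₗ_apply h₂]
  have := TensorProduct.map_comp (e₁'.linearMapAt ℂ p.1) (e₂'.linearMapAt ℂ p.2)
    (e₁.symmₗ ℂ p.1) (e₂.symmₗ ℂ p.2)
  rw [a₁, a₂] at this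
  rw [extTensorCoordChange, fiberMapL_apply]
  exact LinearMap.congr_fun this ξ

variable (E₁ E₂ F₁ F₂) in
/-- The local trivializations of `p₁^* E₁ ⊗ p₂^* E₂` turn it into a vector bundle. -/
def extTensorPrebundle [VectorBundle ℂ F₁ E₁] [VectorBundle ℂ F₂ E₂] :
    VectorPrebundle ℂ (TensorFiber F₁ F₂) (ExtTensor E₁ E₂) where
  pretrivializationAtlas :=
    {e | ∃ (e₁ : Trivialization F₁ (π F₁ E₁)) (e₂ : Trivialization F₂ (π F₂ E₂))
      (_ : MemTrivializationAtlas e₁) (_ : MemTrivializationAtlas e₂), e = extTensorPretriv e₁ e₂}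
  pretrivialization_linear' := by
    rintro _ ⟨e₁, e₂, he₁, he₂, rfl⟩
    infer_instance
  pretrivializationAt p :=
    extTensorPretriv (trivializationAt F₁ E₁ p.1) (trivializationAt F₂ E₂ p.2)
  mem_base_pretrivializationAt p :=
    ⟨mem_baseSet_trivializationAt F₁ E₁ p.1, mem_baseSet_trivializationAt F₂ E₂ p.2⟩
  pretrivialization_mem_atlas p :=
    ⟨trivializationAt F₁ E₁ p.1, trivializationAt F₂ E₂ p.2, inferInstance, inferInstance, rfl⟩
  exists_coordChange := by
    rintro _ ⟨e₁, e₂, he₁, he₂, rfl⟩ _ ⟨e₁', e₂', he₁', he₂', rfl⟩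
    exact ⟨extTensorCoordChange e₁ e₁' e₂ e₂', continuousOn_extTensorCoordChange e₁ e₁' e₂ e₂',
      fun p hp ξ => extTensorCoordChange_apply e₁ e₁' e₂ e₂' hp ξ⟩
  totalSpaceMk_isInducing := by
    intro p
    let L₁ : E₁ p.1 ≃ₗ[ℂ] F₁ := ((trivializationAt F₁ E₁ p.1).continuousLinearEquivAt ℂ p.1
      (mem_baseSet_trivializationAt _ _ _)).toLinearEquiv
    let L₂ : E₂ p.2 ≃ₗ[ℂ] F₂ := ((trivializationAt F₂ E₂ p.2).continuousLinearEquivAt ℂ p.2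
      (mem_baseSet_trivializationAt _ _ _)).toLinearEquiv
    let L : ExtTensor E₁ E₂ p ≃ₗ[ℂ] TensorFiber F₁ F₂ := TensorProduct.congr L₁ L₂
    have : FiniteDimensional ℂ (ExtTensor E₁ E₂ p) := L.symm.finiteDimensional
    have : IsInducing fun ξ => (p, L.toContinuousLinearEquiv ξ) :=
      isInducing_const_prod.mpr L.toContinuousLinearEquiv.toHomeomorph.isInducing
    convert! this using 1
    funext ξ
    refine congrArg (Prod.mk p) ?_
    have a₁ : (trivializationAt F₁ E₁ p.1).linearMapAt ℂ p.1 = L₁ := by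
      ext v
      simp [L₁, Trivialization.linearMapAt_apply, mem_baseSet_trivializationAt]
    have a₂ : (trivializationAt F₂ E₂ p.2).linearMapAt ℂ p.2 = L₂ := by
      ext v
      simp [L₂, Trivialization.linearMapAt_apply, mem_baseSet_trivializationAt]
    change TensorProduct.map _ _ ξ = TensorProduct.map _ _ ξ
    rw [a₁, a₂]

variable [VectorBundle ℂ F₁ E₁] [VectorBundle ℂ F₂ E₂]

instance : TopologicalSpace (TotalSpace (TensorFiber F₁ F₂) (ExtTensor E₁ E₂)) :=
  (extTensorPrebundle E₁ E₂ F₁ F₂).totalSpaceTopology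

instance : FiberBundle (TensorFiber F₁ F₂) (ExtTensor E₁ E₂) :=
  (extTensorPrebundle E₁ E₂ F₁ F₂).toFiberBundle

instance : VectorBundle ℂ (TensorFiber F₁ F₂) (ExtTensor E₁ E₂) :=
  (extTensorPrebundle E₁ E₂ F₁ F₂).toVectorBundle

/-- If `E₁` and `E₂` are holomorphic, so is `p₁^* E₁ ⊗ p₂^* E₂`. -/
instance {V₁ V₂ H₁ H₂ : Type*} [NormedAddCommGroup V₁] [NormedSpace ℂ V₁] [TopologicalSpace H₁]
    [NormedAddCommGroup V₂] [NormedSpace ℂ V₂] [TopologicalSpace H₂]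
    (I₁ : ModelWithCorners ℂ V₁ H₁) (I₂ : ModelWithCorners ℂ V₂ H₂)
    [ChartedSpace H₁ M₁] [ChartedSpace H₂ M₂]
    [ContMDiffVectorBundle ω F₁ E₁ I₁] [ContMDiffVectorBundle ω F₂ E₂ I₂] :
    ContMDiffVectorBundle ω (TensorFiber F₁ F₂) (ExtTensor E₁ E₂) (I₁.prod I₂) :=
  haveI : (extTensorPrebundle E₁ E₂ F₁ F₂).IsContMDiff (I₁.prod I₂) ω :=
    { exists_contMDiffCoordChange := by
        rintro _ ⟨e₁, e₂, he₁, he₂, rfl⟩ _ ⟨e₁', e₂', he₁', he₂', rfl⟩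
        exact ⟨extTensorCoordChange e₁ e₁' e₂ e₂',
          contMDiffOn_extTensorCoordChange I₁ I₂ e₁ e₁' e₂ e₂',
          fun p hp ξ => extTensorCoordChange_apply e₁ e₁' e₂ e₂' hp ξ⟩ }
  (extTensorPrebundle E₁ E₂ F₁ F₂).contMDiffVectorBundle (I₁.prod I₂)

end Tensor

end BergmanProd

end

set_option linter.unusedSectionVars false

noncomputable section

namespace BergmanProd

/-! Put the weight into the measure: `ν = e^{-ψ} dV`. Since `ψ` is locally bounded above, `ν`
dominates a positive multiple of Lebesgue measure near every point. The mean value inequality and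
Cauchy's estimates then bound all jets of a holomorphic section at a point by its `L²` norm. Hence
`A²` is a Hilbert space, and the sections vanishing up to order `k` on `S` form a closed subspace
`L`. The sections coinciding with `f` up to order `k` form the coset `f + L`, whose unique element
of least norm is its element in `Lᗮ`.

Let `L₁`, `L₂`, `L` be the subspaces for `(m₁, S₁)`, `(m₂, S₂)`, `(m₁ + m₂, S₁ × S₂)`, and let `g₁`,
`g₂`, `g` be the minimal elements. The heart of the proof is `inner_tensor_eq_zero`: `g₁ ⊗ g₂` is
orthogonal to every `D ∈ L`. Let `T ∈ A²(Ω₁, E₁)` represent the form `u ↦ ⟪D, u ⊗ g₂⟫`; it suffices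
that `T ∈ L₁`, because then `⟪D, g₁ ⊗ g₂⟫ = ⟪T, g₁⟫ = 0`. A scalar component of a jet of `T` at `x ∈
S₁`, of order `j ≤ m₁`, is `⟪K, T⟫` for some `K`. By Fubini this equals `⟪g₂, J⟫`, where `J` is the
same derivative of `D` in the first variable at `x`, viewed as a section of `E₂`. Taking `j ≤ m₁`
derivatives of a section that vanishes up to order `m₁ + m₂` leaves one that vanishes up to order
`m₂` on `S₂`. So `J ∈ L₂`, and the pairing with `g₂` is zero. `A²(Ω, E)` need not be identified with
a completed tensor product.

Inequality: as `g - f₁ ⊗ f₂ ∈ L`, one gets `⟪g, g₁ ⊗ g₂⟫ = ⟪f₁, g₁⟫ ⟪f₂, g₂⟫ = ‖g₁‖² ‖g₂‖²`, and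
Cauchy–Schwarz finishes.

Equality: `g₁ ⊗ g₂ - f₁ ⊗ f₂ = (g₁ - f₁) ⊗ g₂ + f₁ ⊗ (g₂ - f₂)`. If `fᵢ` vanishes up to order `mᵢ -
1`, so does `gᵢ`, and both terms lie in `L` because vanishing orders add. Then `g - g₁ ⊗ g₂` lies in
`L` and is orthogonal to `L`. -/

open Metric Filter Asymptotics

/-! ### Cauchy estimates and derivatives along complex lines -/

section Cauchy

variable {V F : Type*} [NormedAddCommGroup V] [NormedSpace ℂ V]
  [NormedAddCommGroup F] [NormedSpace ℂ F]

/-- Cauchy's estimate for the derivative of a holomorphic function on a ball. -/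
theorem norm_fderiv_le_of_ball {f : V → F} {z : V} {ρ M : ℝ} (hρ : 0 < ρ)
    (hf : DifferentiableOn ℂ f (ball z ρ)) (hM : ∀ y ∈ ball z ρ, ‖f y‖ ≤ M) :
    ‖fderiv ℂ f z‖ ≤ M / ρ := by
  have hM0 : 0 ≤ M := (norm_nonneg _).trans (hM z (mem_ball_self hρ))
  refine ContinuousLinearMap.opNorm_le_bound _ (by positivity) fun v => ?_
  rcases eq_or_ne v 0 with rfl | hv
  · simp
  have hv' : 0 < ‖v‖ := norm_pos_iff.2 hv
  have hmem : ∀ t : ℂ, ‖t‖ < ρ / ‖v‖ → z + t • v ∈ ball z ρ := fun t ht => by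
    rw [mem_ball_iff_norm, add_sub_cancel_left, norm_smul]
    exact (lt_div_iff₀ hv').1 ht
  have hdiff : DifferentiableOn ℂ (fun t : ℂ => f (z + t • v)) (ball 0 (ρ / ‖v‖)) := by
    refine hf.comp (by fun_prop) fun t ht => hmem t (by simpa using ht)
  have hd : HasDerivAt (fun t : ℂ => f (z + t • v)) (fderiv ℂ f z v) 0 := by
    have h1 : HasFDerivAt f (fderiv ℂ f z) (z + (0 : ℂ) • v) := by
      simpa using (hf.differentiableAt (ball_mem_nhds z hρ)).hasFDerivAt
    have h2 : HasDerivAt (fun t : ℂ => z + t • v) v 0 := by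
      simpa using ((hasDerivAt_id (0 : ℂ)).smul_const v).const_add z
    exact h1.comp_hasDerivAt 0 h2
  -- On the complex line through `z` in direction `v` the ball becomes a disc of radius `ρ / ‖v‖`.
  -- The bound on `f` holds only inside the open ball, so the one-variable estimate is used on
  -- smaller circles and `s` tends to the full radius.
  have key : ∀ s ∈ Ioo 0 (ρ / ‖v‖), ‖fderiv ℂ f z v‖ ≤ M / s := fun s hs => by
    rw [← hd.deriv]
    refine Complex.norm_deriv_le_of_forall_mem_sphere_norm_le hs.1 ?_ fun t ht => ?_
    · refine DifferentiableOn.diffContOnCl (hdiff.mono ?_)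
      exact (closure_ball_subset_closedBall).trans (closedBall_subset_ball hs.2)
    · exact hM _ (hmem t (by simpa using (mem_sphere_zero_iff_norm.1 ht).trans_lt hs.2))
  have hlim : Tendsto (fun s : ℝ => M / s) (𝓝[<] (ρ / ‖v‖)) (𝓝 (M / (ρ / ‖v‖))) :=
    (tendsto_const_nhds.div tendsto_id (by positivity)).mono_left nhdsWithin_le_nhds
  have := ge_of_tendsto hlim
    (by filter_upwards [Ioo_mem_nhdsLT (div_pos hρ hv')] with s hs using key s hs)
  calc _ ≤ _ := this
    _ = _ := by field_simp

variable [CompleteSpace F]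

/-- Each differentiation gives up a margin `ρ`: the bound for order `j` on the ball of radius `ρ`
around `z` feeds the first-order estimate. Hence the room `j * ρ` around `z`. -/
theorem norm_iteratedFDeriv_le_of_subset {f : V → F} {U : Set V} {ρ M : ℝ} (hρ : 0 < ρ)
    (hf : AnalyticOnNhd ℂ f U) (hM : ∀ y ∈ U, ‖f y‖ ≤ M) (j : ℕ) :
    ∀ z ∈ U, ball z (j * ρ) ⊆ U → ‖iteratedFDeriv ℂ j f z‖ ≤ M / ρ ^ j := by
  induction j with
  | zero => intro z hz _; simpa using hM z hz
  | succ j ih =>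
    intro z hz hU
    have hsub : ∀ y ∈ ball z ρ, y ∈ U ∧ ball y (j * ρ) ⊆ U := fun y hy => by
      refine ⟨hU (ball_subset_ball ?_ hy), (ball_subset_ball' ?_).trans hU⟩
      · push_cast; nlinarith [(Nat.cast_nonneg j : (0 : ℝ) ≤ j)]
      · push_cast; linarith [mem_ball.1 hy]
    rw [← norm_fderiv_iteratedFDeriv, pow_succ, ← div_div]
    refine norm_fderiv_le_of_ball hρ (fun y hy => ?_) fun y hy => ih y (hsub y hy).1 (hsub y hy).2
    exact (hf.iteratedFDeriv j y (hsub y hy).1).differentiableAt.differentiableWithinAt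

/-- Cauchy's estimate for the iterated derivatives of a holomorphic function on a ball. -/
theorem norm_iteratedFDeriv_le_of_ball {f : V → F} {a : V} {R M : ℝ} (hR : 0 < R)
    (hf : AnalyticOnNhd ℂ f (ball a R)) (hM : ∀ y ∈ ball a R, ‖f y‖ ≤ M) (j : ℕ) :
    ‖iteratedFDeriv ℂ j f a‖ ≤ M * (j / R) ^ j := by
  rcases Nat.eq_zero_or_pos j with rfl | hj
  · simpa using hM a (mem_ball_self hR)
  have hj' : (0 : ℝ) < j := by exact_mod_cast hj
  -- The radius is split into `j` equal margins. The resulting `j ^ j` is larger than the usual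
  -- `j!`, but only by a geometric factor, which is harmless for power series.
  have := norm_iteratedFDeriv_le_of_subset (ρ := R / j) (by positivity) hf hM j a
    (mem_ball_self hR) (by rw [mul_div_cancel₀ _ hj'.ne'])
  calc _ ≤ _ := this
    _ = _ := by rw [div_eq_mul_inv, ← inv_pow, inv_div]

omit [CompleteSpace F] in
theorem hasDerivAt_comp_line {f : V → F} {a v : V} {t : ℂ} (hf : DifferentiableAt ℂ f (a + t • v)) :
    HasDerivAt (fun t : ℂ => f (a + t • v)) (fderiv ℂ f (a + t • v) v) t := by
  have h2 : HasDerivAt (fun t : ℂ => a + t • v) v t := by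
    simpa using ((hasDerivAt_id t).smul_const v).const_add a
  exact hf.hasFDerivAt.comp_hasDerivAt t h2

omit [CompleteSpace F] in
theorem continuousAt_line (a v : V) (t : ℂ) : ContinuousAt (fun t : ℂ => a + t • v) t := by
  fun_prop

/-- The iterated derivatives along a line. -/
theorem iteratedDeriv_comp_line {f : V → F} {a v : V} (j : ℕ) :
    ∀ {t : ℂ}, AnalyticAt ℂ f (a + t • v) →
    iteratedDeriv j (fun t : ℂ => f (a + t • v)) t =
      iteratedFDeriv ℂ j f (a + t • v) (fun _ => v) := by
  induction j with
  | zero => intro t _; simp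
  | succ j ih =>
    intro t hf
    have hev : iteratedDeriv j (fun t : ℂ => f (a + t • v)) =ᶠ[𝓝 t]
        fun t => iteratedFDeriv ℂ j f (a + t • v) (fun _ => v) := by
      filter_upwards [(continuousAt_line a v t).eventually hf.eventually_analyticAt] with s hs
        using ih hs
    rw [iteratedDeriv_succ, hev.deriv_eq, iteratedFDeriv_succ_apply_left]
    have h1 : AnalyticAt ℂ (iteratedFDeriv ℂ j f) (a + t • v) := by
      have : AnalyticOnNhd ℂ f {a + t • v} := fun y hy => by rwa [mem_singleton_iff.1 hy]
      exact this.iteratedFDeriv j _ rfl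
    have h2 := hasDerivAt_comp_line h1.differentiableAt
    have h3 := (ContinuousMultilinearMap.apply ℂ (fun _ : Fin j => V) F
      (fun _ => v)).hasFDerivAt.comp_hasDerivAt t h2
    exact h3.deriv

end Cauchy

/-! ### Order of vanishing: growth at a point versus vanishing derivatives -/

section Order

variable {V F : Type*} [NormedAddCommGroup V] [NormedSpace ℂ V]
  [NormedAddCommGroup F] [NormedSpace ℂ F] [CompleteSpace F]

theorem AnalyticAt.iteratedFDeriv' {f : V → F} {a : V} (hf : AnalyticAt ℂ f a) (j : ℕ) :
    AnalyticAt ℂ (iteratedFDeriv ℂ j f) a := by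
  have : AnalyticOnNhd ℂ f {a} := fun y hy => by rwa [mem_singleton_iff.1 hy]
  exact this.iteratedFDeriv j _ rfl

/-- A holomorphic function all of whose derivatives of order `< N` along lines through `a` vanish
has a zero of order at least `N` at `a`. -/
theorem isBigO_of_iteratedDeriv_line_eq_zero {f : V → F} {a : V} {N : ℕ} (hf : AnalyticAt ℂ f a)
    (h0 : ∀ j < N, ∀ v, iteratedDeriv j (fun t : ℂ => f (a + t • v)) 0 = 0) :
    (fun y => f (a + y)) =O[𝓝 0] fun y => ‖y‖ ^ N := by
  obtain ⟨p, r, hp⟩ := hf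
  -- The power series is evaluated only on the diagonal, where its `j`-th term times `j!` is a
  -- derivative along a line. So the hypothesis on lines kills all terms of degree below `N`.
  have hpart : ∀ y, p.partialSum N y = 0 := fun y => by
    refine Finset.sum_eq_zero fun j hj => ?_
    have h1 := hp.factorial_smul y j
    have h2 : iteratedFDeriv ℂ j f a (fun _ => y) = 0 := by
      have := iteratedDeriv_comp_line (f := f) (a := a) (v := y) j (t := 0)
        (by simpa using hp.analyticAt)
      rw [zero_smul, add_zero] at this
      rw [← this]
      exact h0 j (Finset.mem_range.1 hj) y
    rw [h2, ← Nat.cast_smul_eq_nsmul ℂ] at h1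
    exact (smul_eq_zero.1 h1).resolve_left (by exact_mod_cast j.factorial_ne_zero)
  have := hp.hasFPowerSeriesAt.isBigO_sub_partialSum_pow N
  simpa [hpart] using this

/-- If a holomorphic function has a zero of order `≥ N`, its `j`-th derivative has a zero of order
`≥ N - j`. -/
theorem isBigO_iteratedFDeriv {f : V → F} {a : V} {N : ℕ} (hf : AnalyticAt ℂ f a)
    (h0 : (fun y => f (a + y)) =O[𝓝 0] fun y => ‖y‖ ^ N) {j : ℕ} (hj : j ≤ N) :
    (fun y => iteratedFDeriv ℂ j f (a + y)) =O[𝓝 0] fun y => ‖y‖ ^ (N - j) := by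
  obtain ⟨C, hC0, hC⟩ := h0.exists_pos
  have han : ∀ᶠ y in 𝓝 (0 : V), AnalyticAt ℂ f (a + y) := by
    have : ContinuousAt (fun y : V => a + y) 0 := by fun_prop
    exact this.eventually (by simpa using hf.eventually_analyticAt)
  obtain ⟨ε, hε, hball⟩ := Metric.eventually_nhds_iff_ball.1 (hC.bound.and han)
  -- A ball of radius `R > ‖y‖` around `a + y` stays within `2 * R` of `a`, where `‖f‖ ≤ C * (2 * R)
  -- ^ N`. Cauchy's estimate multiplies this by `(j / R) ^ j`. Letting `R` decrease to `‖y‖` also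
  -- covers `y = 0`, where no ball of radius `‖y‖` is available.
  refine IsBigO.of_bound (C * 2 ^ N * j ^ j) ?_
  filter_upwards [ball_mem_nhds (0 : V) (half_pos hε)] with y hy
  have hy' : ‖y‖ < ε / 2 := by simpa using hy
  have key : ∀ R ∈ Ioo ‖y‖ (ε / 2),
      ‖iteratedFDeriv ℂ j f (a + y)‖ ≤ C * 2 ^ N * j ^ j * R ^ (N - j) := fun R hR => by
    have hR0 : 0 < R := (norm_nonneg y).trans_lt hR.1
    have hin : ∀ z ∈ ball (a + y) R, ‖z - a‖ < 2 * R := fun z hz => by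
      have h1 : z - a = (z - (a + y)) + y := by abel
      rw [h1]
      linarith [norm_add_le (z - (a + y)) y, mem_ball_iff_norm.1 hz, hR.1]
    have hin' : ∀ z ∈ ball (a + y) R, z - a ∈ ball (0 : V) ε := fun z hz => by
      rw [mem_ball_zero_iff]; linarith [hin z hz, hR.2]
    have := norm_iteratedFDeriv_le_of_ball (M := C * (2 * R) ^ N) hR0
      (fun z hz => by simpa using (hball _ (hin' z hz)).2)
      (fun z hz => by
        have h1 := (hball _ (hin' z hz)).1
        rw [add_sub_cancel, norm_pow, norm_norm] at h1
        exact h1.trans (by gcongr; exact (hin z hz).le)) j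
    refine this.trans_eq ?_
    rw [div_pow, mul_pow, ← Nat.sub_add_cancel hj, pow_add R, Nat.add_sub_cancel]
    field_simp
  have hlim : Tendsto (fun R : ℝ => C * 2 ^ N * j ^ j * R ^ (N - j)) (𝓝[>] ‖y‖)
      (𝓝 (C * 2 ^ N * j ^ j * ‖y‖ ^ (N - j))) :=
    ((continuous_const.mul (continuous_pow _)).tendsto _).mono_left nhdsWithin_le_nhds
  have := ge_of_tendsto hlim (by filter_upwards [Ioo_mem_nhdsGT hy'] with R hR using key R hR)
  simpa using this

/-- At `y = 0` the bound `‖y‖ ^ (N - j)` for the `j`-th derivative is zero. With the converse below,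
vanishing up to order `k` becomes the growth condition with `N = k + 1`, which behaves well under
products and partial derivatives. -/
theorem iteratedFDeriv_eq_zero_of_isBigO {f : V → F} {a : V} {N : ℕ} (hf : AnalyticAt ℂ f a)
    (h0 : (fun y => f (a + y)) =O[𝓝 0] fun y => ‖y‖ ^ N) {j : ℕ} (hj : j < N) :
    iteratedFDeriv ℂ j f a = 0 := by
  have h1 := (isBigO_iteratedFDeriv hf h0 hj.le).eq_zero_imp.self_of_nhds
  simpa using h1 (by simp [Nat.sub_ne_zero_of_lt hj])

theorem isBigO_of_iteratedFDeriv_eq_zero {f : V → F} {a : V} {N : ℕ} (hf : AnalyticAt ℂ f a)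
    (h0 : ∀ j < N, iteratedFDeriv ℂ j f a = 0) :
    (fun y => f (a + y)) =O[𝓝 0] fun y => ‖y‖ ^ N :=
  isBigO_of_iteratedDeriv_line_eq_zero hf fun j hj v => by
    rw [iteratedDeriv_comp_line j (by simpa using hf), zero_smul, add_zero, h0 j hj]
    rfl

variable {W : Type*} [NormedAddCommGroup W] [NormedSpace ℂ W]

/-- Writing the partial derivative as the full derivative of `u` on the constant vector `(v, 0)`
makes its dependence on `w` visibly analytic and lets estimates for full derivatives apply. -/
theorem iteratedDeriv_partial_eventuallyEq {u : V × W → F} {a : V} {b : W}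
    (hu : AnalyticAt ℂ u (a, b)) (j : ℕ) (v : V) :
    (fun w => iteratedDeriv j (fun t : ℂ => u (a + t • v, w)) 0) =ᶠ[𝓝 b]
      fun w => iteratedFDeriv ℂ j u (a, w) (fun _ => (v, 0)) := by
  have : ContinuousAt (fun w : W => (a, w)) b := by fun_prop
  filter_upwards [this.eventually hu.eventually_analyticAt] with w hw
  have := iteratedDeriv_comp_line (f := u) (a := (a, w)) (v := ((v, 0) : V × W)) j (t := 0)
    (by simpa using hw)
  simpa using this

theorem analyticAt_iteratedDeriv_partial {u : V × W → F} {a : V} {b : W}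
    (hu : AnalyticAt ℂ u (a, b)) (j : ℕ) (v : V) :
    AnalyticAt ℂ (fun w => iteratedDeriv j (fun t : ℂ => u (a + t • v, w)) 0) b := by
  refine AnalyticAt.congr ?_ (iteratedDeriv_partial_eventuallyEq hu j v).symm
  have h1 : AnalyticAt ℂ (fun w : W => (a, w)) b := analyticAt_const.prod analyticAt_id
  have h2 := (AnalyticAt.iteratedFDeriv' hu j).comp h1
  exact ((ContinuousMultilinearMap.apply ℂ (fun _ : Fin j => V × W) F
    (fun _ => ((v, 0) : V × W))).analyticAt _).comp h2

/-- Each derivative costs at most one order of vanishing, and restricting to the slice `{a} × W`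
costs none. This trade is the reason why orders add in the theorem. -/
theorem isBigO_iteratedDeriv_partial {u : V × W → F} {a : V} {b : W} {N : ℕ}
    (hu : AnalyticAt ℂ u (a, b)) (h0 : (fun p => u ((a, b) + p)) =O[𝓝 0] fun p => ‖p‖ ^ N)
    {j : ℕ} (hj : j ≤ N) (v : V) :
    (fun w => iteratedDeriv j (fun t : ℂ => u (a + t • v, b + w)) 0) =O[𝓝 0]
      fun w => ‖w‖ ^ (N - j) := by
  have h1 : Tendsto (fun w : W => b + w) (𝓝 0) (𝓝 b) := by
    have : ContinuousAt (fun w : W => b + w) 0 := by fun_prop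
    simpa [ContinuousAt] using this
  have h2 := (iteratedDeriv_partial_eventuallyEq hu j v).comp_tendsto h1
  refine h2.trans_isBigO ?_
  have h3 : Tendsto (fun w : W => ((0, w) : V × W)) (𝓝 0) (𝓝 0) := by
    have : ContinuousAt (fun w : W => ((0, w) : V × W)) 0 := by fun_prop
    exact this
  have h4 := (isBigO_iteratedFDeriv hu h0 hj).comp_tendsto h3
  have h5 := ((ContinuousMultilinearMap.apply ℂ (fun _ : Fin j => V × W) F
    (fun _ => ((v, 0) : V × W))).isBigO_comp
      (fun w : W => iteratedFDeriv ℂ j u ((a, b) + (0, w))) (𝓝 0)).trans h4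
  simpa [Function.comp_def, Prod.norm_def] using h5

end Order

/-! ### Uniform limits of holomorphic functions on normed spaces -/

section Limit

variable {V F : Type*} [NormedAddCommGroup V] [NormedSpace ℂ V]
  [NormedAddCommGroup F] [NormedSpace ℂ F] [CompleteSpace F]

/-- The Taylor series of `t ↦ f (a + t • y)` on the disc of radius `2`, evaluated at `t = 1`. The
hypothesis `2 * ‖y‖ < R` keeps that disc inside the ball. -/
theorem hasSum_iteratedFDeriv_of_ball {f : V → F} {a y : V} {R : ℝ}
    (hf : AnalyticOnNhd ℂ f (ball a R)) (hy : 2 * ‖y‖ < R) :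
    HasSum (fun j : ℕ => (j.factorial : ℂ)⁻¹ • iteratedFDeriv ℂ j f a (fun _ => y))
      (f (a + y)) := by
  have hR : 0 < R := by linarith [norm_nonneg y]
  have hd : DifferentiableOn ℂ (fun t : ℂ => f (a + t • y)) (ball 0 2) := fun t ht => by
    refine (hasDerivAt_comp_line (hf _ ?_).differentiableAt).differentiableAt.differentiableWithinAt
    rw [mem_ball_iff_norm, add_sub_cancel_left, norm_smul]
    have := mem_ball_zero_iff.1 ht
    nlinarith [norm_nonneg y]
  have := Complex.hasSum_taylorSeries_on_ball hd (z := 1) (by simp)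
  simp only [sub_zero, one_pow, one_smul] at this
  convert this using 3 with j
  rw [iteratedDeriv_comp_line j (by simpa using hf a (mem_ball_self hR)), zero_smul, add_zero]

/-- By Cauchy's estimates the Taylor coefficients of `u n` at `a` converge, with a geometric bound
uniform in `n`. Dominated convergence passes to the limit in the Taylor series, so `g` is the sum of
the limit series. -/
theorem analyticAt_of_tendstoUniformlyOn_of_bounded {u : ℕ → V → F} {g : V → F} {a : V} {R : ℝ}
    (hR : 0 < R) (hu : ∀ n, AnalyticOnNhd ℂ (u n) (ball a R))
    (hb : ∀ n, ∀ z ∈ ball a R, ‖u n z‖ ≤ 1) (hg : TendstoUniformlyOn u g atTop (ball a R)) :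
    AnalyticAt ℂ g a := by
  set D : ℕ → (j : ℕ) → ContinuousMultilinearMap ℂ (fun _ : Fin j => V) F :=
    fun n j => iteratedFDeriv ℂ j (u n) a
  have hcauchy : ∀ j, ∃ P, Tendsto (fun n => D n j) atTop (𝓝 P) := fun j => by
    refine cauchySeq_tendsto_of_complete (Metric.cauchySeq_iff.2 fun ε hε => ?_)
    have hK : 0 < ((j : ℝ) / R) ^ j + 1 := by positivity
    obtain ⟨N, hN⟩ := Metric.uniformCauchySeqOn_iff.1 hg.uniformCauchySeqOn
      (ε / (((j : ℝ) / R) ^ j + 1)) (by positivity)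
    refine ⟨N, fun m hm n hn => ?_⟩
    have h1 : D m j - D n j = iteratedFDeriv ℂ j (u m - u n) a := by
      have hm' := ((hu m a (mem_ball_self hR)).contDiffAt (n := j))
      have hn' := ((hu n a (mem_ball_self hR)).contDiffAt (n := j))
      rw [iteratedFDeriv_sub_apply hm' hn']
    rw [dist_eq_norm, h1]
    refine (norm_iteratedFDeriv_le_of_ball hR ((hu m).sub (hu n)) (fun z hz => ?_) j).trans_lt
      (b := ε / (((j : ℝ) / R) ^ j + 1) * (((j : ℝ) / R) ^ j)) ?_
    · have := hN m hm n hn z hz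
      rw [dist_eq_norm] at this
      exact this.le
    · rw [div_mul_eq_mul_div, div_lt_iff₀ hK]
      nlinarith
  choose P hP using hcauchy
  -- Here `j ^ j ≤ j! * e ^ j`, which turns the constant `(j / R) ^ j` into a geometric one and
  -- yields convergence for `‖y‖ < R / e`.
  have hDb : ∀ n j, ‖D n j‖ ≤ (j.factorial : ℝ) * (Real.exp 1 / R) ^ j := fun n j => by
    have h1 := norm_iteratedFDeriv_le_of_ball hR (hu n) (hb n) j
    have h2 := Real.pow_div_factorial_le_exp (j : ℝ) (by positivity) j
    rw [div_le_iff₀ (by positivity)] at h2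
    refine h1.trans ?_
    rw [one_mul, div_pow, div_pow, ← mul_div_assoc, ← Real.exp_nat_mul, mul_one]
    gcongr
    linarith
  have hPb : ∀ j, ‖P j‖ ≤ (j.factorial : ℝ) * (Real.exp 1 / R) ^ j := fun j =>
    le_of_tendsto (hP j).norm (Eventually.of_forall fun n => hDb n j)
  have hscale : ∀ (Q : (j : ℕ) → ContinuousMultilinearMap ℂ (fun _ : Fin j => V) F),
      (∀ j, ‖Q j‖ ≤ (j.factorial : ℝ) * (Real.exp 1 / R) ^ j) →
      ∀ j, ‖(j.factorial : ℂ)⁻¹ • Q j‖ ≤ (Real.exp 1 / R) ^ j := fun Q hQ j => by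
    rw [norm_smul, norm_inv, Complex.norm_natCast, inv_mul_le_iff₀ (by positivity)]
    exact hQ j
  let p : FormalMultilinearSeries ℂ V F := fun j => (j.factorial : ℂ)⁻¹ • P j
  let r : NNReal := ⟨R / Real.exp 1, by positivity⟩
  have hr : (r : ℝ) = R / Real.exp 1 := rfl
  -- Since `e > 2`, the condition `‖y‖ < R / e` implies `2 * ‖y‖ < R`, as the Taylor expansion of `u
  -- n` requires.
  have he : 2 < Real.exp 1 := by linarith [Real.exp_one_gt_d9]
  refine HasFPowerSeriesOnBall.analyticAt (p := p) (r := r) ⟨?_, ?_, ?_⟩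
  · refine p.le_radius_of_bound 1 fun j => ?_
    calc ‖p j‖ * (r : ℝ) ^ j ≤ (Real.exp 1 / R) ^ j * (R / Real.exp 1) ^ j := by
          rw [hr]; gcongr; exact hscale P hPb j
      _ = 1 := by rw [← mul_pow]; field_simp; simp
  · rw [ENNReal.coe_pos, ← NNReal.coe_pos, hr]; positivity
  · intro y hy
    have hy' : ‖y‖ < R / Real.exp 1 := by
      rw [Metric.eball_coe, mem_ball_zero_iff] at hy
      exact hy
    have hy2 : 2 * ‖y‖ < R := by
      have := (lt_div_iff₀ (Real.exp_pos 1)).1 hy'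
      nlinarith [norm_nonneg y]
    have hq : ‖y‖ * (Real.exp 1 / R) < 1 := by
      have := (lt_div_iff₀ (Real.exp_pos 1)).1 hy'
      rw [← mul_div_assoc, div_lt_one hR]; exact this
    have hbd : ∀ (Q : (j : ℕ) → ContinuousMultilinearMap ℂ (fun _ : Fin j => V) F),
        (∀ j, ‖Q j‖ ≤ (j.factorial : ℝ) * (Real.exp 1 / R) ^ j) →
        ∀ j, ‖(j.factorial : ℂ)⁻¹ • Q j (fun _ => y)‖ ≤ (‖y‖ * (Real.exp 1 / R)) ^ j :=
      fun Q hQ j => by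
        have h1 := ((j.factorial : ℂ)⁻¹ • Q j).le_opNorm (fun _ => y)
        rw [Finset.prod_const, Finset.card_univ, Fintype.card_fin] at h1
        refine h1.trans ?_
        rw [mul_pow, mul_comm]
        gcongr
        exact hscale Q hQ j
    have hsum : Summable fun j : ℕ => (‖y‖ * (Real.exp 1 / R)) ^ j :=
      summable_geometric_of_lt_one (by positivity) hq
    have hlim := tendsto_tsum_of_dominated_convergence (𝓕 := atTop)
      (f := fun n j => (j.factorial : ℂ)⁻¹ • D n j (fun _ => y))
      (g := fun j => p j (fun _ => y)) hsum
      (fun j => by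
        have h1 : Tendsto (fun n => D n j (fun _ => y)) atTop (𝓝 (P j fun _ => y)) :=
          ((ContinuousMultilinearMap.apply ℂ (fun _ : Fin j => V) F
            (fun _ => y)).continuous.tendsto _).comp (hP j)
        exact h1.const_smul _)
      (Eventually.of_forall fun n j => hbd _ (hDb n) j)
    have hs : Summable fun j => p j (fun _ => y) := hsum.of_norm_bounded (hbd P hPb)
    have hz : a + y ∈ ball a R := by
      rw [mem_ball_iff_norm, add_sub_cancel_left]; linarith [norm_nonneg y]
    have h2 : ∀ n, ∑' j : ℕ, (j.factorial : ℂ)⁻¹ • D n j (fun _ => y) = u n (a + y) := fun n =>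
      (hasSum_iteratedFDeriv_of_ball (hu n) hy2).tsum_eq
    simp only [h2] at hlim
    rw [tendsto_nhds_unique (hg.tendsto_at hz) hlim]
    exact hs.hasSum

/-- A uniform limit of holomorphic functions is holomorphic. -/
theorem analyticAt_of_tendstoUniformlyOn {u : ℕ → V → F} {g : V → F} {a : V} {R : ℝ}
    (hR : 0 < R) (hu : ∀ n, AnalyticOnNhd ℂ (u n) (ball a R))
    (hg : TendstoUniformlyOn u g atTop (ball a R)) : AnalyticAt ℂ g a := by
  -- The functions `u n` need not be bounded on the ball, but from some index on their differences
  -- with `u N` are bounded by `1`.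
  obtain ⟨N, hN⟩ := Metric.uniformCauchySeqOn_iff.1 hg.uniformCauchySeqOn 1 one_pos
  have h1 : TendstoUniformlyOn (fun n => u (n + N) - u N) (g - u N) atTop (ball a R) := by
    rw [Metric.tendstoUniformlyOn_iff] at hg ⊢
    intro ε hε
    filter_upwards [(tendsto_add_atTop_nat N).eventually (hg ε hε)] with n hn z hz
    simpa using hn z hz
  have h2 := analyticAt_of_tendstoUniformlyOn_of_bounded hR
    (fun n => (hu (n + N)).sub (hu N)) (fun n z hz => by
      have := hN (n + N) (by omega) N le_rfl z hz
      rw [dist_eq_norm] at this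
      exact this.le) h1
  simpa using h2.add (hu N a (mem_ball_self hR))

end Limit

/-! ### The mean value inequality for `‖f‖²` -/

section MeanValue

variable {V F : Type*} [NormedAddCommGroup V] [NormedSpace ℂ V] [FiniteDimensional ℂ V]
  [MeasurableSpace V] [BorelSpace V]
  [NormedAddCommGroup F] [NormedSpace ℂ F]

/-- Composing with a norming functional `ℓ` of `g 0` reduces to scalars. The function `ℓ(g)²` is
holomorphic and equals its circle average, so no subharmonicity theory is needed. -/
theorem enorm_sq_le_lintegral_circle {g : ℂ → F} {R : ℝ} (hR : 1 < R)
    (hg : DifferentiableOn ℂ g (ball 0 R)) :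
    ‖g 0‖ₑ ^ 2 ≤ ENNReal.ofReal ((2 * Real.pi)⁻¹) *
      ∫⁻ θ in Ioc 0 (2 * Real.pi), ‖g (circleMap 0 1 θ)‖ₑ ^ 2 := by
  obtain ⟨ℓ, hℓ, hℓg⟩ := exists_dual_vector'' ℂ (g 0)
  have hd : DifferentiableOn ℂ (fun t => ℓ (g t) ^ 2) (ball 0 R) :=
    (ℓ.differentiable.comp_differentiableOn hg).pow 2
  have hm := DiffContOnCl.circleAverage (f := fun t => ℓ (g t) ^ 2) (c := 0) (R := 1)
    (by
      refine DifferentiableOn.diffContOnCl (hd.mono ?_)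
      rw [abs_one]
      exact (closure_ball_subset_closedBall).trans (closedBall_subset_ball hR))
  have h0 : ‖g 0‖ₑ ^ 2 = ‖ℓ (g 0) ^ 2‖ₑ := by
    rw [hℓg, enorm_pow]
    simp [enorm_eq_nnnorm]
  rw [h0, ← hm, Real.circleAverage, enorm_smul]
  gcongr
  · rw [← ofReal_norm, Real.norm_of_nonneg (by positivity)]
  · rw [intervalIntegral.integral_of_le (by positivity)]
    refine (enorm_integral_le_lintegral_enorm _).trans (lintegral_mono fun θ => ?_)
    rw [enorm_pow]
    gcongr
    have := ℓ.le_opENorm (g (circleMap 0 1 θ))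
    refine this.trans ?_
    calc _ ≤ 1 * ‖g (circleMap 0 1 θ)‖ₑ := by
          gcongr
          rw [← ofReal_norm]
          exact (ENNReal.ofReal_le_ofReal hℓ).trans_eq ENNReal.ofReal_one
      _ = _ := one_mul _

/-- A linear automorphism scales Haar measure by a constant. For a unimodular scalar the constant is
`1`, because the unit ball is mapped onto itself. -/
theorem lintegral_comp_smul_circle (m : Measure V) [m.IsAddHaarMeasure] (G : V → ℝ≥0∞)
    {c : ℂ} (hc : ‖c‖ = 1) : ∫⁻ v, G (c • v) ∂m = ∫⁻ v, G v ∂m := by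
  have hc0 : c ≠ 0 := by rintro rfl; simp at hc
  let e : V ≃ₜ V := Homeomorph.smulOfNeZero c hc0
  let L : V ≃ₗ[ℝ] V := (LinearEquiv.smulOfNeZero ℂ V c hc0).restrictScalars ℝ
  have hdet : LinearMap.det (L : V →ₗ[ℝ] V) ≠ 0 := L.isUnit_det'.ne_zero
  have hmap := Measure.map_linearMap_addHaar_eq_smul_addHaar m hdet
  have hmap' : m.map e = m := by
    have h1 : m.map e = ENNReal.ofReal |(LinearMap.det (L : V →ₗ[ℝ] V))⁻¹| • m := hmap
    have h2 : m.map e (ball 0 1) = m (ball 0 1) := by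
      rw [e.measurableEmbedding.map_apply]
      congr 1
      ext v
      simp [e, norm_smul, hc]
    have hpos : m (ball (0 : V) 1) ≠ 0 := (measure_ball_pos m _ one_pos).ne'
    have hfin : m (ball (0 : V) 1) ≠ ⊤ := measure_ball_lt_top.ne
    rw [h1, Measure.smul_apply, smul_eq_mul] at h2
    have h3 : ENNReal.ofReal |(LinearMap.det (L : V →ₗ[ℝ] V))⁻¹| = 1 :=
      (ENNReal.mul_eq_right hpos hfin).1 h2
    rw [h1, h3, one_smul]
  calc ∫⁻ v, G (c • v) ∂m = ∫⁻ v, G v ∂(m.map e) :=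
        (e.toMeasurableEquiv.measurableEmbedding.lintegral_map G).symm
    _ = _ := by rw [hmap']

/-- The mean value inequality on balls of a complex normed space. -/
theorem enorm_sq_mul_le_lintegral (m : Measure V) [m.IsAddHaarMeasure] {f : V → F} {z : V} {ρ : ℝ}
    (hf : DifferentiableOn ℂ f (ball z ρ)) :
    ‖f z‖ₑ ^ 2 * m (ball 0 ρ) ≤ ∫⁻ y in ball z ρ, ‖f y‖ₑ ^ 2 ∂m := by
  have hmem : ∀ v, v ∈ ball (0 : V) ρ ↔ z + v ∈ ball z ρ := fun v => by simp
  -- Extended by zero off the ball, the integrand lives on all of `V`, where rotations preserve the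
  -- measure. Averaging over the circle through each `v`, integrating in `v` and exchanging the
  -- integrals then gives the claim.
  let G : V → ℝ≥0∞ := (ball (0 : V) ρ).indicator fun v => ‖f (z + v)‖ₑ ^ 2
  have hcont : ContinuousOn (fun v => ‖f (z + v)‖ₑ ^ 2) (ball (0 : V) ρ) := by
    have h1 : ContinuousOn (fun v => f (z + v)) (ball (0 : V) ρ) :=
      hf.continuousOn.comp (by fun_prop) fun v hv => (hmem v).1 hv
    exact (ENNReal.continuous_pow 2).comp_continuousOn (continuous_enorm.comp_continuousOn h1)
  have hG : Measurable G := by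
    classical
    have := hcont.measurable_piecewise (g := fun _ => 0) continuousOn_const measurableSet_ball
    convert this using 1
    exact (Set.piecewise_eq_indicator (s := ball (0 : V) ρ)
      (f := fun v => ‖f (z + v)‖ₑ ^ 2)).symm
  have hcirc : ∀ θ : ℝ, ‖circleMap 0 1 θ‖ = 1 := fun θ => by simp
  have hpt : ∀ v ∈ ball (0 : V) ρ, ‖f z‖ₑ ^ 2 ≤ ENNReal.ofReal ((2 * Real.pi)⁻¹) *
      ∫⁻ θ in Ioc 0 (2 * Real.pi), G (circleMap 0 1 θ • v) := fun v hv => by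
    have hv' : ‖v‖ < ρ := mem_ball_zero_iff.1 hv
    obtain ⟨R, hR1, hR⟩ : ∃ R : ℝ, 1 < R ∧ R * ‖v‖ < ρ := by
      have hc : ContinuousAt (fun R : ℝ => R * ‖v‖) 1 := by fun_prop
      have := hc.eventually (Iio_mem_nhds (by simpa using hv'))
      obtain ⟨R, hR, hR'⟩ := ((this.filter_mono nhdsWithin_le_nhds).and
        (self_mem_nhdsWithin (a := (1 : ℝ)) (s := Ioi 1))).exists
      exact ⟨R, hR', hR⟩
    have hd : DifferentiableOn ℂ (fun t : ℂ => f (z + t • v)) (ball 0 R) := by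
      refine hf.comp (by fun_prop) fun t ht => ?_
      rw [mem_ball_iff_norm, add_sub_cancel_left, norm_smul]
      refine (mul_le_mul_of_nonneg_right ?_ (norm_nonneg v)).trans_lt hR
      simpa using (mem_ball_zero_iff.1 ht).le
    have h1 := enorm_sq_le_lintegral_circle hR1 hd
    simp only [zero_smul, add_zero] at h1
    refine h1.trans_eq ?_
    congr 1
    refine lintegral_congr fun θ => ?_
    refine (Set.indicator_of_mem (s := ball (0 : V) ρ) (f := fun v => ‖f (z + v)‖ₑ ^ 2) ?_).symm
    rw [mem_ball_zero_iff, norm_smul, hcirc, one_mul]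
    exact hv'
  have hmeas : Measurable fun p : V × ℝ => G (circleMap 0 1 p.2 • p.1) := by
    refine hG.comp (Continuous.measurable ?_)
    have : Continuous fun p : V × ℝ => circleMap 0 1 p.2 := (continuous_circleMap 0 1).comp
      continuous_snd
    exact this.smul continuous_fst
  have hrhs : ∫⁻ v, G v ∂m = ∫⁻ y in ball z ρ, ‖f y‖ₑ ^ 2 ∂m := by
    rw [← lintegral_indicator measurableSet_ball,
      ← lintegral_add_left_eq_self ((ball z ρ).indicator fun y => ‖f y‖ₑ ^ 2) z]
    refine lintegral_congr fun v => ?_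
    by_cases hv : v ∈ ball (0 : V) ρ
    · rw [show G v = _ from Set.indicator_of_mem hv _, Set.indicator_of_mem ((hmem v).1 hv)]
    · rw [show G v = _ from Set.indicator_of_notMem hv _,
        Set.indicator_of_notMem fun h => hv ((hmem v).2 h)]
  calc ‖f z‖ₑ ^ 2 * m (ball 0 ρ) = ∫⁻ _ in ball (0 : V) ρ, ‖f z‖ₑ ^ 2 ∂m := by
        rw [setLIntegral_const]
    _ ≤ ∫⁻ v in ball (0 : V) ρ, ENNReal.ofReal ((2 * Real.pi)⁻¹) *
          (∫⁻ θ in Ioc 0 (2 * Real.pi), G (circleMap 0 1 θ • v)) ∂m :=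
        setLIntegral_mono' measurableSet_ball hpt
    _ ≤ ∫⁻ v, ENNReal.ofReal ((2 * Real.pi)⁻¹) *
          (∫⁻ θ in Ioc 0 (2 * Real.pi), G (circleMap 0 1 θ • v)) ∂m :=
        setLIntegral_le_lintegral _ _
    _ = ENNReal.ofReal ((2 * Real.pi)⁻¹) *
          ∫⁻ v, (∫⁻ θ in Ioc 0 (2 * Real.pi), G (circleMap 0 1 θ • v)) ∂m :=
        lintegral_const_mul' _ _ ENNReal.ofReal_ne_top
    _ = ENNReal.ofReal ((2 * Real.pi)⁻¹) *
          ∫⁻ θ in Ioc 0 (2 * Real.pi), (∫⁻ v, G (circleMap 0 1 θ • v) ∂m) := by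
        rw [lintegral_lintegral_swap hmeas.aemeasurable]
    _ = ENNReal.ofReal ((2 * Real.pi)⁻¹) *
          ∫⁻ _ in Ioc 0 (2 * Real.pi), (∫⁻ v, G v ∂m) := by
        simp_rw [lintegral_comp_smul_circle m G (hcirc _)]
    _ = ∫⁻ v, G v ∂m := by
        rw [setLIntegral_const, Real.volume_Ioc, sub_zero, mul_comm, mul_assoc,
          ← ENNReal.ofReal_mul (by positivity), mul_inv_cancel₀ (by positivity),
          ENNReal.ofReal_one, mul_one]
    _ = _ := hrhs

end MeanValue

/-! ### The Hilbert space of square integrable sections -/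

section SectionSpace

variable {M : Type*} [MeasurableSpace M] {E : M → Type*} [∀ x, NormedAddCommGroup (E x)]
  [∀ x, InnerProductSpace ℂ (E x)]

/-- The square of the `L²` norm of a section. -/
def sqNorm (ν : Measure M) (f : ∀ x, E x) : ℝ≥0∞ := ∫⁻ x, ‖f x‖ₑ ^ 2 ∂ν

/-- A space of sections with locally uniformly bounded evaluations and closed under `L²` limits. -/
class IsReproducing (ν : Measure M) (W : Submodule ℂ (∀ x, E x)) : Prop where
  measurable_norm : ∀ f ∈ W, Measurable fun x => ‖f x‖
  eval_bound : ∀ x, ∃ C : ℝ≥0∞, C ≠ ⊤ ∧ ∀ f ∈ W, ‖f x‖ₑ ^ 2 ≤ C * sqNorm ν f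
  complete : ∀ u : ℕ → ∀ x, E x, (∀ n, u n ∈ W) →
    (∀ ε : ℝ≥0∞, 0 < ε → ∃ N, ∀ m ≥ N, ∀ n ≥ N, sqNorm ν (u m - u n) ≤ ε) →
    ∃ f ∈ W, ∀ x, Tendsto (fun n => u n x) atTop (𝓝 (f x))

variable {ν : Measure M} {W : Submodule ℂ (∀ x, E x)}

theorem sqNorm_smul (c : ℂ) (f : ∀ x, E x) : sqNorm ν (c • f) = ‖c‖ₑ ^ 2 * sqNorm ν f := by
  unfold sqNorm
  rw [← lintegral_const_mul' _ _ (by simp)]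
  simp [enorm_smul, mul_pow]

theorem measurable_enorm_sq {f : ∀ x, E x} (hf : Measurable fun x => ‖f x‖) :
    Measurable fun x => ‖f x‖ₑ ^ 2 := by
  have : (fun x => ‖f x‖ₑ ^ 2) = fun x => ENNReal.ofReal ‖f x‖ ^ 2 := by
    ext x; rw [ofReal_norm]
  rw [this]
  exact hf.ennreal_ofReal.pow_const 2

theorem enorm_add_sq_le {A : Type*} [NormedAddCommGroup A] (a b : A) :
    ‖a + b‖ₑ ^ 2 ≤ 4 * (‖a‖ₑ ^ 2 + ‖b‖ₑ ^ 2) := by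
  have h1 : ‖a + b‖ₑ ≤ 2 * max ‖a‖ₑ ‖b‖ₑ := by
    refine (enorm_add_le _ _).trans ?_
    rw [two_mul]
    gcongr
    exacts [le_max_left _ _, le_max_right _ _]
  calc ‖a + b‖ₑ ^ 2 ≤ (2 * max ‖a‖ₑ ‖b‖ₑ) ^ 2 := by gcongr
    _ = 4 * max ‖a‖ₑ ‖b‖ₑ ^ 2 := by rw [mul_pow]; norm_num
    _ ≤ _ := by
      gcongr
      rcases max_choice ‖a‖ₑ ‖b‖ₑ with h | h <;> rw [h]
      exacts [le_self_add, le_add_self]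

theorem sqNorm_add_le {f g : ∀ x, E x} (hf : Measurable fun x => ‖f x‖) :
    sqNorm ν (f + g) ≤ 4 * (sqNorm ν f + sqNorm ν g) := by
  unfold sqNorm
  rw [← lintegral_add_left (measurable_enorm_sq hf), ← lintegral_const_mul' _ _ (by simp)]
  exact lintegral_mono fun x => enorm_add_sq_le _ _

/-- The fibres vary with the point, so measurability is available only for norms. Polarization
expresses the inner product through norms of elements of `W`. -/
theorem measurable_inner {f g : ∀ x, E x} (hW : ∀ f ∈ W, Measurable fun x => ‖f x‖)
    (hf : f ∈ W) (hg : g ∈ W) : Measurable fun x => inner ℂ (f x) (g x) := by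
  have h1 := hW _ (W.add_mem hf hg)
  have h2 := hW _ (W.sub_mem hf hg)
  have h3 := hW _ (W.sub_mem hf (W.smul_mem Complex.I hg))
  have h4 := hW _ (W.add_mem hf (W.smul_mem Complex.I hg))
  simp only [Pi.add_apply, Pi.sub_apply, Pi.smul_apply] at h1 h2 h3 h4
  simp_rw [inner_eq_sum_norm_sq_div_four]
  simp only [Complex.coe_algebraMap, RCLike.I_to_complex]
  fun_prop

theorem integrable_norm_sq {f : ∀ x, E x} (hf : Measurable fun x => ‖f x‖) (h : sqNorm ν f < ⊤) :
    Integrable (fun x => ‖f x‖ ^ 2) ν := by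
  refine ⟨(hf.pow_const 2).aestronglyMeasurable, ?_⟩
  rw [hasFiniteIntegral_iff_enorm]
  refine lt_of_eq_of_lt (lintegral_congr fun x => ?_) h
  rw [enorm_pow, enorm_norm]

theorem integral_norm_sq {f : ∀ x, E x} (hf : Measurable fun x => ‖f x‖) :
    ∫ x, ‖f x‖ ^ 2 ∂ν = (sqNorm ν f).toReal := by
  rw [integral_eq_lintegral_of_nonneg_ae (Eventually.of_forall fun x => sq_nonneg _)
    (hf.pow_const 2).aestronglyMeasurable, sqNorm]
  congr 1
  refine lintegral_congr fun x => ?_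
  rw [ENNReal.ofReal_pow (norm_nonneg _), ofReal_norm]

theorem integrable_inner {f g : ∀ x, E x} (hW : ∀ f ∈ W, Measurable fun x => ‖f x‖)
    (hf : f ∈ W) (hg : g ∈ W) (hf' : sqNorm ν f < ⊤) (hg' : sqNorm ν g < ⊤) :
    Integrable (fun x => inner ℂ (f x) (g x)) ν := by
  refine ((integrable_norm_sq (hW f hf) hf').add (integrable_norm_sq (hW g hg) hg')).mono'
    (measurable_inner hW hf hg).aestronglyMeasurable (Eventually.of_forall fun x => ?_)
  refine (norm_inner_le_norm _ _).trans ?_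
  simp only [Pi.add_apply]
  nlinarith [sq_nonneg (‖f x‖ - ‖g x‖), sq_nonneg (‖f x‖), sq_nonneg (‖g x‖)]

variable (ν W)

/-- The square integrable elements of `W`. -/
def l2Submodule [IsReproducing ν W] : Submodule ℂ (∀ x, E x) where
  carrier := {f | f ∈ W ∧ sqNorm ν f < ⊤}
  zero_mem' := ⟨W.zero_mem, by simp [sqNorm]⟩
  add_mem' {f g} hf hg := ⟨W.add_mem hf.1 hg.1,
    (sqNorm_add_le (IsReproducing.measurable_norm ν f hf.1)).trans_lt
      (ENNReal.mul_lt_top (by simp) (ENNReal.add_lt_top.2 ⟨hf.2, hg.2⟩))⟩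
  smul_mem' c f hf := ⟨W.smul_mem c hf.1, by
    rw [sqNorm_smul]; exact ENNReal.mul_lt_top (by simp) hf.2⟩

/-- The Hilbert space of square integrable elements of `W`. -/
def SectionL2 [IsReproducing ν W] : Type _ := l2Submodule ν W

variable [IsReproducing ν W]

instance : AddCommGroup (SectionL2 ν W) := inferInstanceAs (AddCommGroup (l2Submodule ν W))

instance : Module ℂ (SectionL2 ν W) := inferInstanceAs (Module ℂ (l2Submodule ν W))

variable {ν W}

namespace SectionL2

variable (ν) in
/-- A square integrable element of `W`, as an element of the Hilbert space. -/
def mk (f : ∀ x, E x) (hf : f ∈ W) (hν : sqNorm ν f < ⊤) : SectionL2 ν W :=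
  (⟨f, hf, hν⟩ : l2Submodule ν W)

theorem measurable_norm (f : SectionL2 ν W) : Measurable fun x => ‖f.1 x‖ :=
  IsReproducing.measurable_norm ν _ f.2.1

theorem add_val (f g : SectionL2 ν W) : (f + g).1 = f.1 + g.1 := rfl

theorem sub_val (f g : SectionL2 ν W) : (f - g).1 = f.1 - g.1 := rfl

theorem smul_val (c : ℂ) (f : SectionL2 ν W) : (c • f).1 = c • f.1 := rfl

theorem integrable (f g : SectionL2 ν W) : Integrable (fun x => inner ℂ (f.1 x) (g.1 x)) ν :=
  integrable_inner (IsReproducing.measurable_norm ν) f.2.1 g.2.1 f.2.2 g.2.2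

theorem integral_inner_self (f : SectionL2 ν W) :
    ∫ x, inner ℂ (f.1 x) (f.1 x) ∂ν = ((sqNorm ν f.1).toReal : ℂ) := by
  simp_rw [inner_self_eq_norm_sq_to_K]
  rw [← integral_norm_sq f.measurable_norm, ← integral_complex_ofReal]
  simp

/-- Bounded point evaluations turn a null section into the zero section. Hence the `L²` seminorm is
a norm on actual sections and no quotient by almost everywhere equality is taken. -/
theorem eq_zero_of_sqNorm {f : ∀ x, E x} (hf : f ∈ W) (h : sqNorm ν f = 0) : f = 0 := by
  ext x
  obtain ⟨C, hC, hb⟩ := IsReproducing.eval_bound (ν := ν) (W := W) x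
  have := hb f hf
  rw [h, mul_zero, nonpos_iff_eq_zero] at this
  simpa using this

instance instCore : InnerProductSpace.Core ℂ (SectionL2 ν W) where
  inner f g := ∫ x, inner ℂ (f.1 x) (g.1 x) ∂ν
  conj_inner_symm f g := by
    rw [← integral_conj]
    exact integral_congr_ae (Eventually.of_forall fun x => inner_conj_symm _ _)
  re_inner_nonneg f := by
    rw [integral_inner_self]
    simp
  add_left f g h := by
    rw [← integral_add (f.integrable h) (g.integrable h)]
    exact integral_congr_ae (Eventually.of_forall fun x => inner_add_left _ _ _)
  smul_left f g c := by
    rw [← integral_const_mul]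
    exact integral_congr_ae (Eventually.of_forall fun x => inner_smul_left _ _ _)
  definite f h := by
    rw [integral_inner_self] at h
    have h1 : (sqNorm ν f.1).toReal = 0 := by exact_mod_cast h
    have h2 := (ENNReal.toReal_eq_zero_iff _).1 h1
    exact Subtype.ext (eq_zero_of_sqNorm f.2.1 (h2.resolve_right f.2.2.ne))

instance : NormedAddCommGroup (SectionL2 ν W) :=
  InnerProductSpace.Core.toNormedAddCommGroup (𝕜 := ℂ)

instance : InnerProductSpace ℂ (SectionL2 ν W) := InnerProductSpace.ofCore _

theorem inner_def (f g : SectionL2 ν W) :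
    inner ℂ f g = ∫ x, inner ℂ (f.1 x) (g.1 x) ∂ν := rfl

theorem norm_sq (f : SectionL2 ν W) : ‖f‖ ^ 2 = (sqNorm ν f.1).toReal := by
  have h1 := inner_self_eq_norm_sq_to_K (𝕜 := ℂ) f
  rw [inner_def, integral_inner_self] at h1
  exact Complex.ofReal_injective (by rw [h1]; push_cast; rfl)

theorem enorm_sq (f : SectionL2 ν W) : ‖f‖ₑ ^ 2 = sqNorm ν f.1 := by
  rw [← ofReal_norm, ← ENNReal.ofReal_pow (norm_nonneg _), norm_sq,
    ENNReal.ofReal_toReal f.2.2.ne]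

/-- A Cauchy sequence has a pointwise limit in `W` by the class axiom `complete`. Fatou's lemma
shows that this limit is square integrable and is also the limit in norm. -/
instance : CompleteSpace (SectionL2 ν W) := by
  refine Metric.complete_of_cauchySeq_tendsto fun u hu => ?_
  have hc : ∀ ε : ℝ≥0∞, 0 < ε → ∃ N, ∀ m ≥ N, ∀ n ≥ N, sqNorm ν ((u m).1 - (u n).1) ≤ ε := by
    intro ε hε
    obtain ⟨δ, hδ, hδε⟩ : ∃ δ : ℝ, 0 < δ ∧ ENNReal.ofReal δ ^ 2 ≤ ε := by
      rcases eq_or_ne ε ⊤ with rfl | htop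
      · exact ⟨1, one_pos, le_top⟩
      refine ⟨Real.sqrt ε.toReal, Real.sqrt_pos.2 (ENNReal.toReal_pos hε.ne' htop), ?_⟩
      rw [← ENNReal.ofReal_pow (Real.sqrt_nonneg _), Real.sq_sqrt ENNReal.toReal_nonneg,
        ENNReal.ofReal_toReal htop]
    obtain ⟨N, hN⟩ := Metric.cauchySeq_iff.1 hu δ hδ
    refine ⟨N, fun m hm n hn => le_trans ?_ hδε⟩
    rw [← sub_val, ← enorm_sq, ← ofReal_norm]
    gcongr
    rw [← dist_eq_norm]
    exact (hN m hm n hn).le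
  obtain ⟨f, hfW, hf⟩ := IsReproducing.complete (ν := ν) (W := W) (fun n => (u n).1)
    (fun n => (u n).2.1) hc
  have hfatou : ∀ ε : ℝ≥0∞, 0 < ε → ∃ N, ∀ n ≥ N, sqNorm ν (f - (u n).1) ≤ ε := by
    intro ε hε
    obtain ⟨N, hN⟩ := hc ε hε
    refine ⟨N, fun n hn => ?_⟩
    have h1 : sqNorm ν (f - (u n).1) ≤ liminf (fun m => sqNorm ν ((u m).1 - (u n).1)) atTop := by
      have h2 : ∀ x, ‖(f - (u n).1) x‖ₑ ^ 2 =
          liminf (fun m => ‖((u m).1 - (u n).1) x‖ₑ ^ 2) atTop := fun x => by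
        refine (Tendsto.liminf_eq ?_).symm
        exact ((ENNReal.continuous_pow 2).tendsto _).comp
          ((continuous_enorm.tendsto _).comp ((hf x).sub_const _))
      unfold sqNorm
      simp_rw [h2]
      refine lintegral_liminf_le fun m => measurable_enorm_sq ?_
      exact (u m - u n).measurable_norm
    refine h1.trans ?_
    refine liminf_le_of_frequently_le' (Eventually.frequently ?_)
    filter_upwards [eventually_ge_atTop N] with m hm using hN m hm n hn
  obtain ⟨N, hN⟩ := hfatou 1 one_pos
  have hfin : sqNorm ν f < ⊤ := by
    have h1 := sqNorm_add_le (ν := ν) (f := (u N).1) (g := f - (u N).1) (u N).measurable_norm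
    rw [add_sub_cancel] at h1
    exact h1.trans_lt (ENNReal.mul_lt_top (by simp) (ENNReal.add_lt_top.2
      ⟨(u N).2.2, (hN N le_rfl).trans_lt ENNReal.one_lt_top⟩))
  refine ⟨mk ν f hfW hfin, Metric.tendsto_atTop.2 ?_⟩
  intro ε hε
  obtain ⟨N, hN⟩ := hfatou (ENNReal.ofReal ((ε / 2) ^ 2)) (by positivity)
  refine ⟨N, fun n hn => ?_⟩
  have h1 : ‖mk ν f hfW hfin - u n‖ ^ 2 ≤ (ε / 2) ^ 2 := by
    rw [norm_sq]
    exact ENNReal.toReal_le_of_le_ofReal (by positivity) (hN n hn)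
  rw [dist_comm, dist_eq_norm]
  have := abs_le_of_sq_le_sq h1 (by positivity)
  rw [abs_of_nonneg (norm_nonneg _)] at this
  linarith

end SectionL2

end SectionSpace

/-! ### Elements of least norm in a coset of a closed subspace -/

section Minimal

variable {H : Type*} [NormedAddCommGroup H] [InnerProductSpace ℂ H]

/-- The Pythagorean theorem in a coset of a subspace. -/
theorem norm_sq_eq_of_mem_orthogonal {L : Submodule ℂ H} {g g' : H} (hg : g ∈ Lᗮ)
    (h : g' - g ∈ L) : ‖g'‖ ^ 2 = ‖g‖ ^ 2 + ‖g' - g‖ ^ 2 := by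
  have h1 : inner ℂ g (g' - g) = 0 := L.inner_left_of_mem_orthogonal h hg
  have := norm_add_sq_eq_norm_sq_add_norm_sq_of_inner_eq_zero g (g' - g) h1
  rw [add_sub_cancel] at this
  simpa [sq] using this

theorem exists_sub_mem_mem_orthogonal [CompleteSpace H] {L : Submodule ℂ H}
    (hL : IsClosed (L : Set H)) (f : H) : ∃ g, g - f ∈ L ∧ g ∈ Lᗮ := by
  have : CompleteSpace L := hL.completeSpace_coe
  obtain ⟨l, hl, g, hg, rfl⟩ := L.exists_add_mem_mem_orthogonal f
  exact ⟨g, by simpa using hl, hg⟩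

end Minimal

/-! ### Continuous Hermitian metrics in local trivializations -/

section Hermitian

variable {M : Type*} [TopologicalSpace M] {F : Type*} [NormedAddCommGroup F] [NormedSpace ℂ F]
  [FiniteDimensional ℂ F] {E : M → Type*} [TopologicalSpace (TotalSpace F E)]
  [∀ x, NormedAddCommGroup (E x)] [∀ x, InnerProductSpace ℂ (E x)]
  [FiberBundle F E] [VectorBundle ℂ F E] [IsContinuousHermitianBundle F E]

/-- Expanding the vector in a basis writes the squared norm as a sum of products of coordinates and
Gram matrix entries. This gives continuity jointly in the point and the vector. -/
theorem continuousOn_norm_symmL (e : Trivialization F (π F E)) [MemTrivializationAtlas e] :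
    ContinuousOn (fun p : M × F => ‖e.symmL ℂ p.1 p.2‖) (e.baseSet ×ˢ univ) := by
  let b := Module.finBasis ℂ F
  have hsq : ContinuousOn
      (fun p : M × F => ∑ i, ∑ j, (starRingEnd ℂ) (b.repr p.2 i) * b.repr p.2 j *
        inner ℂ (e.symm p.1 (b i)) (e.symm p.1 (b j))) (e.baseSet ×ˢ univ) := by
    have hrepr : ∀ i, Continuous fun p : M × F => b.repr p.2 i := fun i =>
      (LinearMap.continuous_of_finiteDimensional (b.coord i)).comp continuous_snd
    refine continuousOn_finsetSum _ fun i _ => continuousOn_finsetSum _ fun j _ => ?_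
    refine ((Complex.continuous_conj.comp (hrepr i)).mul (hrepr j)).continuousOn.mul ?_
    exact (IsContinuousHermitianBundle.continuousOn_inner e (b i) (b j)).comp continuousOn_fst
      fun p hp => hp.1
  have heq : ∀ p ∈ e.baseSet ×ˢ (univ : Set F), ‖e.symmL ℂ p.1 p.2‖ =
      Real.sqrt (∑ i, ∑ j, (starRingEnd ℂ) (b.repr p.2 i) * b.repr p.2 j *
        inner ℂ (e.symm p.1 (b i)) (e.symm p.1 (b j))).re := fun p hp => by
    have h1 : e.symmL ℂ p.1 p.2 = ∑ i, b.repr p.2 i • e.symm p.1 (b i) := by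
      conv_lhs => rw [← b.sum_repr p.2]
      rw [map_sum]
      exact Finset.sum_congr rfl fun i _ => by rw [map_smul, e.symmL_apply hp.1]
    have h2 : inner ℂ (e.symmL ℂ p.1 p.2) (e.symmL ℂ p.1 p.2) =
        ∑ i, ∑ j, (starRingEnd ℂ) (b.repr p.2 i) * b.repr p.2 j *
        inner ℂ (e.symm p.1 (b i)) (e.symm p.1 (b j)) := by
      rw [h1, sum_inner]
      refine Finset.sum_congr rfl fun i _ => ?_
      rw [inner_sum]
      refine Finset.sum_congr rfl fun j _ => ?_
      rw [inner_smul_left, inner_smul_right, mul_assoc]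
    rw [← h2, norm_eq_sqrt_re_inner (𝕜 := ℂ)]
    rfl
  exact (Real.continuous_sqrt.comp_continuousOn (Complex.continuous_re.comp_continuousOn hsq)).congr
    heq

/-- Near every point, the norm on the fibres dominates the norm in a local trivialization. -/
theorem eventually_norm_trivialization_le (x : M) : ∃ C : ℝ, 0 < C ∧ ∀ᶠ y in 𝓝 x, ∀ v : E y,
    ‖(trivializationAt F E x ⟨y, v⟩).2‖ ≤ C * ‖v‖ := by
  set e := trivializationAt F E x
  have hx : x ∈ e.baseSet := mem_baseSet_trivializationAt F E x
  have hcpt : IsCompact (sphere (0 : F) 1) := by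
    have : ProperSpace F := FiniteDimensional.proper ℂ F
    exact isCompact_sphere 0 1
  have hc : ∀ v, ContinuousAt (fun p : M × F => ‖e.symmL ℂ p.1 p.2‖) (x, v) := fun v =>
    (continuousOn_norm_symmL e).continuousAt
      ((e.open_baseSet.prod isOpen_univ).mem_nhds ⟨hx, mem_univ _⟩)
  -- `δ` is half the minimum of the fibre norm at `x` over the unit sphere of the model fibre; the
  -- strict inequality persists at nearby points by compactness of the sphere. The sphere is empty
  -- for a bundle of rank zero.
  obtain ⟨δ, hδ, hδs⟩ : ∃ δ : ℝ, 0 < δ ∧ ∀ v ∈ sphere (0 : F) 1, δ < ‖e.symmL ℂ x v‖ := by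
    have hpos : ∀ v ∈ sphere (0 : F) 1, 0 < ‖e.symmL ℂ x v‖ := fun v hv => by
      rw [norm_pos_iff]
      intro h0
      have h1 := e.continuousLinearMapAt_symmL (R := ℂ) hx v
      rw [h0, map_zero] at h1
      rw [← h1, mem_sphere_zero_iff_norm, norm_zero] at hv
      exact zero_ne_one hv
    rcases (sphere (0 : F) 1).eq_empty_or_nonempty with h | h
    · exact ⟨1, one_pos, by simp [h]⟩
    · obtain ⟨w, hw, hmin⟩ := hcpt.exists_isMinOn h
        ((e.symmL ℂ x).continuous.norm.continuousOn)
      exact ⟨‖e.symmL ℂ x w‖ / 2, half_pos (hpos w hw), fun v hv =>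
        (half_lt_self (hpos w hw)).trans_le (hmin hv)⟩
  have hev : ∀ᶠ y in 𝓝 x, ∀ v ∈ sphere (0 : F) 1, δ < ‖e.symmL ℂ y v‖ :=
    hcpt.eventually_forall_of_forall_eventually fun v hv =>
      (hc v).eventually (lt_mem_nhds (hδs v hv))
  refine ⟨δ⁻¹, inv_pos.2 hδ, ?_⟩
  filter_upwards [hev, e.open_baseSet.mem_nhds hx] with y hy hyb v
  rw [← e.continuousLinearMapAt_apply_of_mem (R := ℂ) hyb, inv_mul_eq_div, le_div_iff₀ hδ]
  set w := e.continuousLinearMapAt ℂ y v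
  rcases eq_or_ne w 0 with h0 | h0
  · rw [h0]; simp
  have hw : 0 < ‖w‖ := norm_pos_iff.2 h0
  have h1 := hy ((‖w‖ : ℂ)⁻¹ • w) (by
    rw [mem_sphere_zero_iff_norm, norm_smul, norm_inv, Complex.norm_real, norm_norm,
      inv_mul_cancel₀ hw.ne'])
  rw [map_smul, norm_smul, norm_inv, Complex.norm_real, norm_norm,
    e.symmL_continuousLinearMapAt hyb, inv_mul_eq_div, lt_div_iff₀ hw] at h1
  linarith

theorem continuous_norm_section {f : ∀ x, E x}
    (hf : Continuous fun x => TotalSpace.mk' F x (f x)) : Continuous fun x => ‖f x‖ := by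
  refine continuous_iff_continuousAt.2 fun x => ?_
  set e := trivializationAt F E x
  have hx : x ∈ e.baseSet := mem_baseSet_trivializationAt F E x
  have h1 : ContinuousAt (fun y => (e ⟨y, f y⟩).2) x := by
    refine continuousAt_snd.comp ?_
    exact (e.continuousOn.continuousAt (e.open_source.mem_nhds
      (e.mem_source.2 hx))).comp hf.continuousAt
  have h2 : ContinuousAt (fun p : M × F => ‖e.symmL ℂ p.1 p.2‖) (x, (e ⟨x, f x⟩).2) :=
    (continuousOn_norm_symmL e).continuousAt
      ((e.open_baseSet.prod isOpen_univ).mem_nhds ⟨hx, mem_univ _⟩)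
  have h3 : ContinuousAt (fun y => ‖e.symmL ℂ y (e ⟨y, f y⟩).2‖) x :=
    ContinuousAt.comp (f := fun y => (y, (e ⟨y, f y⟩).2)) h2 (continuousAt_id.prodMk h1)
  refine h3.congr ?_
  filter_upwards [e.open_baseSet.mem_nhds hx] with y hy
  rw [← e.continuousLinearMapAt_apply_of_mem (R := ℂ) hy, e.symmL_continuousLinearMapAt hy]

end Hermitian

/-! ### Holomorphic sections and their local representations -/

section Sections

variable {V : Type*} [NormedAddCommGroup V] [NormedSpace ℂ V] {H : Type*} [TopologicalSpace H]
  (I : ModelWithCorners ℂ V H) [I.Boundaryless]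
  {M : Type*} [TopologicalSpace M] [ChartedSpace H M] [IsManifold I ω M]
  (F : Type*) [NormedAddCommGroup F] [NormedSpace ℂ F] [CompleteSpace F]
  {E : M → Type*} [TopologicalSpace (TotalSpace F E)]
  [∀ x, NormedAddCommGroup (E x)] [∀ x, InnerProductSpace ℂ (E x)]
  [FiberBundle F E] [VectorBundle ℂ F E] [ContMDiffVectorBundle ω F E I]

variable (E)

/-- The domain on which the local representation around `x` is meaningful. -/
def localDomain (x : M) : Set V :=
  (extChartAt I x).target ∩ (extChartAt I x).symm ⁻¹' (trivializationAt F E x).baseSet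

theorem isOpen_localDomain (x : M) : IsOpen (localDomain I F E x) :=
  (continuousOn_extChartAt_symm x).isOpen_inter_preimage (isOpen_extChartAt_target x)
    (trivializationAt F E x).open_baseSet

theorem mem_localDomain (x : M) : extChartAt I x x ∈ localDomain I F E x :=
  ⟨mem_extChartAt_target x, by
    rw [mem_preimage, extChartAt_to_inv]; exact mem_baseSet_trivializationAt F E x⟩

theorem localDomain_mem_nhds (x : M) : localDomain I F E x ∈ 𝓝 (extChartAt I x x) :=
  (isOpen_localDomain I F E x).mem_nhds (mem_localDomain I F E x)

variable {I F E}

theorem localRep_apply {x : M} {z : V} (hz : z ∈ localDomain I F E x) (f : ∀ x, E x) :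
    localRep I F x f z = (trivializationAt F E x).continuousLinearMapAt ℂ
      ((extChartAt I x).symm z) (f ((extChartAt I x).symm z)) :=
  ((trivializationAt F E x).continuousLinearMapAt_apply_of_mem (R := ℂ) hz.2 _).symm

theorem localRep_add {x : M} {z : V} (hz : z ∈ localDomain I F E x) (f g : ∀ x, E x) :
    localRep I F x (f + g) z = localRep I F x f z + localRep I F x g z := by
  simp only [localRep_apply hz, Pi.add_apply, map_add]

theorem localRep_sub {x : M} {z : V} (hz : z ∈ localDomain I F E x) (f g : ∀ x, E x) :
    localRep I F x (f - g) z = localRep I F x f z - localRep I F x g z := by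
  simp only [localRep_apply hz, Pi.sub_apply, map_sub]

theorem localRep_smul {x : M} {z : V} (hz : z ∈ localDomain I F E x) (c : ℂ) (f : ∀ x, E x) :
    localRep I F x (c • f) z = c • localRep I F x f z := by
  simp only [localRep_apply hz, Pi.smul_apply, map_smul]

theorem IsHolomorphicSection.analyticOnNhd {f : ∀ x, E x} (hf : IsHolomorphicSection I F f)
    (x : M) : AnalyticOnNhd ℂ (localRep I F x f) (localDomain I F E x) := by
  intro z hz
  have h1 := ((trivializationAt F E x).contMDiffAt_section_iff (IB := I) hz.2).1
    (hf ((extChartAt I x).symm z))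
  have h2 : ContMDiffAt 𝓘(ℂ, V) I ω (extChartAt I x).symm z :=
    (contMDiffOn_extChartAt_symm x).contMDiffAt ((isOpen_extChartAt_target x).mem_nhds hz.1)
  have h3 : ContMDiffAt 𝓘(ℂ, V) 𝓘(ℂ, F) ω (localRep I F x f) z := h1.comp z h2
  exact h3.contDiffAt.analyticAt

theorem IsHolomorphicSection.analyticAt {f : ∀ x, E x} (hf : IsHolomorphicSection I F f)
    (x : M) : AnalyticAt ℂ (localRep I F x f) (extChartAt I x x) :=
  hf.analyticOnNhd x _ (mem_localDomain I F E x)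

/-- Analyticity at the centre of each preferred chart suffices, since every point is the centre of
its own chart. -/
theorem isHolomorphicSection_of_analyticAt {f : ∀ x, E x}
    (hf : ∀ x, AnalyticAt ℂ (localRep I F x f) (extChartAt I x x)) :
    IsHolomorphicSection I F f := by
  intro x
  rw [contMDiffAt_section]
  have h1 : ContMDiffAt 𝓘(ℂ, V) 𝓘(ℂ, F) ω (localRep I F x f) (extChartAt I x x) :=
    (hf x).contDiffAt.contMDiffAt
  refine (h1.comp x contMDiffAt_extChartAt).congr_of_eventuallyEq ?_
  filter_upwards [extChartAt_source_mem_nhds (I := I) x] with y hy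
  simp only [localRep, Function.comp_apply]
  rw [(extChartAt I x).left_inv hy]

variable (I F E) in
/-- The space of holomorphic sections. -/
def holomorphicSections : Submodule ℂ (∀ x, E x) where
  carrier := {f | IsHolomorphicSection I F f}
  zero_mem' := contMDiff_zeroSection ℂ E
  add_mem' hf hg := ContMDiff.add_section hf hg
  smul_mem' c f hf := isHolomorphicSection_of_analyticAt fun x => by
    refine ((IsHolomorphicSection.analyticAt hf x).const_smul (c := c)).congr ?_
    filter_upwards [localDomain_mem_nhds I F E x] with z hz using (localRep_smul hz c f).symm

theorem iteratedFDeriv_localRep_add {f g : ∀ x, E x} (hf : IsHolomorphicSection I F f)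
    (hg : IsHolomorphicSection I F g) (x : M) (j : ℕ) :
    iteratedFDeriv ℂ j (localRep I F x (f + g)) (extChartAt I x x) =
      iteratedFDeriv ℂ j (localRep I F x f) (extChartAt I x x) +
      iteratedFDeriv ℂ j (localRep I F x g) (extChartAt I x x) := by
  rw [← iteratedFDeriv_add_apply (hf.analyticAt x).contDiffAt (hg.analyticAt x).contDiffAt]
  refine Filter.EventuallyEq.eq_of_nhds (Filter.EventuallyEq.iteratedFDeriv ℂ ?_ j)
  filter_upwards [localDomain_mem_nhds I F E x] with z hz using localRep_add hz f g

theorem iteratedFDeriv_localRep_sub {f g : ∀ x, E x} (hf : IsHolomorphicSection I F f)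
    (hg : IsHolomorphicSection I F g) (x : M) (j : ℕ) :
    iteratedFDeriv ℂ j (localRep I F x (f - g)) (extChartAt I x x) =
      iteratedFDeriv ℂ j (localRep I F x f) (extChartAt I x x) -
      iteratedFDeriv ℂ j (localRep I F x g) (extChartAt I x x) := by
  rw [← iteratedFDeriv_sub_apply (hf.analyticAt x).contDiffAt (hg.analyticAt x).contDiffAt]
  refine Filter.EventuallyEq.eq_of_nhds (Filter.EventuallyEq.iteratedFDeriv ℂ ?_ j)
  filter_upwards [localDomain_mem_nhds I F E x] with z hz using localRep_sub hz f g

theorem iteratedFDeriv_localRep_smul {f : ∀ x, E x} (hf : IsHolomorphicSection I F f) (c : ℂ)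
    (x : M) (j : ℕ) :
    iteratedFDeriv ℂ j (localRep I F x (c • f)) (extChartAt I x x) =
      c • iteratedFDeriv ℂ j (localRep I F x f) (extChartAt I x x) := by
  rw [← iteratedFDeriv_const_smul_apply (hf.analyticAt x).contDiffAt]
  refine Filter.EventuallyEq.eq_of_nhds (Filter.EventuallyEq.iteratedFDeriv ℂ ?_ j)
  filter_upwards [localDomain_mem_nhds I F E x] with z hz using localRep_smul hz c f

theorem coincideUpTo_iff_sub {f g : ∀ x, E x} (hf : IsHolomorphicSection I F f)
    (hg : IsHolomorphicSection I F g) {k : ℤ} {S : Set M} :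
    CoincideUpTo I F k S f g ↔ ∀ x ∈ S, ∀ j : ℕ, (j : ℤ) ≤ k →
      iteratedFDeriv ℂ j (localRep I F x (f - g)) (extChartAt I x x) = 0 := by
  refine forall₂_congr fun x _ => forall₂_congr fun j _ => ?_
  rw [iteratedFDeriv_localRep_sub hf hg, sub_eq_zero]

end Sections

/-! ### Bounded jets, completeness and minimal extensions -/

section Reproducing

variable {V : Type*} [NormedAddCommGroup V] [NormedSpace ℂ V] [FiniteDimensional ℂ V]
  [MeasurableSpace V] [BorelSpace V] {H : Type*} [TopologicalSpace H]
  {I : ModelWithCorners ℂ V H} [I.Boundaryless]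
  {M : Type*} [TopologicalSpace M] [ChartedSpace H M] [IsManifold I ω M]
  [MeasurableSpace M] [BorelSpace M]
  {F : Type*} [NormedAddCommGroup F] [NormedSpace ℂ F] [FiniteDimensional ℂ F]
  {E : M → Type*} [TopologicalSpace (TotalSpace F E)]
  [∀ x, NormedAddCommGroup (E x)] [∀ x, InnerProductSpace ℂ (E x)]
  [FiberBundle F E] [VectorBundle ℂ F E] [ContMDiffVectorBundle ω F E I]
  [IsContinuousHermitianBundle F E]

variable (I) in
/-- In every chart the measure `ν` locally dominates a multiple of `m`. -/
def LocallyDominates (m : Measure V) (ν : Measure M) : Prop :=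
  ∀ x : M, ∃ r > 0, ball (extChartAt I x x) r ⊆ (extChartAt I x).target ∧
    ∃ C : ℝ≥0∞, C ≠ ⊤ ∧ ∀ g : M → ℝ≥0∞, Measurable g →
      ∫⁻ z in ball (extChartAt I x x) r, g ((extChartAt I x).symm z) ∂m ≤ C * ∫⁻ y, g y ∂ν

variable {m : Measure V} [m.IsAddHaarMeasure] {ν : Measure M}

variable (F) in
theorem IsHolomorphicSection.measurable_norm {f : ∀ x, E x} (hf : IsHolomorphicSection I F f) :
    Measurable fun x => ‖f x‖ :=
  (continuous_norm_section (ContMDiff.continuous hf)).measurable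

variable (F E) in
/-- Locally, holomorphic sections are uniformly bounded by their `L²` norm. -/
theorem exists_enorm_localRep_le (hν : LocallyDominates I m ν) (x : M) :
    ∃ r > 0, ball (extChartAt I x x) r ⊆ localDomain I F E x ∧ ∃ C : ℝ≥0∞, C ≠ ⊤ ∧
      ∀ f : ∀ x, E x, IsHolomorphicSection I F f → ∀ z ∈ ball (extChartAt I x x) r,
        ‖localRep I F x f z‖ₑ ^ 2 ≤ C * sqNorm ν f := by
  obtain ⟨r₀, hr₀, hball, C, hC, hdom⟩ := hν x
  obtain ⟨K, hK, hKev⟩ := eventually_norm_trivialization_le (F := F) (E := E) x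
  have hcs : ContinuousAt (extChartAt I x).symm (extChartAt I x x) :=
    continuousAt_extChartAt_symm x
  have hev : ∀ᶠ z in 𝓝 (extChartAt I x x), ∀ v : E ((extChartAt I x).symm z),
      ‖(trivializationAt F E x ⟨(extChartAt I x).symm z, v⟩).2‖ ≤ K * ‖v‖ :=
    hcs.eventually (by rw [extChartAt_to_inv]; exact hKev)
  obtain ⟨r₁, hr₁, hb⟩ := Metric.eventually_nhds_iff_ball.1
    (hev.and (localDomain_mem_nhds I F E x))
  -- With half the radius, the mean value ball around any `z` in the ball of radius `ρ` stays where
  -- both the comparison of measures and the bound on the trivialization hold.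
  set ρ := min r₀ r₁ / 2 with hρdef
  have hρ : 0 < ρ := half_pos (lt_min hr₀ hr₁)
  have hρ0 : 2 * ρ ≤ r₀ := by rw [hρdef]; linarith [min_le_left r₀ r₁]
  have hρ1 : 2 * ρ ≤ r₁ := by rw [hρdef]; linarith [min_le_right r₀ r₁]
  have hm0 : m (ball (0 : V) ρ) ≠ 0 := (measure_ball_pos m _ hρ).ne'
  have hmt : m (ball (0 : V) ρ) ≠ ⊤ := by
    have : ProperSpace V := FiniteDimensional.proper ℂ V
    exact measure_ball_lt_top.ne
  have hloc : ball (extChartAt I x x) (2 * ρ) ⊆ localDomain I F E x := fun z hz =>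
    (hb z (ball_subset_ball hρ1 hz)).2
  refine ⟨ρ, hρ, (ball_subset_ball (by linarith)).trans hloc,
    (m (ball (0 : V) ρ))⁻¹ * (ENNReal.ofReal K ^ 2 * C),
    ENNReal.mul_ne_top (ENNReal.inv_ne_top.2 hm0) (ENNReal.mul_ne_top (by simp) hC), ?_⟩
  intro f hf z hz
  have hsub : ball z ρ ⊆ ball (extChartAt I x x) (2 * ρ) :=
    ball_subset_ball' (by linarith [mem_ball.1 hz])
  have h1 := enorm_sq_mul_le_lintegral m (f := localRep I F x f) (z := z) (ρ := ρ)
    fun w hw => (hf.analyticOnNhd x w (hloc (hsub hw))).differentiableAt.differentiableWithinAt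
  have h2 : ∫⁻ y in ball z ρ, ‖localRep I F x f y‖ₑ ^ 2 ∂m ≤
      ENNReal.ofReal K ^ 2 * (C * sqNorm ν f) := by
    calc _ ≤ ∫⁻ y in ball z ρ, ENNReal.ofReal K ^ 2 *
          ‖f ((extChartAt I x).symm y)‖ₑ ^ 2 ∂m := by
          refine setLIntegral_mono' measurableSet_ball fun y hy => ?_
          rw [← mul_pow, ← ofReal_norm, ← ofReal_norm, ← ENNReal.ofReal_mul hK.le]
          gcongr
          exact (hb y (ball_subset_ball hρ1 (hsub hy))).1 _
      _ ≤ ∫⁻ y in ball (extChartAt I x x) r₀, ENNReal.ofReal K ^ 2 *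
          ‖f ((extChartAt I x).symm y)‖ₑ ^ 2 ∂m :=
          lintegral_mono_set (hsub.trans (ball_subset_ball hρ0))
      _ = ENNReal.ofReal K ^ 2 * ∫⁻ y in ball (extChartAt I x x) r₀,
          ‖f ((extChartAt I x).symm y)‖ₑ ^ 2 ∂m := lintegral_const_mul' _ _ (by simp)
      _ ≤ _ := by
          gcongr
          exact hdom _ (measurable_enorm_sq (hf.measurable_norm F))
  rw [mul_assoc, mul_comm, ← div_eq_mul_inv, ENNReal.le_div_iff_mul_le (.inl hm0) (.inl hmt),
    mul_assoc]
  exact h1.trans h2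

/-- The local bound turns an `L²` Cauchy sequence into a locally uniform one in every
trivialization. The limit is therefore holomorphic near every point. -/
theorem isReproducing_holomorphicSections (hν : LocallyDominates I m ν) :
    IsReproducing ν (holomorphicSections I F E) where
  measurable_norm f hf := IsHolomorphicSection.measurable_norm F hf
  eval_bound x := by
    obtain ⟨r, hr, hloc, C, hC, hb⟩ := exists_enorm_localRep_le F E hν x
    set e := trivializationAt F E x
    have hx : x ∈ e.baseSet := mem_baseSet_trivializationAt F E x
    refine ⟨‖e.symmL ℂ x‖ₑ ^ 2 * C, ENNReal.mul_ne_top (by simp) hC, fun f hf => ?_⟩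
    have h1 := hb f hf _ (mem_ball_self hr)
    have h2 : e.symmL ℂ x (localRep I F x f (extChartAt I x x)) = f x := by
      have h3 := e.symmL_continuousLinearMapAt (R := ℂ) hx (f x)
      rw [e.continuousLinearMapAt_apply_of_mem (R := ℂ) hx] at h3
      rw [localRep, extChartAt_to_inv]
      exact h3
    calc ‖f x‖ₑ ^ 2 = ‖e.symmL ℂ x (localRep I F x f (extChartAt I x x))‖ₑ ^ 2 := by rw [h2]
      _ ≤ (‖e.symmL ℂ x‖ₑ * ‖localRep I F x f (extChartAt I x x)‖ₑ) ^ 2 := by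
        gcongr; exact (e.symmL ℂ x).le_opENorm _
      _ ≤ _ := by rw [mul_pow, mul_assoc]; gcongr
  complete u hu hc := by
    have hunif : ∀ x : M, ∃ r > 0, ball (extChartAt I x x) r ⊆ localDomain I F E x ∧
        UniformCauchySeqOn (fun n => localRep I F x (u n)) atTop (ball (extChartAt I x x) r) := by
      intro x
      obtain ⟨r, hr, hloc, C, hC, hb⟩ := exists_enorm_localRep_le F E hν x
      refine ⟨r, hr, hloc, Metric.uniformCauchySeqOn_iff.2 fun ε hε => ?_⟩
      have hε' : (0 : ℝ≥0∞) < ENNReal.ofReal (ε / 2) ^ 2 / (C + 1) :=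
        ENNReal.div_pos (by positivity) (by simp [hC])
      obtain ⟨N, hN⟩ := hc _ hε'
      refine ⟨N, fun m hm n hn z hz => ?_⟩
      have h1 := hb (u m - u n) ((holomorphicSections I F E).sub_mem (hu m) (hu n)) z hz
      rw [localRep_sub (hloc hz)] at h1
      have h2 : ‖localRep I F x (u m) z - localRep I F x (u n) z‖ₑ ^ 2 ≤
          ENNReal.ofReal (ε / 2) ^ 2 := by
        refine h1.trans ((mul_le_mul' (le_self_add (b := 1)) (hN m hm n hn)).trans ?_)
        exact ENNReal.mul_div_le
      rw [← ofReal_norm] at h2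
      have h3 := (ENNReal.pow_le_pow_left_iff two_ne_zero).1 h2
      rw [ENNReal.ofReal_le_ofReal_iff (by positivity)] at h3
      rw [dist_eq_norm]
      linarith
    have hlim : ∀ x, ∃ v : E x, Tendsto (fun n => u n x) atTop (𝓝 v) := fun x => by
      obtain ⟨r, hr, hloc, huc⟩ := hunif x
      set e := trivializationAt F E x
      have hx : x ∈ e.baseSet := mem_baseSet_trivializationAt F E x
      obtain ⟨w, hw⟩ := cauchySeq_tendsto_of_complete (huc.cauchySeq (mem_ball_self hr))
      refine ⟨e.symmL ℂ x w, ?_⟩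
      have h1 : ∀ n, e.symmL ℂ x (localRep I F x (u n) (extChartAt I x x)) = u n x := fun n => by
        have h3 := e.symmL_continuousLinearMapAt (R := ℂ) hx (u n x)
        rw [e.continuousLinearMapAt_apply_of_mem (R := ℂ) hx] at h3
        rw [localRep, extChartAt_to_inv]
        exact h3
      have h2 := ((e.symmL ℂ x).continuous.tendsto w).comp hw
      exact h2.congr h1
    choose f hf using hlim
    refine ⟨f, isHolomorphicSection_of_analyticAt fun x => ?_, hf⟩
    obtain ⟨r, hr, hloc, huc⟩ := hunif x
    refine analyticAt_of_tendstoUniformlyOn hr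
      (fun n => (IsHolomorphicSection.analyticOnNhd (hu n) x).mono hloc)
      (huc.tendstoUniformlyOn_of_tendsto fun z hz => ?_)
    rw [localRep_apply (hloc hz)]
    have h1 := ((((trivializationAt F E x).continuousLinearMapAt ℂ
      ((extChartAt I x).symm z)).continuous.tendsto _).comp (hf ((extChartAt I x).symm z)))
    exact h1.congr fun n => (localRep_apply (hloc hz) (u n)).symm

variable [IsReproducing ν (holomorphicSections I F E)]

/-- The derivative of order `j` at `x` in local coordinates, as a continuous linear map on the
Hilbert space of square integrable holomorphic sections. -/
def jet (hν : LocallyDominates I m ν) (x : M) (j : ℕ) :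
    SectionL2 ν (holomorphicSections I F E) →L[ℂ]
      ContinuousMultilinearMap ℂ (fun _ : Fin j => V) F :=
  LinearMap.mkContinuousOfExistsBound
    { toFun := fun f => iteratedFDeriv ℂ j (localRep I F x f.1) (extChartAt I x x)
      map_add' := fun f g => iteratedFDeriv_localRep_add f.2.1 g.2.1 x j
      map_smul' := fun c f => iteratedFDeriv_localRep_smul f.2.1 c x j } (by
    obtain ⟨r, hr, hloc, C, hC, hb⟩ := exists_enorm_localRep_le F E hν x
    -- The square root of the evaluation constant on the ball, times the factor from Cauchy's
    -- estimate of order `j`.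
    refine ⟨Real.sqrt C.toReal * (j / r) ^ j, fun f => ?_⟩
    have h1 : ∀ z ∈ ball (extChartAt I x x) r,
        ‖localRep I F x f.1 z‖ ≤ Real.sqrt C.toReal * ‖f‖ := fun z hz => by
      have h2 := hb f.1 f.2.1 z hz
      rw [← SectionL2.enorm_sq] at h2
      have h3 := ENNReal.toReal_mono (ENNReal.mul_ne_top hC (by simp)) h2
      rw [ENNReal.toReal_mul, ENNReal.toReal_pow, ENNReal.toReal_pow, toReal_enorm,
        toReal_enorm] at h3
      refine (pow_le_pow_iff_left₀ (norm_nonneg _) (by positivity) two_ne_zero).1 ?_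
      rw [mul_pow, Real.sq_sqrt ENNReal.toReal_nonneg]
      exact h3
    refine (norm_iteratedFDeriv_le_of_ball hr
      ((IsHolomorphicSection.analyticOnNhd f.2.1 x).mono hloc) h1 j).trans_eq ?_
    ring)

variable (I F E ν) in
/-- The square integrable holomorphic sections that vanish up to order `k` on `S`. -/
def vanishingSubmodule (k : ℤ) (S : Set M) :
    Submodule ℂ (SectionL2 ν (holomorphicSections I F E)) where
  carrier := {f | ∀ x ∈ S, ∀ j : ℕ, (j : ℤ) ≤ k →
    iteratedFDeriv ℂ j (localRep I F x f.1) (extChartAt I x x) = 0}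
  zero_mem' x _ j _ := by
    have := iteratedFDeriv_localRep_smul (I := I) (F := F)
      (holomorphicSections I F E).zero_mem (0 : ℂ) x j
    rwa [zero_smul, zero_smul] at this
  add_mem' {f g} hf hg x hx j hj := by
    rw [SectionL2.add_val, iteratedFDeriv_localRep_add f.2.1 g.2.1, hf x hx j hj, hg x hx j hj,
      add_zero]
  smul_mem' c f hf x hx j hj := by
    rw [SectionL2.smul_val, iteratedFDeriv_localRep_smul f.2.1, hf x hx j hj, smul_zero]

/-- An intersection of kernels of continuous jet maps. Closedness makes the orthogonal projection
available, and with it the minimal extension. -/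
theorem isClosed_vanishingSubmodule (hν : LocallyDominates I m ν) (k : ℤ) (S : Set M) :
    IsClosed (vanishingSubmodule I F E ν k S : Set (SectionL2 ν (holomorphicSections I F E))) := by
  have : (vanishingSubmodule I F E ν k S : Set (SectionL2 ν (holomorphicSections I F E))) =
      ⋂ x ∈ S, ⋂ j : ℕ, ⋂ _ : (j : ℤ) ≤ k, {f | jet hν x j f = 0} := by
    ext f
    simp only [mem_iInter]
    rfl
  rw [this]
  exact isClosed_biInter fun x _ => isClosed_iInter fun j => isClosed_iInter fun _ =>
    isClosed_eq (jet hν x j).continuous continuous_const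

variable {μ : Measure M} {ψ : M → EReal}

/-- Minimal extensions in terms of the orthogonal complement of the vanishing sections. -/
theorem isMinimalExtension_iff (hν : LocallyDominates I m ν)
    (hN : ∀ f : ∀ x, E x, IsHolomorphicSection I F f →
      bergmanNorm μ ψ f = sqNorm ν f ^ (1 / 2 : ℝ))
    (k : ℤ) (S : Set M) (f : SectionL2 ν (holomorphicSections I F E)) (G : ∀ x, E x) :
    IsMinimalExtension I F μ ψ k S f.1 G ↔
      ∃ g : SectionL2 ν (holomorphicSections I F E), g.1 = G ∧
        g - f ∈ vanishingSubmodule I F E ν k S ∧ g ∈ (vanishingSubmodule I F E ν k S)ᗮ := by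
  have hfin : ∀ g : ∀ x, E x, IsHolomorphicSection I F g →
      (bergmanNorm μ ψ g < ⊤ ↔ sqNorm ν g < ⊤) := fun g hg => by
    rw [hN g hg, ENNReal.rpow_lt_top_iff_of_pos (by norm_num)]
  have hle : ∀ g g' : SectionL2 ν (holomorphicSections I F E),
      bergmanNorm μ ψ g.1 ≤ bergmanNorm μ ψ g'.1 ↔ ‖g‖ ^ 2 ≤ ‖g'‖ ^ 2 := fun g g' => by
    rw [hN _ g.2.1, hN _ g'.2.1, ENNReal.rpow_le_rpow_iff (by norm_num), SectionL2.norm_sq,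
      SectionL2.norm_sq, ENNReal.toReal_le_toReal g.2.2.ne g'.2.2.ne]
  have hco : ∀ g : SectionL2 ν (holomorphicSections I F E), CoincideUpTo I F k S g.1 f.1 ↔
      g - f ∈ vanishingSubmodule I F E ν k S := fun g =>
    coincideUpTo_iff_sub g.2.1 f.2.1
  obtain ⟨g₀, hg₀, hg₀'⟩ := exists_sub_mem_mem_orthogonal
    (isClosed_vanishingSubmodule hν k S) f
  constructor
  · rintro ⟨⟨hG, hGn⟩, hGc, hmin⟩
    let g : SectionL2 ν (holomorphicSections I F E) := SectionL2.mk ν G hG ((hfin G hG).1 hGn)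
    have hgL := (hco g).1 hGc
    have h1 := (hle g g₀).1 (hmin g₀.1 ⟨g₀.2.1, (hfin _ g₀.2.1).2 g₀.2.2⟩ ((hco g₀).2 hg₀))
    have h2 : g - g₀ ∈ vanishingSubmodule I F E ν k S := by
      have := Submodule.sub_mem _ hgL hg₀
      rwa [sub_sub_sub_cancel_right] at this
    -- Both `g` and `g₀` lie in the coset of `f`, and `g` has norm at most that of `g₀`. Pythagoras
    -- then forces `g = g₀`.
    have h3 := norm_sq_eq_of_mem_orthogonal hg₀' h2
    have h4 : ‖g - g₀‖ ^ 2 = 0 := le_antisymm (by linarith) (by positivity)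
    have h5 : g = g₀ := by simpa [sub_eq_zero] using h4
    exact ⟨g, rfl, hgL, h5 ▸ hg₀'⟩
  · rintro ⟨g, rfl, hgL, hgo⟩
    refine ⟨⟨g.2.1, (hfin _ g.2.1).2 g.2.2⟩, (hco g).2 hgL, fun G' hG' hG'c => ?_⟩
    let g' : SectionL2 ν (holomorphicSections I F E) :=
      SectionL2.mk ν G' hG'.1 ((hfin G' hG'.1).1 hG'.2)
    have h2 : g' - g ∈ vanishingSubmodule I F E ν k S := by
      have := Submodule.sub_mem _ ((hco g').1 hG'c) hgL
      rwa [sub_sub_sub_cancel_right] at this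
    refine (hle g g').2 ?_
    have h3 := norm_sq_eq_of_mem_orthogonal hgo h2
    linarith [sq_nonneg ‖g' - g‖]

theorem existsUnique_isMinimalExtension (hν : LocallyDominates I m ν)
    (hN : ∀ f : ∀ x, E x, IsHolomorphicSection I F f →
      bergmanNorm μ ψ f = sqNorm ν f ^ (1 / 2 : ℝ))
    (k : ℤ) (S : Set M) (f : SectionL2 ν (holomorphicSections I F E)) :
    ∃! G, IsMinimalExtension I F μ ψ k S f.1 G := by
  obtain ⟨g, hg, hg'⟩ := exists_sub_mem_mem_orthogonal (isClosed_vanishingSubmodule hν k S) f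
  refine ⟨g.1, (isMinimalExtension_iff hν hN k S f _).2 ⟨g, rfl, hg, hg'⟩, fun G hG => ?_⟩
  obtain ⟨g₁, rfl, h1, h1'⟩ := (isMinimalExtension_iff hν hN k S f _).1 hG
  have h2 : g₁ - g ∈ vanishingSubmodule I F E ν k S := by
    have := Submodule.sub_mem _ h1 hg
    rwa [sub_sub_sub_cancel_right] at this
  have h3 : g₁ - g = 0 := by
    have := Submodule.inner_right_of_mem_orthogonal h2 (Submodule.sub_mem _ h1' hg')
    exact inner_self_eq_zero.1 this
  rw [sub_eq_zero.1 h3]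

end Reproducing

/-! ### Contractions of tensors with linear forms -/

section Contraction

variable {A B : Type*} [NormedAddCommGroup A] [InnerProductSpace ℂ A]
  [NormedAddCommGroup B] [InnerProductSpace ℂ B]

/-- Contraction of the first factor of a tensor product with a linear form. -/
def contractFst (l : A →ₗ[ℂ] ℂ) : A ⊗[ℂ] B →ₗ[ℂ] B :=
  (TensorProduct.lid ℂ B).toLinearMap ∘ₗ l.rTensor B

/-- Contraction of the second factor of a tensor product with a linear form. -/
def contractSnd (η : B →ₗ[ℂ] ℂ) : A ⊗[ℂ] B →ₗ[ℂ] A :=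
  (TensorProduct.rid ℂ A).toLinearMap ∘ₗ η.lTensor A

theorem contractFst_tmul (l : A →ₗ[ℂ] ℂ) (a : A) (b : B) :
    contractFst l (a ⊗ₜ[ℂ] b) = l a • b := by
  simp [contractFst]

theorem contractSnd_tmul (η : B →ₗ[ℂ] ℂ) (a : A) (b : B) :
    contractSnd η (a ⊗ₜ[ℂ] b) = η b • a := by
  simp [contractSnd]

/-- Contraction with `⟪b, ·⟫` is the adjoint of `a ↦ a ⊗ b`. This is how an inner product with a
tensor product becomes an iterated pairing, and it yields the norm bound that follows. -/
theorem inner_contractSnd (a : A) (b : B) (ξ : A ⊗[ℂ] B) :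
    inner ℂ a (contractSnd (innerₛₗ ℂ b) ξ) = inner ℂ (a ⊗ₜ[ℂ] b) ξ := by
  induction ξ using TensorProduct.induction_on with
  | zero => simp
  | add x y hx hy => rw [map_add, inner_add_right, inner_add_right, hx, hy]
  | tmul x y =>
    rw [contractSnd_tmul, inner_smul_right, TensorProduct.inner_tmul, innerₛₗ_apply_apply, mul_comm]

theorem norm_contractSnd_le (b : B) (ξ : A ⊗[ℂ] B) :
    ‖contractSnd (innerₛₗ ℂ b) ξ‖ ≤ ‖b‖ * ‖ξ‖ := by
  set a := contractSnd (innerₛₗ ℂ b) ξ with ha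
  rcases eq_or_ne a 0 with h0 | h0
  · rw [h0, norm_zero]; positivity
  have h1 : ‖a‖ * ‖a‖ ≤ ‖a‖ * (‖b‖ * ‖ξ‖) := by
    have h2 : ‖inner ℂ a a‖ = ‖a‖ * ‖a‖ := by
      rw [inner_self_eq_norm_sq_to_K]; simp [sq]
    rw [← h2]
    conv_lhs => rw [ha, inner_contractSnd]
    refine (norm_inner_le_norm (𝕜 := ℂ) (a ⊗ₜ[ℂ] b) ξ).trans_eq ?_
    rw [TensorProduct.norm_tmul (𝕜 := ℂ) a b, mul_assoc]
  exact le_of_mul_le_mul_left h1 (norm_pos_iff.2 h0)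

/-- The two factors can be contracted in either order. This lets jets in the first variable be
exchanged with linear forms on the fibres of `E₂`. -/
theorem apply_contractFst (l : A →ₗ[ℂ] ℂ) (η : B →ₗ[ℂ] ℂ) (ξ : A ⊗[ℂ] B) :
    η (contractFst l ξ) = l (contractSnd η ξ) := by
  induction ξ using TensorProduct.induction_on with
  | zero => simp
  | add x y hx hy => simp only [map_add, hx, hy]
  | tmul x y => simp [contractFst_tmul, contractSnd_tmul, mul_comm]

variable {A' B' : Type*} [NormedAddCommGroup A'] [InnerProductSpace ℂ A']
  [NormedAddCommGroup B'] [InnerProductSpace ℂ B']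

theorem contractFst_map (l : A' →ₗ[ℂ] ℂ) (f : A →ₗ[ℂ] A') (g : B →ₗ[ℂ] B') (ξ : A ⊗[ℂ] B) :
    contractFst l (TensorProduct.map f g ξ) = g (contractFst (l ∘ₗ f) ξ) := by
  induction ξ using TensorProduct.induction_on with
  | zero => simp
  | add x y hx hy => simp only [map_add, hx, hy]
  | tmul x y => simp [contractFst_tmul]

theorem contractSnd_map (η : B' →ₗ[ℂ] ℂ) (f : A →ₗ[ℂ] A') (g : B →ₗ[ℂ] B') (ξ : A ⊗[ℂ] B) :
    contractSnd η (TensorProduct.map f g ξ) = f (contractSnd (η ∘ₗ g) ξ) := by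
  induction ξ using TensorProduct.induction_on with
  | zero => simp
  | add x y hx hy => simp only [map_add, hx, hy]
  | tmul x y => simp [contractSnd_tmul]

end Contraction

/-! ### Sections of the external tensor product and their slices -/

section ExtTensorSections

variable {V₁ V₂ H₁ H₂ : Type*} [NormedAddCommGroup V₁] [NormedSpace ℂ V₁] [TopologicalSpace H₁]
  [NormedAddCommGroup V₂] [NormedSpace ℂ V₂] [TopologicalSpace H₂]
  {I₁ : ModelWithCorners ℂ V₁ H₁} {I₂ : ModelWithCorners ℂ V₂ H₂}
  [I₁.Boundaryless] [I₂.Boundaryless]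
  {M₁ M₂ : Type*} {E₁ : M₁ → Type*} {E₂ : M₂ → Type*}
  [∀ x, NormedAddCommGroup (E₁ x)] [∀ x, InnerProductSpace ℂ (E₁ x)]
  [∀ y, NormedAddCommGroup (E₂ y)] [∀ y, InnerProductSpace ℂ (E₂ y)]
  [TopologicalSpace M₁] [TopologicalSpace M₂]
  {F₁ : Type*} [NormedAddCommGroup F₁] [InnerProductSpace ℂ F₁]
  {F₂ : Type*} [NormedAddCommGroup F₂] [InnerProductSpace ℂ F₂]
  [TopologicalSpace (TotalSpace F₁ E₁)] [TopologicalSpace (TotalSpace F₂ E₂)]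
  [FiberBundle F₁ E₁] [FiberBundle F₂ E₂]
  [FiniteDimensional ℂ F₁] [FiniteDimensional ℂ F₂]
  [VectorBundle ℂ F₁ E₁] [VectorBundle ℂ F₂ E₂]

/-- The metric of an external tensor product of Hermitian bundles is continuous. -/
instance [IsContinuousHermitianBundle F₁ E₁] [IsContinuousHermitianBundle F₂ E₂] :
    IsContinuousHermitianBundle (TensorFiber F₁ F₂) (ExtTensor E₁ E₂) where
  continuousOn_inner := by
    rintro _ ⟨⟨_, ⟨e₁, e₂, he₁, he₂, rfl⟩, rfl⟩⟩ v w
    have key : ∀ v w : TensorFiber F₁ F₂, ContinuousOn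
        (fun p => inner ℂ (extTensorFrom e₁ e₂ p v) (extTensorFrom e₁ e₂ p w))
        (e₁.baseSet ×ˢ e₂.baseSet) := by
      intro v w
      -- On pure tensors the Gram entry is a product of Gram entries of the two factors; the general
      -- case follows by additivity in both arguments.
      refine TensorProduct.induction_on v ?_ (fun a b => ?_) fun v v' hv hv' => ?_
      · simp_rw [show ∀ p, extTensorFrom e₁ e₂ p (0 : F₁ ⊗[ℂ] F₂) = 0 from
          fun p => map_zero (extTensorFrom e₁ e₂ p), inner_zero_left]
        exact continuousOn_const
      · refine TensorProduct.induction_on w ?_ (fun c d => ?_) fun w w' hw hw' => ?_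
        · simp_rw [show ∀ p, extTensorFrom e₁ e₂ p (0 : F₁ ⊗[ℂ] F₂) = 0 from
            fun p => map_zero (extTensorFrom e₁ e₂ p), inner_zero_right]
          exact continuousOn_const
        · have h1 := (IsContinuousHermitianBundle.continuousOn_inner e₁ a c).comp
            (continuousOn_fst (s := e₁.baseSet ×ˢ e₂.baseSet)) fun p hp => hp.1
          have h2 := (IsContinuousHermitianBundle.continuousOn_inner e₂ b d).comp
            (continuousOn_snd (s := e₁.baseSet ×ˢ e₂.baseSet)) fun p hp => hp.2
          refine (h1.mul h2).congr fun p hp => ?_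
          have h3 : inner ℂ (extTensorFrom e₁ e₂ p (a ⊗ₜ[ℂ] b))
              (extTensorFrom e₁ e₂ p (c ⊗ₜ[ℂ] d)) =
              inner ℂ (e₁.symmₗ ℂ p.1 a) (e₁.symmₗ ℂ p.1 c) *
              inner ℂ (e₂.symmₗ ℂ p.2 b) (e₂.symmₗ ℂ p.2 d) :=
            TensorProduct.inner_tmul (𝕜 := ℂ) (e₁.symmₗ ℂ p.1 a) (e₁.symmₗ ℂ p.1 c)
              (e₂.symmₗ ℂ p.2 b) (e₂.symmₗ ℂ p.2 d)
          refine h3.trans ?_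
          rw [e₁.symmₗ_apply hp.1, e₁.symmₗ_apply hp.1, e₂.symmₗ_apply hp.2,
            e₂.symmₗ_apply hp.2]
          rfl
        · simp_rw [show ∀ p, extTensorFrom e₁ e₂ p (w + w' : F₁ ⊗[ℂ] F₂) =
            extTensorFrom e₁ e₂ p w + extTensorFrom e₁ e₂ p w' from
            fun p => map_add (extTensorFrom e₁ e₂ p) w w', inner_add_right]
          exact hw.add hw'
      · simp_rw [show ∀ p, extTensorFrom e₁ e₂ p (v + v' : F₁ ⊗[ℂ] F₂) =
          extTensorFrom e₁ e₂ p v + extTensorFrom e₁ e₂ p v' from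
          fun p => map_add (extTensorFrom e₁ e₂ p) v v', inner_add_left]
        exact hv.add hv'
    refine (key v w).congr fun p hp => ?_
    have hs : ∀ v : TensorFiber F₁ F₂,
        Trivialization.symm ((extTensorPrebundle E₁ E₂ F₁
          F₂).toFiberPrebundle.trivializationOfMemPretrivializationAtlas
            ⟨e₁, e₂, he₁, he₂, rfl⟩) p v = extTensorFrom e₁ e₂ p v := fun v =>
      Pretrivialization.symm_apply (extTensorPretriv e₁ e₂) hp v
    exact congrArg₂ (inner ℂ) (hs v) (hs w)

theorem norm_tensorSection (f₁ : ∀ x, E₁ x) (f₂ : ∀ y, E₂ y) (p : M₁ × M₂) :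
    ‖tensorSection f₁ f₂ p‖ = ‖f₁ p.1‖ * ‖f₂ p.2‖ := TensorProduct.norm_tmul _ _

theorem inner_tensorSection (f₁ g₁ : ∀ x, E₁ x) (f₂ g₂ : ∀ y, E₂ y) (p : M₁ × M₂) :
    inner ℂ (tensorSection f₁ f₂ p) (tensorSection g₁ g₂ p) =
      inner ℂ (f₁ p.1) (g₁ p.1) * inner ℂ (f₂ p.2) (g₂ p.2) :=
  TensorProduct.inner_tmul (𝕜 := ℂ) (f₁ p.1) (g₁ p.1) (f₂ p.2) (g₂ p.2)

variable [ChartedSpace H₁ M₁] [ChartedSpace H₂ M₂]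

theorem localRep_extTensor (D : ∀ p, ExtTensor E₁ E₂ p) (x : M₁) (y : M₂) (z : V₁) (w : V₂) :
    localRep (I₁.prod I₂) (TensorFiber F₁ F₂) (x, y) D (z, w) =
      extTensorTo (trivializationAt F₁ E₁ x) (trivializationAt F₂ E₂ y)
        ((extChartAt I₁ x).symm z, (extChartAt I₂ y).symm w)
        (D ((extChartAt I₁ x).symm z, (extChartAt I₂ y).symm w)) := rfl

theorem extChartAt_prod_self (x : M₁) (y : M₂) :
    extChartAt (I₁.prod I₂) (x, y) (x, y) = (extChartAt I₁ x x, extChartAt I₂ y y) := rfl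

theorem localRep_apply' [ContMDiffVectorBundle ω F₁ E₁ I₁] {x : M₁} {z : V₁}
    (hz : z ∈ localDomain I₁ F₁ E₁ x) (f : ∀ x, E₁ x) :
    localRep I₁ F₁ x f z = (trivializationAt F₁ E₁ x).linearMapAt ℂ
      ((extChartAt I₁ x).symm z) (f ((extChartAt I₁ x).symm z)) := by
  rw [Trivialization.coe_linearMapAt_of_mem _ hz.2]
  rfl

variable [IsManifold I₁ ω M₁] [IsManifold I₂ ω M₂]
  [ContMDiffVectorBundle ω F₁ E₁ I₁] [ContMDiffVectorBundle ω F₂ E₂ I₂]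

variable (F₁ F₂) in
/-- The tensor product on the model fibres. -/
def tensorFiberMk : F₁ →L[ℂ] F₂ →L[ℂ] TensorFiber F₁ F₂ :=
  LinearMap.toContinuousLinearMap
    ((LinearMap.toContinuousLinearMap (𝕜 := ℂ) (E := F₂) (F' := TensorFiber F₁ F₂)).toLinearMap ∘ₗ
      (TensorProduct.mk ℂ F₁ F₂ : F₁ →ₗ[ℂ] F₂ →ₗ[ℂ] TensorFiber F₁ F₂))

theorem localRep_tensorSection {f₁ : ∀ x, E₁ x} {f₂ : ∀ y, E₂ y} {x : M₁} {y : M₂} {z : V₁}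
    {w : V₂} (hz : z ∈ localDomain I₁ F₁ E₁ x) (hw : w ∈ localDomain I₂ F₂ E₂ y) :
    localRep (I₁.prod I₂) (TensorFiber F₁ F₂) (x, y) (tensorSection f₁ f₂) (z, w) =
      tensorFiberMk F₁ F₂ (localRep I₁ F₁ x f₁ z) (localRep I₂ F₂ y f₂ w) := by
  rw [localRep_apply' hz, localRep_apply' hw]
  rfl

theorem localRep_tensorSection_eventuallyEq (f₁ : ∀ x, E₁ x) (f₂ : ∀ y, E₂ y) (x : M₁) (y : M₂) :
    localRep (I₁.prod I₂) (TensorFiber F₁ F₂) (x, y) (tensorSection f₁ f₂)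
      =ᶠ[𝓝 (extChartAt I₁ x x, extChartAt I₂ y y)]
      fun q => tensorFiberMk F₁ F₂ (localRep I₁ F₁ x f₁ q.1) (localRep I₂ F₂ y f₂ q.2) := by
  filter_upwards [prod_mem_nhds (localDomain_mem_nhds I₁ F₁ E₁ x)
    (localDomain_mem_nhds I₂ F₂ E₂ y)] with q hq
  exact localRep_tensorSection hq.1 hq.2

theorem IsHolomorphicSection.tensorSection {f₁ : ∀ x, E₁ x} {f₂ : ∀ y, E₂ y}
    (h₁ : IsHolomorphicSection I₁ F₁ f₁) (h₂ : IsHolomorphicSection I₂ F₂ f₂) :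
    IsHolomorphicSection (I₁.prod I₂) (TensorFiber F₁ F₂) (tensorSection f₁ f₂) := by
  refine isHolomorphicSection_of_analyticAt fun ⟨x, y⟩ => ?_
  rw [extChartAt_prod_self]
  refine AnalyticAt.congr ?_ (localRep_tensorSection_eventuallyEq f₁ f₂ x y).symm
  have a₁ : AnalyticAt ℂ (fun q : V₁ × V₂ => localRep I₁ F₁ x f₁ q.1)
      (extChartAt I₁ x x, extChartAt I₂ y y) :=
    AnalyticAt.comp (g := localRep I₁ F₁ x f₁) (h₁.analyticAt x) analyticAt_fst
  have a₂ : AnalyticAt ℂ (fun q : V₁ × V₂ => localRep I₂ F₂ y f₂ q.2)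
      (extChartAt I₁ x x, extChartAt I₂ y y) :=
    AnalyticAt.comp (g := localRep I₂ F₂ y f₂) (h₂.analyticAt y) analyticAt_snd
  exact ((tensorFiberMk F₁ F₂).analyticAt_bilinear _).comp (a₁.prod a₂)

/-- The contraction of a section of `p₁^* E₁ ⊗ p₂^* E₂` with a linear form on one fibre of `E₂`. -/
def slice (D : ∀ p, ExtTensor E₁ E₂ p) (y : M₂) (η : E₂ y →ₗ[ℂ] ℂ) (x : M₁) : E₁ x :=
  contractSnd (A := E₁ x) η (D (x, y))

/-- Contraction is natural in both factors, so in coordinates a slice is a fixed contraction of the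
local representation of `D`, with `η` transported to the model fibre at `y`. Holomorphy of slices
follows at once. -/
theorem localRep_slice (D : ∀ p, ExtTensor E₁ E₂ p) (y : M₂) (η : E₂ y →ₗ[ℂ] ℂ) {x : M₁} {z : V₁}
    (hz : z ∈ localDomain I₁ F₁ E₁ x) :
    localRep I₁ F₁ x (slice D y η) z =
      contractSnd (A := F₁) (η ∘ₗ (trivializationAt F₂ E₂ y).symmₗ ℂ y)
        (localRep (I₁.prod I₂) (TensorFiber F₁ F₂) (x, y) D (z, extChartAt I₂ y y)) := by
  rw [localRep_apply' hz, localRep_extTensor, extChartAt_to_inv, extTensorTo]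
  refine Eq.trans ?_ (contractSnd_map _ _ _ _).symm
  congr 2
  have : (η ∘ₗ (trivializationAt F₂ E₂ y).symmₗ ℂ y) ∘ₗ (trivializationAt F₂ E₂ y).linearMapAt ℂ y
      = η := by
    ext v
    simp only [LinearMap.comp_apply]
    rw [Trivialization.symmₗ_linearMapAt _ (mem_baseSet_trivializationAt F₂ E₂ y)]
  dsimp only
  rw [this]

theorem IsHolomorphicSection.slice {D : ∀ p, ExtTensor E₁ E₂ p}
    (hD : IsHolomorphicSection (I₁.prod I₂) (TensorFiber F₁ F₂) D) (y : M₂) (η : E₂ y →ₗ[ℂ] ℂ) :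
    IsHolomorphicSection I₁ F₁ (slice D y η) := by
  refine isHolomorphicSection_of_analyticAt fun x => ?_
  have h1 : AnalyticAt ℂ (fun z : V₁ => (z, extChartAt I₂ y y)) (extChartAt I₁ x x) :=
    analyticAt_id.prod analyticAt_const
  have h2 := AnalyticAt.comp (f := fun z : V₁ => (z, extChartAt I₂ y y)) (hD.analyticAt (x, y)) h1
  let L : TensorFiber F₁ F₂ →L[ℂ] F₁ := LinearMap.toContinuousLinearMap
    (contractSnd (A := F₁) (η ∘ₗ (trivializationAt F₂ E₂ y).symmₗ ℂ y))
  refine AnalyticAt.congr ((L.analyticAt _).comp h2) ?_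
  filter_upwards [localDomain_mem_nhds I₁ F₁ E₁ x] with z hz
  exact (localRep_slice D y η hz).symm

end ExtTensorSections

theorem iteratedDeriv_clm_comp {A B : Type*} [NormedAddCommGroup A] [NormedSpace ℂ A]
    [NormedAddCommGroup B] [NormedSpace ℂ B] (L : A →L[ℂ] B) {f : ℂ → A} {t : ℂ} {j : ℕ}
    (hf : ContDiffAt ℂ j f t) :
    iteratedDeriv j (fun s => L (f s)) t = L (iteratedDeriv j f t) := by
  have := L.iteratedFDeriv_comp_left hf le_rfl
  rw [iteratedDeriv_eq_iteratedFDeriv, iteratedDeriv_eq_iteratedFDeriv]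
  exact congrArg (fun Q => Q fun _ => (1 : ℂ)) this

theorem iteratedDeriv_cle_comp {A B : Type*} [NormedAddCommGroup A] [NormedSpace ℂ A]
    [NormedAddCommGroup B] [NormedSpace ℂ B] (L : A ≃L[ℂ] B) (f : ℂ → A) (t : ℂ) (j : ℕ) :
    iteratedDeriv j (fun s => L (f s)) t = L (iteratedDeriv j f t) := by
  have := L.iteratedFDeriv_comp_left (f := f) (x := t) (i := j)
  rw [iteratedDeriv_eq_iteratedFDeriv, iteratedDeriv_eq_iteratedFDeriv]
  exact congrArg (fun Q => Q fun _ => (1 : ℂ)) this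

/-! ### Derivatives in the first variable as sections over the second factor -/

section DirectionalJet

variable {V₁ V₂ H₁ H₂ : Type*} [NormedAddCommGroup V₁] [NormedSpace ℂ V₁] [TopologicalSpace H₁]
  [NormedAddCommGroup V₂] [NormedSpace ℂ V₂] [TopologicalSpace H₂]
  {I₁ : ModelWithCorners ℂ V₁ H₁} {I₂ : ModelWithCorners ℂ V₂ H₂}
  [I₁.Boundaryless] [I₂.Boundaryless]
  {M₁ M₂ : Type*} {E₁ : M₁ → Type*} {E₂ : M₂ → Type*}
  [∀ x, NormedAddCommGroup (E₁ x)] [∀ x, InnerProductSpace ℂ (E₁ x)]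
  [∀ y, NormedAddCommGroup (E₂ y)] [∀ y, InnerProductSpace ℂ (E₂ y)]
  [TopologicalSpace M₁] [TopologicalSpace M₂]
  {F₁ : Type*} [NormedAddCommGroup F₁] [InnerProductSpace ℂ F₁]
  {F₂ : Type*} [NormedAddCommGroup F₂] [InnerProductSpace ℂ F₂]
  [TopologicalSpace (TotalSpace F₁ E₁)] [TopologicalSpace (TotalSpace F₂ E₂)]
  [FiberBundle F₁ E₁] [FiberBundle F₂ E₂]
  [FiniteDimensional ℂ F₁] [FiniteDimensional ℂ F₂]
  [VectorBundle ℂ F₁ E₁] [VectorBundle ℂ F₂ E₂]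
  [ChartedSpace H₁ M₁] [ChartedSpace H₂ M₂]
  [IsManifold I₁ ω M₁] [IsManifold I₂ ω M₂]
  [ContMDiffVectorBundle ω F₁ E₁ I₁] [ContMDiffVectorBundle ω F₂ E₂ I₂]

variable (I₁) in
/-- The `j`-th derivative at `x ∈ M₁` in the direction `v` of a section of `p₁^* E₁ ⊗ p₂^* E₂`,
contracted with the linear form `l` on the fibre of `E₁`: a section of `E₂`. -/
def dirJet (D : ∀ p, ExtTensor E₁ E₂ p) (x : M₁) (j : ℕ) (v : V₁) (l : F₁ →ₗ[ℂ] ℂ) (y : M₂) :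
    E₂ y :=
  -- For fixed `y` the curve stays in the single vector space `E₂ y`. Only `E₁` is trivialized, so
  -- the result is a section of `E₂` itself.
  iteratedDeriv j (fun t : ℂ => contractFst (B := E₂ y)
    (l ∘ₗ (trivializationAt F₁ E₁ x).linearMapAt ℂ
      ((extChartAt I₁ x).symm (extChartAt I₁ x x + t • v)))
    (D ((extChartAt I₁ x).symm (extChartAt I₁ x x + t • v), y))) 0

variable {D : ∀ p, ExtTensor E₁ E₂ p} {x : M₁}

/-- The contraction with a linear form on the first model fibre. -/
def contractFiber (F₂ : Type*) [NormedAddCommGroup F₂] [InnerProductSpace ℂ F₂]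
    [FiniteDimensional ℂ F₂] (l : F₁ →ₗ[ℂ] ℂ) : TensorFiber F₁ F₂ →L[ℂ] F₂ :=
  LinearMap.toContinuousLinearMap (E := TensorFiber F₁ F₂) (contractFst (B := F₂) l)

theorem contractFiber_localRep (l : F₁ →ₗ[ℂ] ℂ) {y₀ : M₂} (z : V₁) (w : V₂) :
    contractFiber F₂ l (localRep (I₁.prod I₂) (TensorFiber F₁ F₂) (x, y₀) D (z, w)) =
      (trivializationAt F₂ E₂ y₀).linearMapAt ℂ ((extChartAt I₂ y₀).symm w)
        (contractFst (B := E₂ ((extChartAt I₂ y₀).symm w))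
          (l ∘ₗ (trivializationAt F₁ E₁ x).linearMapAt ℂ ((extChartAt I₁ x).symm z))
          (D ((extChartAt I₁ x).symm z, (extChartAt I₂ y₀).symm w))) :=
  contractFst_map _ _ _ _

/-- At a fixed `w` the trivialization of `E₂` is a linear equivalence independent of `t`. It
therefore commutes with the derivative in `t`, without any smoothness assumption on the curve. -/
theorem localRep_dirJet (D : ∀ p, ExtTensor E₁ E₂ p) (x : M₁) (j : ℕ) (v : V₁) (l : F₁ →ₗ[ℂ] ℂ)
    {y₀ : M₂} {w : V₂} (hw : w ∈ localDomain I₂ F₂ E₂ y₀) :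
    localRep I₂ F₂ y₀ (dirJet I₁ D x j v l) w = iteratedDeriv j (fun t : ℂ => contractFiber F₂ l
      (localRep (I₁.prod I₂) (TensorFiber F₁ F₂) (x, y₀) D (extChartAt I₁ x x + t • v, w))) 0 := by
  simp_rw [contractFiber_localRep]
  have h1 : ∀ ξ : E₂ ((extChartAt I₂ y₀).symm w), (trivializationAt F₂ E₂ y₀).linearMapAt ℂ
      ((extChartAt I₂ y₀).symm w) ξ =
      (trivializationAt F₂ E₂ y₀).continuousLinearEquivAt ℂ _ hw.2 ξ := fun ξ => by
    rw [Trivialization.coe_linearMapAt_of_mem _ hw.2]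
    rfl
  simp_rw [h1]
  rw [iteratedDeriv_cle_comp, ← h1, localRep_apply' hw]
  rfl

theorem analyticAt_contractFiber_localRep
    (hD : IsHolomorphicSection (I₁.prod I₂) (TensorFiber F₁ F₂) D) (x : M₁) (y : M₂)
    (l : F₁ →ₗ[ℂ] ℂ) : AnalyticAt ℂ (fun q => contractFiber F₂ l
      (localRep (I₁.prod I₂) (TensorFiber F₁ F₂) (x, y) D q))
      (extChartAt I₁ x x, extChartAt I₂ y y) :=
  ((contractFiber F₂ l).analyticAt _).comp (hD.analyticAt (x, y))

theorem IsHolomorphicSection.dirJet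
    (hD : IsHolomorphicSection (I₁.prod I₂) (TensorFiber F₁ F₂) D) (x : M₁) (j : ℕ) (v : V₁)
    (l : F₁ →ₗ[ℂ] ℂ) : IsHolomorphicSection I₂ F₂ (dirJet I₁ D x j v l) := by
  refine isHolomorphicSection_of_analyticAt fun y => ?_
  refine AnalyticAt.congr
    (analyticAt_iteratedDeriv_partial (analyticAt_contractFiber_localRep hD x y l) j v) ?_
  filter_upwards [localDomain_mem_nhds I₂ F₂ E₂ y] with w hw
  exact (localRep_dirJet D x j v l hw).symm

/-- If a section vanishes up to order `m₁ + m₂`, its derivatives of order at most `m₁` in the first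
variable vanish up to order `m₂` in the second variable. -/
theorem iteratedFDeriv_localRep_dirJet_eq_zero
    (hD : IsHolomorphicSection (I₁.prod I₂) (TensorFiber F₁ F₂) D) {x : M₁} {y : M₂} {m₁ m₂ : ℕ}
    (h0 : ∀ i : ℕ, i ≤ m₁ + m₂ → iteratedFDeriv ℂ i
      (localRep (I₁.prod I₂) (TensorFiber F₁ F₂) (x, y) D)
      (extChartAt (I₁.prod I₂) (x, y) (x, y)) = 0)
    {j : ℕ} (hj : j ≤ m₁) (v : V₁) (l : F₁ →ₗ[ℂ] ℂ) {i : ℕ} (hi : i ≤ m₂) :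
    iteratedFDeriv ℂ i (localRep I₂ F₂ y (dirJet I₁ D x j v l)) (extChartAt I₂ y y) = 0 := by
  -- Vanishing up to order `m₁ + m₂` is growth of order `m₁ + m₂ + 1`. After `j ≤ m₁` derivatives at
  -- least `m₂ + 1` remains, which is vanishing up to order `m₂`.
  have hO := isBigO_of_iteratedFDeriv_eq_zero (N := m₁ + m₂ + 1) (hD.analyticAt (x, y))
    fun i hi => h0 i (by omega)
  have hO' := ((contractFiber F₂ l).isBigO_comp _ _).trans hO
  have h1 := isBigO_iteratedDeriv_partial (analyticAt_contractFiber_localRep hD x y l) hO'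
    (j := j) (by omega) v
  have h2 : (fun w => localRep I₂ F₂ y (dirJet I₁ D x j v l) (extChartAt I₂ y y + w)) =O[𝓝 0]
      fun w => ‖w‖ ^ (m₁ + m₂ + 1 - j) := by
    refine Asymptotics.IsBigO.congr' h1 ?_ EventuallyEq.rfl
    have hc : Tendsto (fun w : V₂ => extChartAt I₂ y y + w) (𝓝 0) (𝓝 (extChartAt I₂ y y)) := by
      have : ContinuousAt (fun w : V₂ => extChartAt I₂ y y + w) 0 := by fun_prop
      simpa [ContinuousAt] using this
    filter_upwards [hc (localDomain_mem_nhds I₂ F₂ E₂ y)] with w hw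
    exact (localRep_dirJet D x j v l hw).symm
  exact iteratedFDeriv_eq_zero_of_isBigO ((hD.dirJet x j v l).analyticAt y) h2 (by omega)

/-- Differentiation at `x` commutes with the linear form `η` on the fibre over `y`. So pairing the
directional jet with a vector of `E₂ y` is a jet of a slice, that is, of a section over `M₁`. -/
theorem apply_dirJet (hD : IsHolomorphicSection (I₁.prod I₂) (TensorFiber F₁ F₂) D) (x : M₁)
    (j : ℕ) (v : V₁) (l : F₁ →L[ℂ] ℂ) (y : M₂) (η : E₂ y →L[ℂ] ℂ) :
    η (dirJet I₁ D x j v (l : F₁ →ₗ[ℂ] ℂ) y) = l (iteratedFDeriv ℂ j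
      (localRep I₁ F₁ x (slice D y (η : E₂ y →ₗ[ℂ] ℂ))) (extChartAt I₁ x x) fun _ => v) := by
  set a := extChartAt I₁ x x
  have hline : Tendsto (fun t : ℂ => a + t • v) (𝓝 0) (𝓝 a) := by
    have := continuousAt_line a v 0
    simpa [ContinuousAt] using this
  have hy : y ∈ (trivializationAt F₂ E₂ y).baseSet := mem_baseSet_trivializationAt F₂ E₂ y
  -- The curve in `E₂ y` is smooth because it is the contracted local representation at `(x, y)`
  -- carried back by the inverse trivialization at `y`.
  have hcd : ContDiffAt ℂ j (fun t : ℂ => contractFst (B := E₂ y)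
      ((l : F₁ →ₗ[ℂ] ℂ) ∘ₗ (trivializationAt F₁ E₁ x).linearMapAt ℂ
        ((extChartAt I₁ x).symm (a + t • v)))
      (D ((extChartAt I₁ x).symm (a + t • v), y))) 0 := by
    have h1 : AnalyticAt ℂ (fun t : ℂ => contractFiber F₂ (l : F₁ →ₗ[ℂ] ℂ)
        (localRep (I₁.prod I₂) (TensorFiber F₁ F₂) (x, y) D
          (a + t • v, extChartAt I₂ y y))) 0 := by
      have h2 : AnalyticAt ℂ (fun t : ℂ => (a + t • v, extChartAt I₂ y y)) 0 :=
        (analyticAt_const.add (analyticAt_id.smul analyticAt_const)).prod analyticAt_const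
      refine AnalyticAt.comp (f := fun t : ℂ => (a + t • v, extChartAt I₂ y y))
        (g := fun q => contractFiber F₂ (l : F₁ →ₗ[ℂ] ℂ)
          (localRep (I₁.prod I₂) (TensorFiber F₁ F₂) (x, y) D q)) ?_ h2
      simp only [zero_smul, add_zero]
      exact analyticAt_contractFiber_localRep hD x y (l : F₁ →ₗ[ℂ] ℂ)
    have h3 := ((trivializationAt F₂ E₂ y).symmL ℂ y).contDiff.contDiffAt.comp (0 : ℂ)
      (h1.contDiffAt (n := j))
    refine h3.congr_of_eventuallyEq (Eventually.of_forall fun t => ?_)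
    simp only [Function.comp_apply]
    rw [contractFiber_localRep, extChartAt_to_inv]
    exact ((trivializationAt F₂ E₂ y).symmₗ_linearMapAt hy _).symm
  rw [dirJet, ← iteratedDeriv_clm_comp η hcd]
  have hsl := hD.slice y (η : E₂ y →ₗ[ℂ] ℂ)
  have han : AnalyticAt ℂ (localRep I₁ F₁ x (slice D y (η : E₂ y →ₗ[ℂ] ℂ))) (a + (0 : ℂ) • v) := by
    rw [zero_smul, add_zero]
    exact hsl.analyticAt x
  have h4 := iteratedDeriv_comp_line (v := v) j han
  rw [zero_smul, add_zero] at h4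
  rw [← h4, ← iteratedDeriv_clm_comp l]
  · refine Filter.EventuallyEq.eq_of_nhds (Filter.EventuallyEq.iteratedDeriv ?_ j)
    filter_upwards [hline (localDomain_mem_nhds I₁ F₁ E₁ x)] with t ht
    rw [localRep_apply' ht]
    exact apply_contractFst _ (η : E₂ y →ₗ[ℂ] ℂ) _
  · have h2 : AnalyticAt ℂ (fun t : ℂ => a + t • v) 0 :=
      analyticAt_const.add (analyticAt_id.smul analyticAt_const)
    exact (AnalyticAt.comp (f := fun t : ℂ => a + t • v) han h2).contDiffAt

end DirectionalJet

/-! ### Tensor products of square integrable sections and the orthogonality lemma -/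

section TensorL2

variable {V₁ V₂ H₁ H₂ : Type*} [NormedAddCommGroup V₁] [NormedSpace ℂ V₁] [TopologicalSpace H₁]
  [NormedAddCommGroup V₂] [NormedSpace ℂ V₂] [TopologicalSpace H₂]
  [FiniteDimensional ℂ V₁] [MeasurableSpace V₁] [BorelSpace V₁]
  {I₁ : ModelWithCorners ℂ V₁ H₁} {I₂ : ModelWithCorners ℂ V₂ H₂}
  [I₁.Boundaryless] [I₂.Boundaryless]
  {M₁ M₂ : Type*} {E₁ : M₁ → Type*} {E₂ : M₂ → Type*}
  [∀ x, NormedAddCommGroup (E₁ x)] [∀ x, InnerProductSpace ℂ (E₁ x)]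
  [∀ y, NormedAddCommGroup (E₂ y)] [∀ y, InnerProductSpace ℂ (E₂ y)]
  [TopologicalSpace M₁] [TopologicalSpace M₂]
  {F₁ : Type*} [NormedAddCommGroup F₁] [InnerProductSpace ℂ F₁]
  {F₂ : Type*} [NormedAddCommGroup F₂] [InnerProductSpace ℂ F₂]
  [TopologicalSpace (TotalSpace F₁ E₁)] [TopologicalSpace (TotalSpace F₂ E₂)]
  [FiberBundle F₁ E₁] [FiberBundle F₂ E₂]
  [FiniteDimensional ℂ F₁] [FiniteDimensional ℂ F₂]
  [VectorBundle ℂ F₁ E₁] [VectorBundle ℂ F₂ E₂]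
  [ChartedSpace H₁ M₁] [ChartedSpace H₂ M₂]
  [IsManifold I₁ ω M₁] [IsManifold I₂ ω M₂]
  [ContMDiffVectorBundle ω F₁ E₁ I₁] [ContMDiffVectorBundle ω F₂ E₂ I₂]
  [MeasurableSpace M₁] [BorelSpace M₁] [MeasurableSpace M₂]
  [IsContinuousHermitianBundle F₁ E₁]
  {ν₁ : Measure M₁} {ν₂ : Measure M₂} [SFinite ν₁] [SFinite ν₂]

theorem sqNorm_tensorSection {f₁ : ∀ x, E₁ x} {f₂ : ∀ y, E₂ y}
    (h₁ : Measurable fun x => ‖f₁ x‖) (h₂ : Measurable fun y => ‖f₂ y‖) :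
    sqNorm (ν₁.prod ν₂) (tensorSection f₁ f₂) = sqNorm ν₁ f₁ * sqNorm ν₂ f₂ := by
  unfold sqNorm
  rw [← lintegral_prod_mul (measurable_enorm_sq h₁).aemeasurable
    (measurable_enorm_sq h₂).aemeasurable]
  refine lintegral_congr fun p => ?_
  rw [← mul_pow, ← ofReal_norm, norm_tensorSection, ENNReal.ofReal_mul (norm_nonneg _),
    ofReal_norm, ofReal_norm]

variable [IsReproducing ν₁ (holomorphicSections I₁ F₁ E₁)]
  [IsReproducing ν₂ (holomorphicSections I₂ F₂ E₂)]
  [IsReproducing (ν₁.prod ν₂)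
    (holomorphicSections (I₁.prod I₂) (TensorFiber F₁ F₂) (ExtTensor E₁ E₂))]

namespace SectionL2

/-- The tensor product of square integrable holomorphic sections. -/
def tensor (g₁ : SectionL2 ν₁ (holomorphicSections I₁ F₁ E₁))
    (g₂ : SectionL2 ν₂ (holomorphicSections I₂ F₂ E₂)) :
    SectionL2 (ν₁.prod ν₂)
      (holomorphicSections (I₁.prod I₂) (TensorFiber F₁ F₂) (ExtTensor E₁ E₂)) :=
  mk _ (tensorSection g₁.1 g₂.1) (IsHolomorphicSection.tensorSection g₁.2.1 g₂.2.1) (by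
    rw [sqNorm_tensorSection g₁.measurable_norm g₂.measurable_norm]
    exact ENNReal.mul_lt_top g₁.2.2 g₂.2.2)

theorem inner_tensor (f₁ g₁ : SectionL2 ν₁ (holomorphicSections I₁ F₁ E₁))
    (f₂ g₂ : SectionL2 ν₂ (holomorphicSections I₂ F₂ E₂)) :
    inner ℂ (f₁.tensor f₂) (g₁.tensor g₂) = inner ℂ f₁ g₁ * inner ℂ f₂ g₂ := by
  simp_rw [inner_def]
  rw [← integral_prod_mul]
  exact integral_congr_ae (Eventually.of_forall fun p => inner_tensorSection _ _ _ _ p)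

theorem norm_tensor (g₁ : SectionL2 ν₁ (holomorphicSections I₁ F₁ E₁))
    (g₂ : SectionL2 ν₂ (holomorphicSections I₂ F₂ E₂)) : ‖g₁.tensor g₂‖ = ‖g₁‖ * ‖g₂‖ := by
  refine (pow_left_inj₀ (norm_nonneg _) (by positivity) two_ne_zero).1 ?_
  rw [mul_pow, norm_sq, norm_sq, norm_sq, ← ENNReal.toReal_mul,
    ← sqNorm_tensorSection g₁.measurable_norm g₂.measurable_norm]
  rfl

/-- The linear form `g ↦ ⟪D, g ⊗ g₂⟫`. -/
def innerTensor (D : SectionL2 (ν₁.prod ν₂)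
      (holomorphicSections (I₁.prod I₂) (TensorFiber F₁ F₂) (ExtTensor E₁ E₂)))
    (g₂ : SectionL2 ν₂ (holomorphicSections I₂ F₂ E₂)) :
    SectionL2 ν₁ (holomorphicSections I₁ F₁ E₁) →L[ℂ] ℂ :=
  LinearMap.mkContinuous
    { toFun := fun g => inner ℂ D (g.tensor g₂)
      map_add' := fun g g' => by
        rw [← inner_add_right]
        congr 1
        exact Subtype.ext (funext fun p => TensorProduct.add_tmul _ _ _)
      map_smul' := fun c g => by
        rw [RingHom.id_apply, smul_eq_mul, ← inner_smul_right]
        congr 1 }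
    (‖D‖ * ‖g₂‖) fun g => by
      refine (norm_inner_le_norm (𝕜 := ℂ) D (g.tensor g₂)).trans_eq ?_
      rw [norm_tensor]
      ring

end SectionL2

variable (D : SectionL2 (ν₁.prod ν₂)
      (holomorphicSections (I₁.prod I₂) (TensorFiber F₁ F₂) (ExtTensor E₁ E₂)))

/-- By Tonelli, almost every slice is square integrable. The identities on slices below are needed
only under the integral over `y`, so this suffices. -/
theorem ae_lintegral_enorm_sq_lt_top : ∀ᵐ y ∂ν₂, ∫⁻ x, ‖D.1 (x, y)‖ₑ ^ 2 ∂ν₁ < ⊤ := by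
  refine ae_lt_top (measurable_enorm_sq D.measurable_norm).lintegral_prod_left' ?_
  rw [← lintegral_prod_symm' _ (measurable_enorm_sq D.measurable_norm)]
  exact D.2.2.ne

theorem sqNorm_slice_le (y : M₂) (b : E₂ y) : sqNorm ν₁ (slice D.1 y (innerₛₗ ℂ b)) ≤
    ‖b‖ₑ ^ 2 * ∫⁻ x, ‖D.1 (x, y)‖ₑ ^ 2 ∂ν₁ := by
  rw [← lintegral_const_mul' _ _ (by simp)]
  refine lintegral_mono fun x => ?_
  rw [← mul_pow, ← ofReal_norm, ← ofReal_norm, ← ofReal_norm, ← ENNReal.ofReal_mul (norm_nonneg _)]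
  gcongr
  exact norm_contractSnd_le b (D.1 (x, y))

variable {D} in
/-- The slices of a square integrable holomorphic section. -/
def sliceL2 {y : M₂} (hy : ∫⁻ x, ‖D.1 (x, y)‖ₑ ^ 2 ∂ν₁ < ⊤) (b : E₂ y) :
    SectionL2 ν₁ (holomorphicSections I₁ F₁ E₁) :=
  SectionL2.mk ν₁ (slice D.1 y (innerₛₗ ℂ b))
    (IsHolomorphicSection.slice (I₁ := I₁) (I₂ := I₂) (F₁ := F₁) (F₂ := F₂) D.2.1 y (innerₛₗ ℂ b))
    ((sqNorm_slice_le D y b).trans_lt (ENNReal.mul_lt_top (by simp) hy))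

/-- A directional derivative at a point, contracted with a linear form. -/
def jetForm {m : Measure V₁} [m.IsAddHaarMeasure] (hν₁ : LocallyDominates I₁ m ν₁) (x : M₁) (j : ℕ)
    (v : V₁) (l : F₁ →L[ℂ] ℂ) : SectionL2 ν₁ (holomorphicSections I₁ F₁ E₁) →L[ℂ] ℂ :=
  l ∘L ContinuousMultilinearMap.apply ℂ (fun _ : Fin j => V₁) F₁ (fun _ => v) ∘L jet hν₁ x j

variable {m : Measure V₁} [m.IsAddHaarMeasure] (hν₁ : LocallyDominates I₁ m ν₁)
variable {D}

theorem inner_dirJet {y : M₂} (hy : ∫⁻ x, ‖D.1 (x, y)‖ₑ ^ 2 ∂ν₁ < ⊤) (b : E₂ y)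
    (x : M₁) (j : ℕ) (v : V₁) (l : F₁ →L[ℂ] ℂ) :
    inner ℂ b (dirJet I₁ D.1 x j v (l : F₁ →ₗ[ℂ] ℂ) y) = jetForm hν₁ x j v l (sliceL2 hy b) :=
  apply_dirJet (I₁ := I₁) (I₂ := I₂) (F₁ := F₁) (F₂ := F₂) D.2.1 x j v l y (innerSL ℂ b)

/-- Pairing the jet `s` with itself gives `‖s‖²` as a jet of the slice of `D` by `s`. That slice has
norm at most `‖s‖` times the norm of `D(·, y)`; a factor `‖s‖` then cancels. -/
theorem enorm_dirJet_sq_le {y : M₂} (hy : ∫⁻ x, ‖D.1 (x, y)‖ₑ ^ 2 ∂ν₁ < ⊤)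
    (x : M₁) (j : ℕ) (v : V₁) (l : F₁ →L[ℂ] ℂ) :
    ‖dirJet I₁ D.1 x j v (l : F₁ →ₗ[ℂ] ℂ) y‖ₑ ^ 2 ≤
      ‖jetForm (E₁ := E₁) hν₁ x j v l‖ₑ ^ 2 * ∫⁻ x, ‖D.1 (x, y)‖ₑ ^ 2 ∂ν₁ := by
  set s := dirJet I₁ D.1 x j v (l : F₁ →ₗ[ℂ] ℂ) y with hs
  rcases eq_or_ne s 0 with h0 | h0
  · simp [h0]
  have h1 : ‖s‖ₑ ^ 2 = ‖inner ℂ s s‖ₑ := by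
    rw [inner_self_eq_norm_sq_to_K, enorm_pow]
    congr 1
    simp [enorm_eq_iff_norm_eq]
  have h2 : (‖s‖ₑ ^ 2) ^ 2 ≤ ‖s‖ₑ ^ 2 * (‖jetForm (E₁ := E₁) hν₁ x j v l‖ₑ ^ 2 *
      ∫⁻ x, ‖D.1 (x, y)‖ₑ ^ 2 ∂ν₁) := by
    calc (‖s‖ₑ ^ 2) ^ 2 = ‖jetForm hν₁ x j v l (sliceL2 hy s)‖ₑ ^ 2 := by
          rw [h1, ← inner_dirJet hν₁ hy]
      _ ≤ (‖jetForm (E₁ := E₁) hν₁ x j v l‖ₑ * ‖sliceL2 hy s‖ₑ) ^ 2 := by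
          gcongr
          exact ContinuousLinearMap.le_opENorm _ _
      _ ≤ ‖jetForm (E₁ := E₁) hν₁ x j v l‖ₑ ^ 2 *
          (‖s‖ₑ ^ 2 * ∫⁻ x, ‖D.1 (x, y)‖ₑ ^ 2 ∂ν₁) := by
          rw [mul_pow, SectionL2.enorm_sq]
          gcongr
          exact sqNorm_slice_le D y s
      _ = _ := by ring
  rw [sq (‖s‖ₑ ^ 2)] at h2
  exact (ENNReal.mul_le_mul_iff_right (by simpa using h0) (by simp)).1 h2

/-- The directional derivatives of a square integrable section are square integrable. -/
def dirJetL2 (x : M₁) (j : ℕ) (v : V₁) (l : F₁ →L[ℂ] ℂ) :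
    SectionL2 ν₂ (holomorphicSections I₂ F₂ E₂) :=
  SectionL2.mk ν₂ (dirJet I₁ D.1 x j v (l : F₁ →ₗ[ℂ] ℂ))
    (IsHolomorphicSection.dirJet (I₁ := I₁) (I₂ := I₂) (F₁ := F₁) (F₂ := F₂) D.2.1 x j v l) (by
    calc sqNorm ν₂ (dirJet I₁ D.1 x j v (l : F₁ →ₗ[ℂ] ℂ))
        ≤ ∫⁻ y, ‖jetForm (E₁ := E₁) hν₁ x j v l‖ₑ ^ 2 * ∫⁻ x, ‖D.1 (x, y)‖ₑ ^ 2 ∂ν₁ ∂ν₂ := by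
          refine lintegral_mono_ae ?_
          filter_upwards [ae_lintegral_enorm_sq_lt_top D] with y hy
          exact enorm_dirJet_sq_le hν₁ hy x j v l
      _ = ‖jetForm (E₁ := E₁) hν₁ x j v l‖ₑ ^ 2 * sqNorm (ν₁.prod ν₂) D.1 := by
          rw [lintegral_const_mul' _ _ (by simp),
            ← lintegral_prod_symm' _ (measurable_enorm_sq D.measurable_norm)]
          rfl
      _ < ⊤ := ENNReal.mul_lt_top (by simp) D.2.2)

/-- Integrate over `M₁` first. For almost every `y` the inner integral is `⟪K, ·⟫` applied to the
slice of `D` by `g₂ y`, which `K` turns into a jet of this slice, hence into `⟪g₂ y, dirJet y⟫`. -/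
theorem inner_tensor_eq_inner_dirJetL2 (K : SectionL2 ν₁ (holomorphicSections I₁ F₁ E₁))
    (g₂ : SectionL2 ν₂ (holomorphicSections I₂ F₂ E₂)) (x : M₁) (j : ℕ) (v : V₁) (l : F₁ →L[ℂ] ℂ)
    (hK : ∀ g, inner ℂ K g = jetForm hν₁ x j v l g) :
    inner ℂ (K.tensor g₂) D = inner ℂ g₂ (dirJetL2 (D := D) hν₁ x j v l) := by
  rw [SectionL2.inner_def, SectionL2.inner_def, integral_prod_symm _ (SectionL2.integrable _ _)]
  refine integral_congr_ae ?_
  filter_upwards [ae_lintegral_enorm_sq_lt_top D] with y hy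
  refine Eq.trans ?_ (inner_dirJet hν₁ hy (g₂.1 y) x j v l).symm
  rw [← hK, SectionL2.inner_def]
  refine integral_congr_ae (Eventually.of_forall fun x => ?_)
  exact (inner_contractSnd (K.1 x) (g₂.1 y) (D.1 (x, y))).symm

variable {m₁ m₂ : ℕ} {S₁ : Set M₁} {S₂ : Set M₂}

theorem dirJetL2_mem_vanishingSubmodule
    (hD : D ∈ vanishingSubmodule (I₁.prod I₂) (TensorFiber F₁ F₂) (ExtTensor E₁ E₂) (ν₁.prod ν₂)
      (m₁ + m₂) (S₁ ×ˢ S₂)) {x : M₁} (hx : x ∈ S₁) {j : ℕ} (hj : j ≤ m₁) (v : V₁)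
    (l : F₁ →L[ℂ] ℂ) :
    dirJetL2 (D := D) hν₁ x j v l ∈ vanishingSubmodule I₂ F₂ E₂ ν₂ m₂ S₂ := fun y hy i hi =>
  iteratedFDeriv_localRep_dirJet_eq_zero (m₂ := m₂) D.2.1
    (fun i hi => hD (x, y) ⟨hx, hy⟩ i (by exact_mod_cast hi)) hj v _ (by exact_mod_cast hi)

/-- Sections that vanish up to order `m₁ + m₂` on `S₁ × S₂` are orthogonal to the tensor products
of sections that are orthogonal to those that vanish up to order `m₁` on `S₁` and up to order `m₂`
on `S₂`. -/
theorem inner_tensor_eq_zero (hν₁ : LocallyDominates I₁ m ν₁)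
    (hD : D ∈ vanishingSubmodule (I₁.prod I₂) (TensorFiber F₁ F₂) (ExtTensor E₁ E₂) (ν₁.prod ν₂)
      (m₁ + m₂) (S₁ ×ˢ S₂))
    {g₁ : SectionL2 ν₁ (holomorphicSections I₁ F₁ E₁)}
    (hg₁ : g₁ ∈ (vanishingSubmodule I₁ F₁ E₁ ν₁ m₁ S₁)ᗮ)
    {g₂ : SectionL2 ν₂ (holomorphicSections I₂ F₂ E₂)}
    (hg₂ : g₂ ∈ (vanishingSubmodule I₂ F₂ E₂ ν₂ m₂ S₂)ᗮ) :
    inner ℂ D (g₁.tensor g₂) = 0 := by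
  set T := (InnerProductSpace.toDual ℂ (SectionL2 ν₁ (holomorphicSections I₁ F₁ E₁))).symm
    (SectionL2.innerTensor D g₂) with hT
  have hTi : ∀ g, inner ℂ T g = inner ℂ D (g.tensor g₂) := fun g =>
    InnerProductSpace.toDual_symm_apply
  -- `T` is `D` with its second variable integrated against `g₂`. Once `T` is known to vanish up to
  -- order `m₁` on `S₁`, it is orthogonal to `g₁`.
  suffices T ∈ vanishingSubmodule I₁ F₁ E₁ ν₁ m₁ S₁ by
    rw [← hTi]
    exact Submodule.inner_right_of_mem_orthogonal this hg₁
  intro x hx j hj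
  have hj' : j ≤ m₁ := by exact_mod_cast hj
  have key : ∀ i ≤ m₁, ∀ v, ∀ l : F₁ →L[ℂ] ℂ, jetForm hν₁ x i v l T = 0 := fun i hi v l => by
    set K := (InnerProductSpace.toDual ℂ (SectionL2 ν₁ (holomorphicSections I₁ F₁ E₁))).symm
      (jetForm hν₁ x i v l)
    have hK : ∀ g, inner ℂ K g = jetForm hν₁ x i v l g := fun g =>
      InnerProductSpace.toDual_symm_apply
    rw [← hK, ← inner_conj_symm, hTi, inner_conj_symm,
      inner_tensor_eq_inner_dirJetL2 hν₁ K g₂ x i v l hK]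
    exact Submodule.inner_left_of_mem_orthogonal
      (dirJetL2_mem_vanishingSubmodule hν₁ hD hx hi v l) hg₂
  have hline : ∀ i ≤ m₁, ∀ v, iteratedFDeriv ℂ i (localRep I₁ F₁ x T.1) (extChartAt I₁ x x)
      (fun _ => v) = 0 := fun i hi v =>
    SeparatingDual.eq_zero_of_forall_dual_eq_zero (R := ℂ) fun l => key i hi v l
  have han : AnalyticAt ℂ (localRep I₁ F₁ x T.1) (extChartAt I₁ x x) :=
    IsHolomorphicSection.analyticAt T.2.1 x
  -- So far the derivatives vanish only on constant tuples `(v, ..., v)`. The growth condition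
  -- upgrades this to the full multilinear derivative.
  refine iteratedFDeriv_eq_zero_of_isBigO (N := m₁ + 1) han
    (isBigO_of_iteratedDeriv_line_eq_zero han fun i hi v => ?_) (by omega)
  have h4 := iteratedDeriv_comp_line (f := localRep I₁ F₁ x T.1) (a := extChartAt I₁ x x) (v := v)
    (t := 0) i (by simpa using han)
  rw [h4, zero_smul, add_zero]
  exact hline i (by omega) v

end TensorL2

/-! ### The product property in Hilbert space form -/

section ProductProperty

variable {V₁ V₂ H₁ H₂ : Type*} [NormedAddCommGroup V₁] [NormedSpace ℂ V₁] [TopologicalSpace H₁]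
  [NormedAddCommGroup V₂] [NormedSpace ℂ V₂] [TopologicalSpace H₂]
  [FiniteDimensional ℂ V₁] [MeasurableSpace V₁] [BorelSpace V₁]
  {I₁ : ModelWithCorners ℂ V₁ H₁} {I₂ : ModelWithCorners ℂ V₂ H₂}
  [I₁.Boundaryless] [I₂.Boundaryless]
  {M₁ M₂ : Type*} {E₁ : M₁ → Type*} {E₂ : M₂ → Type*}
  [∀ x, NormedAddCommGroup (E₁ x)] [∀ x, InnerProductSpace ℂ (E₁ x)]
  [∀ y, NormedAddCommGroup (E₂ y)] [∀ y, InnerProductSpace ℂ (E₂ y)]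
  [TopologicalSpace M₁] [TopologicalSpace M₂]
  {F₁ : Type*} [NormedAddCommGroup F₁] [InnerProductSpace ℂ F₁]
  {F₂ : Type*} [NormedAddCommGroup F₂] [InnerProductSpace ℂ F₂]
  [TopologicalSpace (TotalSpace F₁ E₁)] [TopologicalSpace (TotalSpace F₂ E₂)]
  [FiberBundle F₁ E₁] [FiberBundle F₂ E₂]
  [FiniteDimensional ℂ F₁] [FiniteDimensional ℂ F₂]
  [VectorBundle ℂ F₁ E₁] [VectorBundle ℂ F₂ E₂]
  [ChartedSpace H₁ M₁] [ChartedSpace H₂ M₂]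
  [IsManifold I₁ ω M₁] [IsManifold I₂ ω M₂]
  [ContMDiffVectorBundle ω F₁ E₁ I₁] [ContMDiffVectorBundle ω F₂ E₂ I₂]
  [MeasurableSpace M₁] [BorelSpace M₁] [MeasurableSpace M₂]
  [IsContinuousHermitianBundle F₁ E₁]
  {ν₁ : Measure M₁} {ν₂ : Measure M₂} [SFinite ν₁] [SFinite ν₂]

variable [IsReproducing ν₁ (holomorphicSections I₁ F₁ E₁)]
  [IsReproducing ν₂ (holomorphicSections I₂ F₂ E₂)]
  [IsReproducing (ν₁.prod ν₂)
    (holomorphicSections (I₁.prod I₂) (TensorFiber F₁ F₂) (ExtTensor E₁ E₂))]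
  {S₁ : Set M₁} {S₂ : Set M₂}

/-- Growth orders of the two factors add. Natural orders `Nᵢ` with `Nᵢ ≤ kᵢ + 1` include `kᵢ = -1`,
where `Nᵢ = 0` expresses no condition. -/
theorem tensor_mem_vanishingSubmodule {N₁ N₂ : ℕ} {k₁ k₂ k : ℤ} (h₁ : (N₁ : ℤ) ≤ k₁ + 1)
    (h₂ : (N₂ : ℤ) ≤ k₂ + 1) (hk : k < N₁ + N₂)
    {g₁ : SectionL2 ν₁ (holomorphicSections I₁ F₁ E₁)}
    (hg₁ : g₁ ∈ vanishingSubmodule I₁ F₁ E₁ ν₁ k₁ S₁)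
    {g₂ : SectionL2 ν₂ (holomorphicSections I₂ F₂ E₂)}
    (hg₂ : g₂ ∈ vanishingSubmodule I₂ F₂ E₂ ν₂ k₂ S₂) :
    g₁.tensor g₂ ∈ vanishingSubmodule (I₁.prod I₂) (TensorFiber F₁ F₂) (ExtTensor E₁ E₂)
      (ν₁.prod ν₂) k (S₁ ×ˢ S₂) := by
  rintro ⟨x, y⟩ ⟨hx, hy⟩ j hj
  have o₁ := isBigO_of_iteratedFDeriv_eq_zero (N := N₁)
    (IsHolomorphicSection.analyticAt g₁.2.1 x) fun i hi => hg₁ x hx i (by omega)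
  have o₂ := isBigO_of_iteratedFDeriv_eq_zero (N := N₂)
    (IsHolomorphicSection.analyticAt g₂.2.1 y) fun i hi => hg₂ y hy i (by omega)
  have t₁ : Tendsto (fun q : V₁ × V₂ => q.1) (𝓝 0) (𝓝 0) := continuous_fst.tendsto 0
  have t₂ : Tendsto (fun q : V₁ × V₂ => q.2) (𝓝 0) (𝓝 0) := continuous_snd.tendsto 0
  refine iteratedFDeriv_eq_zero_of_isBigO (N := N₁ + N₂)
    (IsHolomorphicSection.analyticAt (g₁.tensor g₂).2.1 (x, y)) ?_ (by omega)
  rw [extChartAt_prod_self]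
  have hc : Tendsto (fun q : V₁ × V₂ => (extChartAt I₁ x x, extChartAt I₂ y y) + q) (𝓝 0)
      (𝓝 (extChartAt I₁ x x, extChartAt I₂ y y)) := by
    have : ContinuousAt (fun q : V₁ × V₂ => (extChartAt I₁ x x, extChartAt I₂ y y) + q) 0 := by
      fun_prop
    simpa [ContinuousAt] using this
  refine Asymptotics.IsBigO.congr'
    (f₁ := fun q : V₁ × V₂ => tensorFiberMk F₁ F₂ (localRep I₁ F₁ x g₁.1 (extChartAt I₁ x x + q.1))
      (localRep I₂ F₂ y g₂.1 (extChartAt I₂ y y + q.2))) ?_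
    ((localRep_tensorSection_eventuallyEq g₁.1 g₂.1 x y).comp_tendsto hc).symm EventuallyEq.rfl
  have b₁ : (fun q : V₁ × V₂ => ‖q.1‖ ^ N₁) =O[𝓝 0] fun q => ‖q‖ ^ N₁ :=
    (IsBigO.of_norm_le fun q => (norm_norm q.1).le.trans (norm_fst_le q)).pow N₁
  have b₂ : (fun q : V₁ × V₂ => ‖q.2‖ ^ N₂) =O[𝓝 0] fun q => ‖q‖ ^ N₂ :=
    (IsBigO.of_norm_le fun q => (norm_norm q.2).le.trans (norm_snd_le q)).pow N₂
  have o := (((o₁.comp_tendsto t₁).trans b₁).norm_left).mul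
    (((o₂.comp_tendsto t₂).trans b₂).norm_left)
  simp_rw [pow_add]
  refine IsBigO.trans ?_ o
  refine IsBigO.of_bound ‖tensorFiberMk F₁ F₂‖ (Eventually.of_forall fun q => ?_)
  rw [norm_mul, norm_norm, norm_norm, ← mul_assoc]
  exact (tensorFiberMk F₁ F₂).le_opNorm₂ _ _

variable {m : Measure V₁} [m.IsAddHaarMeasure] {m₁ m₂ : ℕ}
  {f₁ g₁ : SectionL2 ν₁ (holomorphicSections I₁ F₁ E₁)}
  {f₂ g₂ : SectionL2 ν₂ (holomorphicSections I₂ F₂ E₂)}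
  {g : SectionL2 (ν₁.prod ν₂)
    (holomorphicSections (I₁.prod I₂) (TensorFiber F₁ F₂) (ExtTensor E₁ E₂))}

/-- By the orthogonality lemma, `⟪g, g₁ ⊗ g₂⟫` may be computed with `f₁ ⊗ f₂` in place of `g`, and
then with `g₁ ⊗ g₂` itself. Cauchy–Schwarz concludes. -/
theorem norm_mul_norm_le (hν₁ : LocallyDominates I₁ m ν₁)
    (h₁ : g₁ - f₁ ∈ vanishingSubmodule I₁ F₁ E₁ ν₁ m₁ S₁)
    (hg₁ : g₁ ∈ (vanishingSubmodule I₁ F₁ E₁ ν₁ m₁ S₁)ᗮ)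
    (h₂ : g₂ - f₂ ∈ vanishingSubmodule I₂ F₂ E₂ ν₂ m₂ S₂)
    (hg₂ : g₂ ∈ (vanishingSubmodule I₂ F₂ E₂ ν₂ m₂ S₂)ᗮ)
    (h : g - f₁.tensor f₂ ∈ vanishingSubmodule (I₁.prod I₂) (TensorFiber F₁ F₂)
      (ExtTensor E₁ E₂) (ν₁.prod ν₂) (m₁ + m₂) (S₁ ×ˢ S₂)) :
    ‖g₁‖ * ‖g₂‖ ≤ ‖g‖ := by
  have e₁ : inner ℂ f₁ g₁ = inner ℂ g₁ g₁ := by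
    have := Submodule.inner_right_of_mem_orthogonal h₁ hg₁
    rw [inner_sub_left, sub_eq_zero] at this
    exact this.symm
  have e₂ : inner ℂ f₂ g₂ = inner ℂ g₂ g₂ := by
    have := Submodule.inner_right_of_mem_orthogonal h₂ hg₂
    rw [inner_sub_left, sub_eq_zero] at this
    exact this.symm
  have e : inner ℂ g (g₁.tensor g₂) = inner ℂ (g₁.tensor g₂) (g₁.tensor g₂) := by
    have := inner_tensor_eq_zero hν₁ h hg₁ hg₂
    rw [inner_sub_left, sub_eq_zero] at this
    rw [this, SectionL2.inner_tensor, SectionL2.inner_tensor, e₁, e₂]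
  have h3 : ‖g₁.tensor g₂‖ * ‖g₁.tensor g₂‖ ≤ ‖g‖ * ‖g₁.tensor g₂‖ := by
    have h4 := norm_inner_le_norm (𝕜 := ℂ) g (g₁.tensor g₂)
    rw [e, inner_self_eq_norm_sq_to_K, norm_pow, sq] at h4
    simpa using h4
  rw [← SectionL2.norm_tensor]
  rcases (norm_nonneg (g₁.tensor g₂)).eq_or_lt with h0 | h0
  · rw [← h0]; exact norm_nonneg _
  · exact le_of_mul_le_mul_right h3 h0

theorem eq_tensor (hν₁ : LocallyDominates I₁ m ν₁)
    (h₁ : g₁ - f₁ ∈ vanishingSubmodule I₁ F₁ E₁ ν₁ m₁ S₁)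
    (hg₁ : g₁ ∈ (vanishingSubmodule I₁ F₁ E₁ ν₁ m₁ S₁)ᗮ)
    (h₂ : g₂ - f₂ ∈ vanishingSubmodule I₂ F₂ E₂ ν₂ m₂ S₂)
    (hg₂ : g₂ ∈ (vanishingSubmodule I₂ F₂ E₂ ν₂ m₂ S₂)ᗮ)
    (h : g - f₁.tensor f₂ ∈ vanishingSubmodule (I₁.prod I₂) (TensorFiber F₁ F₂)
      (ExtTensor E₁ E₂) (ν₁.prod ν₂) (m₁ + m₂) (S₁ ×ˢ S₂))
    (hg : g ∈ (vanishingSubmodule (I₁.prod I₂) (TensorFiber F₁ F₂)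
      (ExtTensor E₁ E₂) (ν₁.prod ν₂) (m₁ + m₂) (S₁ ×ˢ S₂))ᗮ)
    (hf₁ : f₁ ∈ vanishingSubmodule I₁ F₁ E₁ ν₁ (m₁ - 1) S₁)
    (hf₂ : f₂ ∈ vanishingSubmodule I₂ F₂ E₂ ν₂ (m₂ - 1) S₂) :
    g = g₁.tensor g₂ := by
  -- `g₂` agrees with `f₂` up to order `m₂`, so it inherits the vanishing up to order `m₂ - 1`.
  have hg₂' : g₂ ∈ vanishingSubmodule I₂ F₂ E₂ ν₂ (m₂ - 1) S₂ := by
    have : g₂ - f₂ ∈ vanishingSubmodule I₂ F₂ E₂ ν₂ (m₂ - 1) S₂ :=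
      fun y hy j hj => h₂ y hy j (by omega)
    simpa using Submodule.add_mem _ this hf₂
  have a₁ := tensor_mem_vanishingSubmodule (N₁ := m₁ + 1) (N₂ := m₂) (k := m₁ + m₂)
    (by omega) (by omega) (by omega) h₁ hg₂'
  have a₂ := tensor_mem_vanishingSubmodule (N₁ := m₁) (N₂ := m₂ + 1) (k := m₁ + m₂)
    (by omega) (by omega) (by omega) hf₁ h₂
  -- In each summand one factor vanishes up to order `mᵢ` and the other up to one order less than
  -- its own `mᵢ`. The growth orders therefore sum to `m₁ + m₂ + 1`.
  have e : (g₁ - f₁).tensor g₂ + f₁.tensor (g₂ - f₂) = g₁.tensor g₂ - f₁.tensor f₂ := by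
    refine Subtype.ext (funext fun p => ?_)
    change (g₁.1 p.1 - f₁.1 p.1) ⊗ₜ[ℂ] g₂.1 p.2 + f₁.1 p.1 ⊗ₜ[ℂ] (g₂.1 p.2 - f₂.1 p.2) =
      g₁.1 p.1 ⊗ₜ[ℂ] g₂.1 p.2 - f₁.1 p.1 ⊗ₜ[ℂ] f₂.1 p.2
    rw [TensorProduct.sub_tmul, TensorProduct.tmul_sub, sub_add_sub_cancel]
  have h3 := Submodule.sub_mem _ h (e ▸ Submodule.add_mem _ a₁ a₂)
  rw [sub_sub_sub_cancel_right] at h3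
  -- The difference vanishes up to order `m₁ + m₂`, while both `g` and `g₁ ⊗ g₂` are orthogonal to
  -- such sections.
  have h4 : inner ℂ (g - g₁.tensor g₂) (g - g₁.tensor g₂) = 0 := by
    rw [inner_sub_right, inner_tensor_eq_zero hν₁ h3 hg₁ hg₂,
      Submodule.inner_right_of_mem_orthogonal h3 hg, sub_zero]
  exact sub_eq_zero.1 (inner_self_eq_zero.1 h4)

end ProductProperty

/-! ### Volume forms and weights against Lebesgue measure -/

section Volume

variable {n : ℕ} {M : Type*} [TopologicalSpace M] [ChartedSpace (Fin n → ℂ) M]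
  [MeasurableSpace M] [BorelSpace M] {μ : Measure M}

/-- On a small ball in a chart, a continuous volume form is comparable to the Lebesgue measure. -/
theorem IsContinuousVolume.exists_ball (hμ : IsContinuousVolume (n := n) μ) (x : M) {U : Set M}
    (hU : U ∈ 𝓝 x) :
    ∃ r > 0, ball (chartAt (Fin n → ℂ) x x) r ⊆ (chartAt (Fin n → ℂ) x).target ∧
      (∀ z ∈ ball (chartAt (Fin n → ℂ) x x) r, (chartAt (Fin n → ℂ) x).symm z ∈ U) ∧
      ∃ c : ℝ≥0∞, c ≠ 0 ∧ c ≠ ⊤ ∧ ∃ C : ℝ≥0∞, C ≠ ⊤ ∧ ∀ T : Set M, MeasurableSet T →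
        c * volume ((chartAt (Fin n → ℂ) x).symm ⁻¹' T ∩ ball (chartAt (Fin n → ℂ) x x) r) ≤
          μ (T ∩ (chartAt (Fin n → ℂ) x).symm '' ball (chartAt (Fin n → ℂ) x x) r) ∧
        μ (T ∩ (chartAt (Fin n → ℂ) x).symm '' ball (chartAt (Fin n → ℂ) x x) r) ≤
          C * volume ((chartAt (Fin n → ℂ) x).symm ⁻¹' T ∩
            ball (chartAt (Fin n → ℂ) x x) r) := by
  set φ := chartAt (Fin n → ℂ) x
  obtain ⟨ρ, hρc, hρ0, hρ⟩ := hμ φ (chart_mem_atlas _ x)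
  have hx : x ∈ φ.source := mem_chart_source _ x
  have hxt : φ x ∈ φ.target := φ.map_source hx
  have htn : φ.target ∈ 𝓝 (φ x) := φ.open_target.mem_nhds hxt
  have hρa : ContinuousAt ρ (φ x) := hρc.continuousAt htn
  have hs : φ.symm ⁻¹' U ∈ 𝓝 (φ x) := by
    refine (φ.continuousAt_symm hxt).preimage_mem_nhds ?_
    rwa [φ.left_inv hx]
  -- By continuity the density lies between half its value at the centre and that value plus one on
  -- a small ball; these give the two comparison constants.
  obtain ⟨r, hr, hb⟩ := Metric.eventually_nhds_iff_ball.1 (((eventually_mem_set.2 htn).and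
    (eventually_mem_set.2 hs)).and ((hρa.eventually (lt_mem_nhds (half_lt_self (hρ0 _ hxt)))).and
      (hρa.eventually (gt_mem_nhds (lt_add_one (ρ (φ x)))))))
  have hbt : ball (φ x) r ⊆ φ.target := fun z hz => (hb z hz).1.1
  refine ⟨r, hr, hbt, fun z hz => (hb z hz).1.2, ENNReal.ofReal (ρ (φ x) / 2),
    by simpa using hρ0 _ hxt, ENNReal.ofReal_ne_top, ENNReal.ofReal (ρ (φ x) + 1),
    ENNReal.ofReal_ne_top, fun T hT => ?_⟩
  have himg : φ.symm '' ball (φ x) r = φ.source ∩ φ ⁻¹' ball (φ x) r :=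
    φ.symm_image_eq_source_inter_preimage hbt
  have hopen : IsOpen (φ.symm '' ball (φ x) r) := by
    rw [himg]
    exact φ.isOpen_inter_preimage isOpen_ball
  have hsub : T ∩ φ.symm '' ball (φ x) r ⊆ φ.source := fun y hy => by
    rw [himg] at hy
    exact hy.2.1
  have hpre : φ '' (T ∩ φ.symm '' ball (φ x) r) = φ.symm ⁻¹' T ∩ ball (φ x) r := by
    ext z
    constructor
    · rintro ⟨y, ⟨hy, w, hw, rfl⟩, rfl⟩
      rw [mem_inter_iff, mem_preimage, φ.right_inv (hbt hw)]
      exact ⟨hy, hw⟩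
    · rintro ⟨hz, hzb⟩
      exact ⟨φ.symm z, ⟨hz, z, hzb, rfl⟩, φ.right_inv (hbt hzb)⟩
  have hmeas : MeasurableSet (φ.symm ⁻¹' T ∩ ball (φ x) r) := by
    have h1 : Measurable fun z : ball (φ x) r => φ.symm z :=
      (continuousOn_iff_continuous_domRestrict.1 (φ.continuousOn_symm.mono hbt)).measurable
    convert (MeasurableEmbedding.subtype_coe measurableSet_ball).measurableSet_image.2 (h1 hT)
      using 1
    ext z
    exact ⟨fun h => ⟨⟨z, h.2⟩, h.1, rfl⟩, by rintro ⟨w, hw, rfl⟩; exact ⟨hw, w.2⟩⟩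
  rw [hρ _ hsub (hT.inter hopen.measurableSet), hpre, ← setLIntegral_const, ← setLIntegral_const]
  exact ⟨setLIntegral_mono' hmeas fun z hz => ENNReal.ofReal_le_ofReal (hb z hz.2).2.1.le,
    setLIntegral_mono' hmeas fun z hz => ENNReal.ofReal_le_ofReal (hb z hz.2).2.2.le⟩

theorem IsContinuousVolume.isLocallyFiniteMeasure (hμ : IsContinuousVolume (n := n) μ) :
    IsLocallyFiniteMeasure μ := by
  refine ⟨fun x => ?_⟩
  obtain ⟨r, hr, hbt, -, c, -, -, C, hC, h⟩ := hμ.exists_ball x univ_mem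
  set φ := chartAt (Fin n → ℂ) x
  refine ⟨φ.symm '' ball (φ x) r, ?_, ?_⟩
  · rw [φ.symm_image_eq_source_inter_preimage hbt]
    exact (φ.isOpen_inter_preimage isOpen_ball).mem_nhds
      ⟨mem_chart_source _ x, mem_ball_self hr⟩
  · have := (h univ MeasurableSet.univ).2
    rw [univ_inter, preimage_univ, univ_inter] at this
    exact this.trans_lt (ENNReal.mul_lt_top hC.lt_top measure_ball_lt_top)

/-- The density `e^{-ψ}`. -/
def weightDensity {M : Type*} (ψ : M → EReal) (x : M) : ℝ≥0∞ := EReal.exp (-ψ x)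

theorem IsWeight.measurable_weightDensity {ψ : M → EReal} (hψ : IsWeight μ ψ) :
    Measurable (weightDensity ψ) :=
  (continuous_neg.measurable.comp hψ.measurable).ereal_exp

/-- Where `ψ ≤ B` the density is at least `e^{-B}`, and the volume is at least `c` times Lebesgue
measure on a small ball. This is where local boundedness of the weight from above enters. -/
theorem locallyDominates_withDensity (hμ : IsContinuousVolume (n := n) μ) {ψ : M → EReal}
    (hψ : IsWeight μ ψ) :
    LocallyDominates 𝓘(ℂ, Fin n → ℂ) volume (μ.withDensity (weightDensity ψ)) := by
  intro x
  obtain ⟨B, hB⟩ := hψ.locally_bdd_above x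
  obtain ⟨r, hr, hbt, hbU, c, hc, hc', C, -, h⟩ := hμ.exists_ball x hB
  have e₁ : extChartAt 𝓘(ℂ, Fin n → ℂ) x x = chartAt (Fin n → ℂ) x x := rfl
  have e₂ : ∀ z, (extChartAt 𝓘(ℂ, Fin n → ℂ) x).symm z = (chartAt (Fin n → ℂ) x).symm z :=
    fun z => rfl
  have e₃ : (extChartAt 𝓘(ℂ, Fin n → ℂ) x).target = (chartAt (Fin n → ℂ) x).target := by simp
  rw [e₁, e₃]
  simp_rw [e₂]
  set φ := chartAt (Fin n → ℂ) x
  have hw0 : EReal.exp (-(B : EReal)) ≠ 0 := by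
    rw [Ne, EReal.exp_eq_zero_iff, ← EReal.coe_neg]
    exact EReal.coe_ne_bot _
  have hw1 : EReal.exp (-(B : EReal)) ≠ ⊤ := by
    rw [Ne, EReal.exp_eq_top_iff, ← EReal.coe_neg]
    exact EReal.coe_ne_top _
  refine ⟨r, hr, hbt, (c * EReal.exp (-(B : EReal)))⁻¹,
    ENNReal.inv_ne_top.2 (mul_ne_zero hc hw0), fun g hg => ?_⟩
  have hae : AEMeasurable φ.symm (volume.restrict (ball (φ x) r)) :=
    (φ.continuousOn_symm.mono hbt).aemeasurable measurableSet_ball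
  rw [← lintegral_map' hg.aemeasurable hae, ← smul_eq_mul,
    ← lintegral_smul_measure]
  refine lintegral_mono' (Measure.le_iff.2 fun T hT => ?_) le_rfl
  rw [Measure.map_apply_of_aemeasurable hae hT, Measure.restrict_apply' measurableSet_ball,
    Measure.smul_apply, smul_eq_mul, ← ENNReal.mul_le_iff_le_inv (mul_ne_zero hc hw0)
      (ENNReal.mul_ne_top hc' hw1), mul_comm c, mul_assoc]
  have hA : MeasurableSet (T ∩ φ.symm '' ball (φ x) r) := by
    rw [φ.symm_image_eq_source_inter_preimage hbt]
    exact hT.inter (φ.isOpen_inter_preimage isOpen_ball).measurableSet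
  calc _ ≤ EReal.exp (-(B : EReal)) * μ (T ∩ φ.symm '' ball (φ x) r) := by
        gcongr
        exact (h T hT).1
    _ = ∫⁻ _ in T ∩ φ.symm '' ball (φ x) r, EReal.exp (-(B : EReal)) ∂μ :=
        (setLIntegral_const _ _).symm
    _ ≤ ∫⁻ y in T ∩ φ.symm '' ball (φ x) r, weightDensity ψ y ∂μ := by
        refine setLIntegral_mono' hA ?_
        rintro _ ⟨-, z, hz, rfl⟩
        exact EReal.exp_monotone (EReal.neg_le_neg_iff.2 (hbU z hz))
    _ = μ.withDensity (weightDensity ψ) (T ∩ φ.symm '' ball (φ x) r) :=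
        (withDensity_apply _ hA).symm
    _ ≤ _ := measure_mono inter_subset_left

end Volume

/-! ### Product measures and product weights -/

section Product

theorem LocallyDominates.prod {V₁ V₂ H₁ H₂ : Type*} [NormedAddCommGroup V₁] [NormedSpace ℂ V₁]
    [TopologicalSpace H₁] [NormedAddCommGroup V₂] [NormedSpace ℂ V₂] [TopologicalSpace H₂]
    [MeasurableSpace V₁] [MeasurableSpace V₂]
    {I₁ : ModelWithCorners ℂ V₁ H₁} {I₂ : ModelWithCorners ℂ V₂ H₂} {M₁ M₂ : Type*}
    [TopologicalSpace M₁] [TopologicalSpace M₂] [ChartedSpace H₁ M₁] [ChartedSpace H₂ M₂]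
    [MeasurableSpace M₁] [MeasurableSpace M₂] {m₁ : Measure V₁} {m₂ : Measure V₂} 
    {ν₁ : Measure M₁} {ν₂ : Measure M₂} [SFinite m₁] [SFinite m₂] [SFinite ν₁] [SFinite ν₂]
    (h₁ : LocallyDominates I₁ m₁ ν₁) (h₂ : LocallyDominates I₂ m₂ ν₂) :
    LocallyDominates (I₁.prod I₂) (m₁.prod m₂) (ν₁.prod ν₂) := by
  rintro ⟨x, y⟩
  obtain ⟨r₁, hr₁, ht₁, C₁, hC₁, hd₁⟩ := h₁ x
  obtain ⟨r₂, hr₂, ht₂, C₂, hC₂, hd₂⟩ := h₂ y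
  rw [extChartAt_prod, PartialEquiv.prod_target]
  change ∃ r > 0, ball (extChartAt I₁ x x, extChartAt I₂ y y) r ⊆ _ ∧ _
  have hsub : ball (extChartAt I₁ x x, extChartAt I₂ y y) (min r₁ r₂) ⊆
      ball (extChartAt I₁ x x) r₁ ×ˢ ball (extChartAt I₂ y y) r₂ := by
    rw [← ball_prod_same]
    exact prod_mono (ball_subset_ball (min_le_left _ _)) (ball_subset_ball (min_le_right _ _))
  refine ⟨min r₁ r₂, lt_min hr₁ hr₂, hsub.trans (prod_mono ht₁ ht₂), C₂ * C₁,
    ENNReal.mul_ne_top hC₂ hC₁, fun g hg => ?_⟩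
  calc _ ≤ ∫⁻ q in ball (extChartAt I₁ x x) r₁ ×ˢ ball (extChartAt I₂ y y) r₂,
        g ((extChartAt I₁ x).symm q.1, (extChartAt I₂ y).symm q.2) ∂(m₁.prod m₂) :=
        lintegral_mono_set hsub
    _ ≤ ∫⁻ z in ball (extChartAt I₁ x x) r₁, ∫⁻ w in ball (extChartAt I₂ y y) r₂,
        g ((extChartAt I₁ x).symm z, (extChartAt I₂ y).symm w) ∂m₂ ∂m₁ := by
        -- Only an inequality is needed here, and that half of Tonelli's theorem holds without
        -- measurability of the composition with the inverse charts.
        rw [← Measure.prod_restrict]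
        exact lintegral_prod_le _
    _ ≤ ∫⁻ z in ball (extChartAt I₁ x x) r₁,
        C₂ * ∫⁻ y, g ((extChartAt I₁ x).symm z, y) ∂ν₂ ∂m₁ :=
        lintegral_mono fun z => hd₂ _ (hg.comp measurable_prodMk_left)
    _ = C₂ * ∫⁻ z in ball (extChartAt I₁ x x) r₁,
        ∫⁻ y, g ((extChartAt I₁ x).symm z, y) ∂ν₂ ∂m₁ := lintegral_const_mul' _ _ hC₂
    _ ≤ C₂ * (C₁ * ∫⁻ x, ∫⁻ y, g (x, y) ∂ν₂ ∂ν₁) := by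
        gcongr
        exact hd₁ _ hg.lintegral_prod_right'
    _ = _ := by rw [lintegral_prod _ hg.aemeasurable, mul_assoc]

/-- In `EReal` the rule `-(a + b) = -a - b` can fail for `⊤ + ⊥`. Local upper bounds exclude the
value `⊤` for both weights. -/
theorem weightDensity_prodWeight {M₁ M₂ : Type*} [TopologicalSpace M₁] [MeasurableSpace M₁]
    [TopologicalSpace M₂] [MeasurableSpace M₂] {μ₁ : Measure M₁} {μ₂ : Measure M₂}
    {ψ₁ : M₁ → EReal} {ψ₂ : M₂ → EReal} (h₁ : IsWeight μ₁ ψ₁) (h₂ : IsWeight μ₂ ψ₂) :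
    weightDensity (prodWeight ψ₁ ψ₂) =
      fun p : M₁ × M₂ => weightDensity ψ₁ p.1 * weightDensity ψ₂ p.2 := by
  have t₁ : ∀ x, ψ₁ x ≠ ⊤ := fun x => by
    obtain ⟨C, hC⟩ := h₁.locally_bdd_above x
    exact (hC.self_of_nhds.trans_lt (EReal.coe_lt_top C)).ne
  have t₂ : ∀ x, ψ₂ x ≠ ⊤ := fun x => by
    obtain ⟨C, hC⟩ := h₂.locally_bdd_above x
    exact (hC.self_of_nhds.trans_lt (EReal.coe_lt_top C)).ne
  ext p
  rw [weightDensity, prodWeight, EReal.neg_add (.inr (t₂ _)) (.inl (t₁ _)), sub_eq_add_neg,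
    EReal.exp_add]
  rfl

theorem withDensity_prodWeight {M₁ M₂ : Type*} [TopologicalSpace M₁] [MeasurableSpace M₁]
    [BorelSpace M₁] [TopologicalSpace M₂] [MeasurableSpace M₂] [BorelSpace M₂]
    {μ₁ : Measure M₁} {μ₂ : Measure M₂} [SFinite μ₁] [SFinite μ₂]
    {ψ₁ : M₁ → EReal} {ψ₂ : M₂ → EReal} (h₁ : IsWeight μ₁ ψ₁) (h₂ : IsWeight μ₂ ψ₂) :
    (μ₁.prod μ₂).withDensity (weightDensity (prodWeight ψ₁ ψ₂)) =
      (μ₁.withDensity (weightDensity ψ₁)).prod (μ₂.withDensity (weightDensity ψ₂)) := by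
  rw [prod_withDensity h₁.measurable_weightDensity h₂.measurable_weightDensity,
    weightDensity_prodWeight h₁ h₂]

theorem bergmanNorm_eq_sqNorm {M : Type*} [MeasurableSpace M] {E : M → Type*}
    [∀ x, NormedAddCommGroup (E x)] [∀ x, InnerProductSpace ℂ (E x)] {μ : Measure M}
    {ψ : M → EReal} (hψ : Measurable (weightDensity ψ)) {f : ∀ x, E x}
    (hf : Measurable fun x => ‖f x‖) :
    bergmanNorm μ ψ f = sqNorm (μ.withDensity (weightDensity ψ)) f ^ (1 / 2 : ℝ) := by
  rw [bergmanNorm, sqNorm,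
    lintegral_withDensity_eq_lintegral_mul _ hψ (measurable_enorm_sq hf)]
  congr 1
  exact lintegral_congr fun x => mul_comm _ _

theorem bergmanNorm_eq_enorm {M : Type*} [MeasurableSpace M] {E : M → Type*}
    [∀ x, NormedAddCommGroup (E x)] [∀ x, InnerProductSpace ℂ (E x)] {μ : Measure M}
    {ψ : M → EReal} {ν : Measure M} {W : Submodule ℂ (∀ x, E x)} [IsReproducing ν W]
    (f : SectionL2 ν W) (h : bergmanNorm μ ψ f.1 = sqNorm ν f.1 ^ (1 / 2 : ℝ)) :
    bergmanNorm μ ψ f.1 = ‖f‖ₑ := by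
  rw [h, ← SectionL2.enorm_sq, ← ENNReal.rpow_natCast, ← ENNReal.rpow_mul]
  norm_num

end Product

/-! ### Translation from Hilbert spaces back to Bergman spaces -/

section MinimalExtensions

variable {V₁ V₂ H₁ H₂ : Type*} [NormedAddCommGroup V₁] [NormedSpace ℂ V₁] [TopologicalSpace H₁]
  [NormedAddCommGroup V₂] [NormedSpace ℂ V₂] [TopologicalSpace H₂]
  [FiniteDimensional ℂ V₁] [MeasurableSpace V₁] [BorelSpace V₁]
  {I₁ : ModelWithCorners ℂ V₁ H₁} {I₂ : ModelWithCorners ℂ V₂ H₂}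
  [I₁.Boundaryless] [I₂.Boundaryless]
  {M₁ M₂ : Type*} {E₁ : M₁ → Type*} {E₂ : M₂ → Type*}
  [∀ x, NormedAddCommGroup (E₁ x)] [∀ x, InnerProductSpace ℂ (E₁ x)]
  [∀ y, NormedAddCommGroup (E₂ y)] [∀ y, InnerProductSpace ℂ (E₂ y)]
  [TopologicalSpace M₁] [TopologicalSpace M₂]
  {F₁ : Type*} [NormedAddCommGroup F₁] [InnerProductSpace ℂ F₁]
  {F₂ : Type*} [NormedAddCommGroup F₂] [InnerProductSpace ℂ F₂]
  [TopologicalSpace (TotalSpace F₁ E₁)] [TopologicalSpace (TotalSpace F₂ E₂)]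
  [FiberBundle F₁ E₁] [FiberBundle F₂ E₂]
  [FiniteDimensional ℂ F₁] [FiniteDimensional ℂ F₂]
  [VectorBundle ℂ F₁ E₁] [VectorBundle ℂ F₂ E₂]
  [ChartedSpace H₁ M₁] [ChartedSpace H₂ M₂]
  [IsManifold I₁ ω M₁] [IsManifold I₂ ω M₂]
  [ContMDiffVectorBundle ω F₁ E₁ I₁] [ContMDiffVectorBundle ω F₂ E₂ I₂]
  [MeasurableSpace M₁] [BorelSpace M₁] [MeasurableSpace M₂] [BorelSpace M₂]
  [SecondCountableTopologyEither M₁ M₂]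
  [IsContinuousHermitianBundle F₁ E₁] [IsContinuousHermitianBundle F₂ E₂]
  [FiniteDimensional ℂ V₂] [MeasurableSpace V₂] [BorelSpace V₂] [BorelSpace (V₁ × V₂)]

/-- The product property of minimal extensions. -/
theorem isMinimalExtension_product {l₁ : Measure V₁} {l₂ : Measure V₂} [l₁.IsAddHaarMeasure]
    [l₂.IsAddHaarMeasure] [SFinite l₁] [SFinite l₂] [(l₁.prod l₂).IsAddHaarMeasure]
    {μ₁ : Measure M₁} {μ₂ : Measure M₂} [SFinite μ₁] [SFinite μ₂]
    {ψ₁ : M₁ → EReal} (hψ₁ : IsWeight μ₁ ψ₁) {ψ₂ : M₂ → EReal} (hψ₂ : IsWeight μ₂ ψ₂)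
    (d₁ : LocallyDominates I₁ l₁ (μ₁.withDensity (weightDensity ψ₁)))
    (d₂ : LocallyDominates I₂ l₂ (μ₂.withDensity (weightDensity ψ₂)))
    (S₁ : Set M₁) (S₂ : Set M₂)
    {f₁ : ∀ x, E₁ x} (hf₁ : f₁ ∈ bergmanSpace I₁ F₁ μ₁ ψ₁)
    {f₂ : ∀ y, E₂ y} (hf₂ : f₂ ∈ bergmanSpace I₂ F₂ μ₂ ψ₂) (m₁ m₂ : ℕ) :
    (∃! G₁ : ∀ x, E₁ x, IsMinimalExtension I₁ F₁ μ₁ ψ₁ m₁ S₁ f₁ G₁) ∧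
    (∃! G₂ : ∀ y, E₂ y, IsMinimalExtension I₂ F₂ μ₂ ψ₂ m₂ S₂ f₂ G₂) ∧
    (∃! G : ∀ p, ExtTensor E₁ E₂ p, IsMinimalExtension (I₁.prod I₂) (TensorFiber F₁ F₂)
      (μ₁.prod μ₂) (prodWeight ψ₁ ψ₂) (m₁ + m₂) (S₁ ×ˢ S₂) (tensorSection f₁ f₂) G) ∧
    ∀ (G₁ : ∀ x, E₁ x) (G₂ : ∀ y, E₂ y) (G : ∀ p, ExtTensor E₁ E₂ p),
      IsMinimalExtension I₁ F₁ μ₁ ψ₁ m₁ S₁ f₁ G₁ →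
      IsMinimalExtension I₂ F₂ μ₂ ψ₂ m₂ S₂ f₂ G₂ →
      IsMinimalExtension (I₁.prod I₂) (TensorFiber F₁ F₂)
        (μ₁.prod μ₂) (prodWeight ψ₁ ψ₂) (m₁ + m₂) (S₁ ×ˢ S₂) (tensorSection f₁ f₂) G →
      bergmanNorm μ₁ ψ₁ G₁ * bergmanNorm μ₂ ψ₂ G₂ ≤
          bergmanNorm (μ₁.prod μ₂) (prodWeight ψ₁ ψ₂) G ∧
      (VanishesUpTo I₁ F₁ (m₁ - 1) S₁ f₁ → VanishesUpTo I₂ F₂ (m₂ - 1) S₂ f₂ →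
        G = tensorSection G₁ G₂ ∧
        bergmanNorm (μ₁.prod μ₂) (prodWeight ψ₁ ψ₂) G =
          bergmanNorm μ₁ ψ₁ G₁ * bergmanNorm μ₂ ψ₂ G₂) := by
  set ν₁ := μ₁.withDensity (weightDensity ψ₁)
  set ν₂ := μ₂.withDensity (weightDensity ψ₂)
  have d : LocallyDominates (I₁.prod I₂) (l₁.prod l₂) (ν₁.prod ν₂) := d₁.prod d₂
  have : IsReproducing ν₁ (holomorphicSections I₁ F₁ E₁) := isReproducing_holomorphicSections d₁
  have : IsReproducing ν₂ (holomorphicSections I₂ F₂ E₂) := isReproducing_holomorphicSections d₂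
  have : IsReproducing (ν₁.prod ν₂)
      (holomorphicSections (I₁.prod I₂) (TensorFiber F₁ F₂) (ExtTensor E₁ E₂)) :=
    isReproducing_holomorphicSections d
  have N₁ : ∀ f : ∀ x, E₁ x, IsHolomorphicSection I₁ F₁ f →
      bergmanNorm μ₁ ψ₁ f = sqNorm ν₁ f ^ (1 / 2 : ℝ) := fun f hf =>
    bergmanNorm_eq_sqNorm hψ₁.measurable_weightDensity (hf.measurable_norm F₁)
  have N₂ : ∀ f : ∀ y, E₂ y, IsHolomorphicSection I₂ F₂ f →
      bergmanNorm μ₂ ψ₂ f = sqNorm ν₂ f ^ (1 / 2 : ℝ) := fun f hf =>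
    bergmanNorm_eq_sqNorm hψ₂.measurable_weightDensity (hf.measurable_norm F₂)
  have N : ∀ f : ∀ p, ExtTensor E₁ E₂ p,
      IsHolomorphicSection (I₁.prod I₂) (TensorFiber F₁ F₂) f →
      bergmanNorm (μ₁.prod μ₂) (prodWeight ψ₁ ψ₂) f =
        sqNorm (ν₁.prod ν₂) f ^ (1 / 2 : ℝ) := fun f hf => by
    rw [← withDensity_prodWeight hψ₁ hψ₂]
    refine bergmanNorm_eq_sqNorm ?_ (hf.measurable_norm (TensorFiber F₁ F₂))
    rw [weightDensity_prodWeight hψ₁ hψ₂]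
    exact (hψ₁.measurable_weightDensity.comp measurable_fst).mul
      (hψ₂.measurable_weightDensity.comp measurable_snd)
  have fin₁ : sqNorm ν₁ f₁ < ⊤ := by
    have := hf₁.2
    rwa [N₁ f₁ hf₁.1, ENNReal.rpow_lt_top_iff_of_pos (by norm_num)] at this
  have fin₂ : sqNorm ν₂ f₂ < ⊤ := by
    have := hf₂.2
    rwa [N₂ f₂ hf₂.1, ENNReal.rpow_lt_top_iff_of_pos (by norm_num)] at this
  set u₁ : SectionL2 ν₁ (holomorphicSections I₁ F₁ E₁) := SectionL2.mk ν₁ f₁ hf₁.1 fin₁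
  set u₂ : SectionL2 ν₂ (holomorphicSections I₂ F₂ E₂) := SectionL2.mk ν₂ f₂ hf₂.1 fin₂
  refine ⟨existsUnique_isMinimalExtension d₁ N₁ m₁ S₁ u₁,
    existsUnique_isMinimalExtension d₂ N₂ m₂ S₂ u₂,
    existsUnique_isMinimalExtension d N (m₁ + m₂) (S₁ ×ˢ S₂) (u₁.tensor u₂), ?_⟩
  intro G₁ G₂ G hG₁ hG₂ hG
  obtain ⟨g₁, rfl, h₁, h₁'⟩ := (isMinimalExtension_iff d₁ N₁ m₁ S₁ u₁ G₁).1 hG₁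
  obtain ⟨g₂, rfl, h₂, h₂'⟩ := (isMinimalExtension_iff d₂ N₂ m₂ S₂ u₂ G₂).1 hG₂
  obtain ⟨g, rfl, h, h'⟩ :=
    (isMinimalExtension_iff d N (m₁ + m₂) (S₁ ×ˢ S₂) (u₁.tensor u₂) G).1 hG
  -- From here on all Bergman norms are norms in the Hilbert spaces, and both claims are the
  -- abstract statements proved above.
  rw [bergmanNorm_eq_enorm g₁ (N₁ _ g₁.2.1), bergmanNorm_eq_enorm g₂ (N₂ _ g₂.2.1),
    bergmanNorm_eq_enorm g (N _ g.2.1), ← ofReal_norm, ← ofReal_norm, ← ofReal_norm,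
    ← ENNReal.ofReal_mul (norm_nonneg _)]
  refine ⟨ENNReal.ofReal_le_ofReal (norm_mul_norm_le d₁ h₁ h₁' h₂ h₂' h), fun v₁ v₂ => ?_⟩
  have w₁ : u₁ ∈ vanishingSubmodule I₁ F₁ E₁ ν₁ (m₁ - 1) S₁ := by
    have := (coincideUpTo_iff_sub hf₁.1 (holomorphicSections I₁ F₁ E₁).zero_mem).1 v₁
    rwa [sub_zero] at this
  have w₂ : u₂ ∈ vanishingSubmodule I₂ F₂ E₂ ν₂ (m₂ - 1) S₂ := by
    have := (coincideUpTo_iff_sub hf₂.1 (holomorphicSections I₂ F₂ E₂).zero_mem).1 v₂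
    rwa [sub_zero] at this
  obtain rfl := eq_tensor d₁ h₁ h₁' h₂ h₂' h h' w₁ w₂
  exact ⟨rfl, by rw [SectionL2.norm_tensor]⟩

end MinimalExtensions

end BergmanProd

end

/-! ### The theorem for manifolds modelled on `ℂⁿ` -/

open BergmanProd in
theorem mainTheorem2
    {n₁ n₂ r₁ r₂ : ℕ}
    -- the complex manifolds
    {Ω₁ : Type*} [TopologicalSpace Ω₁] [T2Space Ω₁] [SecondCountableTopology Ω₁]
    [ChartedSpace (Fin n₁ → ℂ) Ω₁] [IsManifold 𝓘(ℂ, Fin n₁ → ℂ) ω Ω₁]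
    [MeasurableSpace Ω₁] [BorelSpace Ω₁]
    {Ω₂ : Type*} [TopologicalSpace Ω₂] [T2Space Ω₂] [SecondCountableTopology Ω₂]
    [ChartedSpace (Fin n₂ → ℂ) Ω₂] [IsManifold 𝓘(ℂ, Fin n₂ → ℂ) ω Ω₂]
    [MeasurableSpace Ω₂] [BorelSpace Ω₂]
    -- the holomorphic vector bundles with continuous Hermitian metrics
    {E₁ : Ω₁ → Type*} [∀ x, NormedAddCommGroup (E₁ x)] [∀ x, InnerProductSpace ℂ (E₁ x)]
    [TopologicalSpace (TotalSpace (EuclideanSpace ℂ (Fin r₁)) E₁)]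
    [FiberBundle (EuclideanSpace ℂ (Fin r₁)) E₁] [VectorBundle ℂ (EuclideanSpace ℂ (Fin r₁)) E₁]
    [ContMDiffVectorBundle ω (EuclideanSpace ℂ (Fin r₁)) E₁ 𝓘(ℂ, Fin n₁ → ℂ)]
    [IsContinuousHermitianBundle (EuclideanSpace ℂ (Fin r₁)) E₁]
    {E₂ : Ω₂ → Type*} [∀ y, NormedAddCommGroup (E₂ y)] [∀ y, InnerProductSpace ℂ (E₂ y)]
    [TopologicalSpace (TotalSpace (EuclideanSpace ℂ (Fin r₂)) E₂)]
    [FiberBundle (EuclideanSpace ℂ (Fin r₂)) E₂] [VectorBundle ℂ (EuclideanSpace ℂ (Fin r₂)) E₂]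
    [ContMDiffVectorBundle ω (EuclideanSpace ℂ (Fin r₂)) E₂ 𝓘(ℂ, Fin n₂ → ℂ)]
    [IsContinuousHermitianBundle (EuclideanSpace ℂ (Fin r₂)) E₂]
    -- the volume forms and the weights
    (μ₁ : Measure Ω₁) (hμ₁ : IsContinuousVolume (n := n₁) μ₁)
    (μ₂ : Measure Ω₂) (hμ₂ : IsContinuousVolume (n := n₂) μ₂)
    (ψ₁ : Ω₁ → EReal) (hψ₁ : IsWeight μ₁ ψ₁)
    (ψ₂ : Ω₂ → EReal) (hψ₂ : IsWeight μ₂ ψ₂)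
    -- the closed subsets, the sections and the orders
    (S₁ : Set Ω₁) (hS₁ : IsClosed S₁) (S₂ : Set Ω₂) (hS₂ : IsClosed S₂)
    (f₁ : ∀ x, E₁ x)
    (hf₁ : f₁ ∈ bergmanSpace 𝓘(ℂ, Fin n₁ → ℂ) (EuclideanSpace ℂ (Fin r₁)) μ₁ ψ₁)
    (f₂ : ∀ y, E₂ y)
    (hf₂ : f₂ ∈ bergmanSpace 𝓘(ℂ, Fin n₂ → ℂ) (EuclideanSpace ℂ (Fin r₂)) μ₂ ψ₂)
    (m₁ m₂ : ℕ) :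
    -- the minimal extensions exist and are unique
    (∃! G₁ : ∀ x, E₁ x, IsMinimalExtension 𝓘(ℂ, Fin n₁ → ℂ) (EuclideanSpace ℂ (Fin r₁))
      μ₁ ψ₁ m₁ S₁ f₁ G₁) ∧
    (∃! G₂ : ∀ y, E₂ y, IsMinimalExtension 𝓘(ℂ, Fin n₂ → ℂ) (EuclideanSpace ℂ (Fin r₂))
      μ₂ ψ₂ m₂ S₂ f₂ G₂) ∧
    (∃! G : ∀ p, ExtTensor E₁ E₂ p, IsMinimalExtension
      (𝓘(ℂ, Fin n₁ → ℂ).prod 𝓘(ℂ, Fin n₂ → ℂ))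
      (TensorFiber (EuclideanSpace ℂ (Fin r₁)) (EuclideanSpace ℂ (Fin r₂)))
      (μ₁.prod μ₂) (prodWeight ψ₁ ψ₂) (m₁ + m₂) (S₁ ×ˢ S₂) (tensorSection f₁ f₂) G) ∧
    -- the product property
    ∀ (G₁ : ∀ x, E₁ x) (G₂ : ∀ y, E₂ y) (G : ∀ p, ExtTensor E₁ E₂ p),
      IsMinimalExtension 𝓘(ℂ, Fin n₁ → ℂ) (EuclideanSpace ℂ (Fin r₁)) μ₁ ψ₁ m₁ S₁ f₁ G₁ →
      IsMinimalExtension 𝓘(ℂ, Fin n₂ → ℂ) (EuclideanSpace ℂ (Fin r₂)) μ₂ ψ₂ m₂ S₂ f₂ G₂ →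
      IsMinimalExtension (𝓘(ℂ, Fin n₁ → ℂ).prod 𝓘(ℂ, Fin n₂ → ℂ))
        (TensorFiber (EuclideanSpace ℂ (Fin r₁)) (EuclideanSpace ℂ (Fin r₂)))
        (μ₁.prod μ₂) (prodWeight ψ₁ ψ₂) (m₁ + m₂) (S₁ ×ˢ S₂) (tensorSection f₁ f₂) G →
      bergmanNorm μ₁ ψ₁ G₁ * bergmanNorm μ₂ ψ₂ G₂ ≤
          bergmanNorm (μ₁.prod μ₂) (prodWeight ψ₁ ψ₂) G ∧
      (VanishesUpTo 𝓘(ℂ, Fin n₁ → ℂ) (EuclideanSpace ℂ (Fin r₁)) (m₁ - 1) S₁ f₁ →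
        VanishesUpTo 𝓘(ℂ, Fin n₂ → ℂ) (EuclideanSpace ℂ (Fin r₂)) (m₂ - 1) S₂ f₂ →
        G = tensorSection G₁ G₂ ∧
        bergmanNorm (μ₁.prod μ₂) (prodWeight ψ₁ ψ₂) G =
          bergmanNorm μ₁ ψ₁ G₁ * bergmanNorm μ₂ ψ₂ G₂) := by
  -- On a second countable space local finiteness gives σ-finiteness, which the product measure and
  -- Fubini's theorem require.
  have : IsLocallyFiniteMeasure μ₁ := hμ₁.isLocallyFiniteMeasure
  have : IsLocallyFiniteMeasure μ₂ := hμ₂.isLocallyFiniteMeasure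
  have : ((volume : Measure (Fin n₁ → ℂ)).prod
      (volume : Measure (Fin n₂ → ℂ))).IsAddHaarMeasure :=
    Measure.prod.instIsAddHaarMeasure _ _
  exact isMinimalExtension_product (l₁ := volume) (l₂ := volume) hψ₁ hψ₂
    (locallyDominates_withDensity hμ₁ hψ₁) (locallyDominates_withDensity hμ₂ hψ₂)
    S₁ S₂ hf₁ hf₂ m₁ m₂
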